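/- Let $\Omega\subset\mathbb{C}^2$ be a bounded pseudoconvex domain with smooth boundary, with coordinates $(z,w)$ in which $\Omega$ is Hartogs, i.e. $(e^{i\theta}z,w)\in\Omega$ whenever $(z,w)\in\Omega$ and $\theta\in\mathbb{R}$. Let $\tilde\delta$ be the signed distance to $b\Omega$ (negative in $\Omega$, positive outside $\overline\Omega$). Call a set $K\subset\mathbb{C}^2$ disk-like if $(z,w)\in K$ implies $(rz,w)\in K$ for all $0\le r\le1$, and annulus-like if $(z,w)\in K$ implies $(0,w)\notin K$. Let $W\subset b\Omega$ be the set of weakly pseudoconvex points (boundary points at which $\Omega$ is not strictly pseudoconvex), and let $M_1=\{p\in W:\frac{\partial\tilde\delta}{\partial z}(p)=0\}$ and $M_2=\{p\in W:\frac{\partial\tilde\delta}{\partial z}(p)\ne0\}$. Assume that $\Omega$ has regular weakly pseudoconvex points: $M_1\cap\overline{M_2}=\emptyset$, $M_1$ has finitely many connected components, and each of them is disk-like or annulus-like. Suppose that for every annulus-like connected component $K$ of $$\left\{p\in b\Omega:\ \frac{\partial\tilde\delta}{\partial z}(p)=0\ \text{ and }\ \frac{\partial^2\tilde\delta}{\partial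 z\,\partial\bar z}(p)=0\right\}$$ there are constants $B_K\ge A_K>0$ and $C_K>0$ such that $A_K\le|z|^2\le B_K$ and $\left|\frac{\partial^2\tilde\delta}{\partial w\,\partial\bar z}\right|\le\frac{C_K}{|z|}$ on $K$. Then the Diederich–Fornæss index of $\Omega$, that is, the supremum of all $\tau\in(0,1)$ for which there is a smooth defining function $\rho$ of $\Omega$ (a smooth $\rho:\mathbb{C}^2\to\mathbb{R}$ with $\Omega=\{\rho<0\}$ and $d\rho\ne0$ on $b\Omega$) such that $-(-\rho)^\tau$ is plurisubharmonic on $\Omega$, is at least $$\min_K\ \frac{\pi}{2C_K\log\frac{B_K}{A_K}+\pi},$$ the minimum being taken over all annulus-like components $K$ (and read as $1$ if there are none). In particular, if the same constants $A,B,C$ serve for every such $K$, the index is at least $\frac{\pi}{2C\log\frac BA+\pi}$. -/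

import Mathlib

open scoped ContDiff

noncomputable section

/-- Complex Euclidean space of dimension two; a point `p` has coordinates `z = p 0`, `w = p 1`. -/
abbrev C2 : Type := EuclideanSpace ℂ (Fin 2)

/-- The Wirtinger derivative with respect to the `j`-th complex coordinate, that is
`(1/2) (∂/∂x_j - i ∂/∂y_j)`. -/
def wirt (j : Fin 2) (f : C2 → ℂ) (p : C2) : ℂ :=
  (1 / 2 : ℂ) * (fderiv ℝ f p (EuclideanSpace.single j 1)
    - Complex.I * fderiv ℝ f p (EuclideanSpace.single j Complex.I))

/-- The conjugate Wirtinger derivative with respect to the `j`-th complex coordinate, that is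
`(1/2) (∂/∂x_j + i ∂/∂y_j)`. -/
def wirtBar (j : Fin 2) (f : C2 → ℂ) (p : C2) : ℂ :=
  (1 / 2 : ℂ) * (fderiv ℝ f p (EuclideanSpace.single j 1)
    + Complex.I * fderiv ℝ f p (EuclideanSpace.single j Complex.I))

/-- The complex Hessian (Levi form) `∑ j k, ∂²φ/∂z_j∂z̄_k (p) t_j t̄_k` of a real-valued
function; the sum is real for `C²` functions. -/
def complexHessian (φ : C2 → ℝ) (p t : C2) : ℝ :=
  (∑ j : Fin 2, ∑ k : Fin 2,
    wirt j (wirtBar k (fun x => (φ x : ℂ))) p * t j * (starRingEnd ℂ) (t k)).re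

/-- A `C²` function is plurisubharmonic on `Ω` if its complex Hessian is positive semi-definite at
every point of `Ω`. -/
def IsC2Plurisubharmonic (Ω : Set C2) (φ : C2 → ℝ) : Prop :=
  ContDiffOn ℝ 2 φ Ω ∧ ∀ p ∈ Ω, ∀ t : C2, 0 ≤ complexHessian φ p t

/-- `r` is a defining function of class `C^n` for `Ω`. -/
def IsDefiningFunction (n : ℕ∞) (Ω : Set C2) (r : C2 → ℝ) : Prop :=
  ContDiff ℝ n r ∧ Ω = {p | r p < 0} ∧ ∀ p ∈ frontier Ω, fderiv ℝ r p ≠ 0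

/-- `Ω` has smooth boundary. -/
def HasSmoothBoundary (Ω : Set C2) : Prop :=
  ∃ r : C2 → ℝ, IsDefiningFunction (⊤ : ℕ∞) Ω r

/-- `t` is a complex tangent vector at `p` to the level set of `r`. -/
def IsComplexTangent (r : C2 → ℝ) (p t : C2) : Prop :=
  ∑ j : Fin 2, t j * wirt j (fun x => (r x : ℂ)) p = 0

/-- Pseudoconvexity of a domain with `C²` boundary: the Levi form of any `C²` defining
function is nonnegative on complex tangent vectors at every boundary point. -/
def IsLeviPseudoconvex (Ω : Set C2) : Prop :=
  ∀ r : C2 → ℝ, IsDefiningFunction 2 Ω r → ∀ p ∈ frontier Ω, ∀ t : C2,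
    IsComplexTangent r p t → 0 ≤ complexHessian r p t

/-- `Ω` is strictly pseudoconvex at the boundary point `p`. -/
def IsStrictlyPseudoconvexAt (Ω : Set C2) (p : C2) : Prop :=
  ∀ r : C2 → ℝ, IsDefiningFunction 2 Ω r → ∀ t : C2, t ≠ 0 →
    IsComplexTangent r p t → 0 < complexHessian r p t

/-- The set of weakly pseudoconvex boundary points. -/
def weaklyPseudoconvexPoints (Ω : Set C2) : Set C2 :=
  {p | p ∈ frontier Ω ∧ ¬ IsStrictlyPseudoconvexAt Ω p}

open Classical in
/-- The signed distance to the boundary of `Ω`: negative inside, positive outside. -/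
def signedBdryDist (Ω : Set C2) (p : C2) : ℝ :=
  if p ∈ closure Ω then - Metric.infDist p (frontier Ω) else Metric.infDist p (frontier Ω)

/-- The signed distance as a complex-valued function, to which Wirtinger derivatives apply. -/
def signedBdryDistC (Ω : Set C2) (p : C2) : ℂ := (signedBdryDist Ω p : ℂ)

/-- `Ω` is invariant under rotations in the first coordinate. -/
def IsHartogs (Ω : Set C2) : Prop :=
  ∀ p ∈ Ω, ∀ θ : ℝ, (!₂[Complex.exp (θ * Complex.I) * p 0, p 1] : C2) ∈ Ω

/-- Weakly pseudoconvex points at which `∂δ̃/∂z = 0`. -/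
def weakSet₁ (Ω : Set C2) : Set C2 :=
  {p | p ∈ weaklyPseudoconvexPoints Ω ∧ wirt 0 (signedBdryDistC Ω) p = 0}

/-- Weakly pseudoconvex points at which `∂δ̃/∂z ≠ 0`. -/
def weakSet₂ (Ω : Set C2) : Set C2 :=
  {p | p ∈ weaklyPseudoconvexPoints Ω ∧ wirt 0 (signedBdryDistC Ω) p ≠ 0}

/-- The collection of connected components of a subset `S` of `ℂ²`. -/
def componentsOf (S : Set C2) : Set (Set C2) :=
  {K | ∃ p ∈ S, K = connectedComponentIn S p}

/-- If `(z, w) ∈ K`, then `(r z, w) ∈ K` for all `0 ≤ r ≤ 1`. -/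
def IsDiskLike (K : Set C2) : Prop :=
  ∀ p ∈ K, ∀ r : ℝ, 0 ≤ r → r ≤ 1 → (!₂[(r : ℂ) * p 0, p 1] : C2) ∈ K

/-- If `(z, w) ∈ K`, then `(0, w) ∉ K`. -/
def IsAnnulusLike (K : Set C2) : Prop :=
  ∀ p ∈ K, (!₂[0, p 1] : C2) ∉ K

/-- `Ω` has regular weakly pseudoconvex points. -/
def HasRegularWeaklyPseudoconvexPoints (Ω : Set C2) : Prop :=
  weakSet₁ Ω ∩ closure (weakSet₂ Ω) = ∅ ∧
  (componentsOf (weakSet₁ Ω)).Finite ∧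
  ∀ K ∈ componentsOf (weakSet₁ Ω), IsDiskLike K ∨ IsAnnulusLike K

/-- The set of boundary points at which `∂δ̃/∂z = 0` and `∂²δ̃/∂z∂z̄ = 0`. -/
def criticalSet (Ω : Set C2) : Set C2 :=
  {p | p ∈ frontier Ω ∧ wirt 0 (signedBdryDistC Ω) p = 0 ∧
    wirt 0 (wirtBar 0 (signedBdryDistC Ω)) p = 0}

/-- The annulus-like connected components of `criticalSet Ω`. -/
def annulusLikeComponents (Ω : Set C2) : Set (Set C2) :=
  {K | K ∈ componentsOf (criticalSet Ω) ∧ IsAnnulusLike K}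

/-- `τ ∈ (0, 1)` is a Diederich-Fornæss exponent for `Ω`: there is a smooth defining function `ρ`
such that `-(-ρ)^τ` is plurisubharmonic on `Ω`. -/
def IsDFExponent (Ω : Set C2) (τ : ℝ) : Prop :=
  0 < τ ∧ τ < 1 ∧ ∃ ρ : C2 → ℝ, IsDefiningFunction (⊤ : ℕ∞) Ω ρ ∧
    IsC2Plurisubharmonic Ω (fun p => -((-ρ p) ^ τ))

/-- The Diederich-Fornæss index: the supremum of all Diederich-Fornæss exponents. -/
def dfIndex (Ω : Set C2) : ℝ := sSup {τ : ℝ | IsDFExponent Ω τ}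

end

/-!
The defining function is `ρ = d exp ψ`, where `d` is a smooth extension of the signed boundary
distance. Near a strictly pseudoconvex boundary point `-(-ρ) ^ τ` is plurisubharmonic for every `ψ`.
At a weakly pseudoconvex point `p` the Levi form of `d` on the tangential field `(∂d/∂w, -∂d/∂z)`
vanishes along with its derivatives in the directions of the boundary, so that to leading order the
complex Hessian of `-(-ρ) ^ τ` is a Hermitian `2 × 2` form whose determinant is positive as soon as
`ψ` satisfies a strict inequality at `p` alone. This condition depends only on the germ of `ψ`, so
weights found separately on `M₂` and on the components of `M₁` can be glued.

The rotational symmetry provides these weights. On `M₂` the function `-log (z ∂d/∂z)` satisfies the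
non-strict inequality, and on a disk-like component, where `∂²d/∂z∂w̄` vanishes, so does `ψ = 0`; an
extra term `-ε ‖x‖²` makes both strict. On an annulus-like component `ψ` is a function `f` of
`u = log |z|²`, and the condition becomes `f'' < -k (4 C² + f' ²)` with `k = τ / (1 - τ)`. The
extremal solution `(1 / k) log cos (2 k C (u - u₀))` exists on a closed interval of length
`log (B / A)` precisely when `2 k C log (B / A) < π`, that is, `τ < π / (2 C log (B / A) + π)`.

A convex cutoff of `-(-ρ) ^ τ` makes it plurisubharmonic on all of `Ω` without changing it near the
boundary.
-/

open scoped Gradient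
open Complex ComplexConjugate Filter Set Topology

section WirtingerCalculus

variable {f g : C2 → ℂ} {p : C2}

theorem C2.eq_sum_re_im_smul (v : C2) :
    v = ∑ j : Fin 2, ((v j).re • (EuclideanSpace.single j (1 : ℂ) : C2)
      + (v j).im • (EuclideanSpace.single j I : C2)) := by
  ext i
  fin_cases i <;> simp [Fin.sum_univ_two, Complex.re_add_im]

theorem fderiv_eq_wirt (f : C2 → ℂ) (p v : C2) :
    fderiv ℝ f p v = (v 0 * wirt 0 f p + conj (v 0) * wirtBar 0 f p)
      + (v 1 * wirt 1 f p + conj (v 1) * wirtBar 1 f p) := by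
  conv_lhs => rw [C2.eq_sum_re_im_smul v]
  simp only [Fin.sum_univ_two, map_add, map_smul, Complex.real_smul, wirt, wirtBar]
  rw [← Complex.re_add_im (v 0), ← Complex.re_add_im (v 1)]
  simp only [map_add, map_mul, conj_ofReal, conj_I, add_re, add_im, ofReal_re, ofReal_im, mul_re,
    mul_im, I_re, I_im, mul_zero, mul_one, sub_zero, add_zero, zero_add]
  ring_nf
  simp only [I_sq]
  ring

theorem wirtBar_conj (j : Fin 2) (f : C2 → ℂ) (p : C2) :
    wirtBar j (fun x => conj (f x)) p = conj (wirt j f p) := by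
  have h : fderiv ℝ (fun x => conj (f x)) p = (conjCLE : ℂ →L[ℝ] ℂ) ∘L fderiv ℝ f p :=
    conjCLE.comp_fderiv (f := f) (x := p)
  simp [wirt, wirtBar, h, map_ofNat]

theorem wirt_conj (j : Fin 2) (f : C2 → ℂ) (p : C2) :
    wirt j (fun x => conj (f x)) p = conj (wirtBar j f p) := by
  rw [← conj_conj (wirt j _ p), ← wirtBar_conj]
  simp only [conj_conj]

theorem conj_wirt_of_conj_eq (hf : ∀ x, conj (f x) = f x) (j : Fin 2) (p : C2) :
    conj (wirt j f p) = wirtBar j f p := by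
  simp only [← wirtBar_conj, hf]

theorem conj_wirtBar_of_conj_eq (hf : ∀ x, conj (f x) = f x) (j : Fin 2) (p : C2) :
    conj (wirtBar j f p) = wirt j f p := by
  simp only [← wirt_conj, hf]

theorem conj_wirt_ofReal (j : Fin 2) (φ : C2 → ℝ) (p : C2) :
    conj (wirt j (fun x => (φ x : ℂ)) p) = wirtBar j (fun x => (φ x : ℂ)) p :=
  conj_wirt_of_conj_eq (fun _ => conj_ofReal _) j p

theorem wirt_add (j : Fin 2) (hf : DifferentiableAt ℝ f p) (hg : DifferentiableAt ℝ g p) :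
    wirt j (fun x => f x + g x) p = wirt j f p + wirt j g p := by
  simp only [wirt, fderiv_fun_add hf hg, add_apply]
  ring

theorem wirtBar_add (j : Fin 2) (hf : DifferentiableAt ℝ f p) (hg : DifferentiableAt ℝ g p) :
    wirtBar j (fun x => f x + g x) p = wirtBar j f p + wirtBar j g p := by
  simp only [wirtBar, fderiv_fun_add hf hg, add_apply]
  ring

theorem wirt_sub (j : Fin 2) (hf : DifferentiableAt ℝ f p) (hg : DifferentiableAt ℝ g p) :
    wirt j (fun x => f x - g x) p = wirt j f p - wirt j g p := by
  simp only [wirt, fderiv_fun_sub hf hg, sub_apply]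
  ring

theorem wirt_mul (j : Fin 2) (hf : DifferentiableAt ℝ f p) (hg : DifferentiableAt ℝ g p) :
    wirt j (fun x => f x * g x) p = f p * wirt j g p + wirt j f p * g p := by
  simp only [wirt, fderiv_fun_mul hf hg, add_apply, smul_apply, smul_eq_mul]
  ring

theorem wirtBar_mul (j : Fin 2) (hf : DifferentiableAt ℝ f p) (hg : DifferentiableAt ℝ g p) :
    wirtBar j (fun x => f x * g x) p = f p * wirtBar j g p + wirtBar j f p * g p := by
  simp only [wirtBar, fderiv_fun_mul hf hg, add_apply, smul_apply, smul_eq_mul]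
  ring

@[simp] theorem wirt_const (j : Fin 2) (c : ℂ) (p : C2) : wirt j (fun _ => c) p = 0 := by
  simp [wirt]

@[simp] theorem wirtBar_const (j : Fin 2) (c : ℂ) (p : C2) : wirtBar j (fun _ => c) p = 0 := by
  simp [wirtBar]

theorem contDiff_coord {n : WithTop ℕ∞} (i : Fin 2) : ContDiff ℝ n (fun x : C2 => x i) :=
  ((EuclideanSpace.proj i : C2 →L[ℂ] ℂ).restrictScalars ℝ).contDiff

theorem fderiv_coord (i : Fin 2) (p v : C2) : fderiv ℝ (fun x : C2 => x i) p v = v i :=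
  congrArg (· v) ((EuclideanSpace.proj i : C2 →L[ℂ] ℂ).restrictScalars ℝ).hasFDerivAt.fderiv

theorem wirt_coord (j i : Fin 2) (p : C2) :
    wirt j (fun x : C2 => x i) p = if i = j then 1 else 0 := by
  simp only [wirt, fderiv_coord]
  by_cases h : i = j
  · subst h; simp; norm_num
  · simp [h]

theorem wirtBar_coord (j i : Fin 2) (p : C2) : wirtBar j (fun x : C2 => x i) p = 0 := by
  simp only [wirtBar, fderiv_coord]
  by_cases h : i = j
  · subst h; simp
  · simp [h]

theorem wirt_conj_coord (j i : Fin 2) (p : C2) : wirt j (fun x : C2 => conj (x i)) p = 0 := by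
  rw [wirt_conj, wirtBar_coord, map_zero]

theorem wirtBar_conj_coord (j i : Fin 2) (p : C2) :
    wirtBar j (fun x : C2 => conj (x i)) p = if i = j then 1 else 0 := by
  rw [wirtBar_conj, wirt_coord, apply_ite conj, map_one, map_zero]

theorem wirt_congr_nhds {j : Fin 2} (h : f =ᶠ[𝓝 p] g) : wirt j f p = wirt j g p := by
  simp only [wirt, h.fderiv_eq]

theorem wirtBar_congr_nhds {j : Fin 2} (h : f =ᶠ[𝓝 p] g) : wirtBar j f p = wirtBar j g p := by
  simp only [wirtBar, h.fderiv_eq]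

theorem wirtBar_eventuallyEq {j : Fin 2} (h : f =ᶠ[𝓝 p] g) : wirtBar j f =ᶠ[𝓝 p] wirtBar j g :=
  h.eventuallyEq_nhds.mono fun _ => wirtBar_congr_nhds

theorem contDiffAt_wirt {m n : WithTop ℕ∞} (j : Fin 2) (hf : ContDiffAt ℝ n f p)
    (hmn : m + 1 ≤ n) : ContDiffAt ℝ m (wirt j f) p := by
  have h := hf.fderiv_right hmn
  exact contDiffAt_const.mul ((h.clm_apply contDiffAt_const).sub
    (contDiffAt_const.mul (h.clm_apply contDiffAt_const)))

theorem contDiffAt_wirtBar {m n : WithTop ℕ∞} (j : Fin 2) (hf : ContDiffAt ℝ n f p)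
    (hmn : m + 1 ≤ n) : ContDiffAt ℝ m (wirtBar j f) p := by
  have h := hf.fderiv_right hmn
  exact contDiffAt_const.mul ((h.clm_apply contDiffAt_const).add
    (contDiffAt_const.mul (h.clm_apply contDiffAt_const)))

theorem contDiff_wirt (j : Fin 2) (hf : ContDiff ℝ ∞ f) : ContDiff ℝ ∞ (wirt j f) :=
  contDiff_iff_contDiffAt.2 fun _ => contDiffAt_wirt j hf.contDiffAt le_rfl

theorem contDiff_wirtBar (j : Fin 2) (hf : ContDiff ℝ ∞ f) : ContDiff ℝ ∞ (wirtBar j f) :=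
  contDiff_iff_contDiffAt.2 fun _ => contDiffAt_wirtBar j hf.contDiffAt le_rfl

theorem differentiable_wirt (j : Fin 2) (hf : ContDiff ℝ ∞ f) : Differentiable ℝ (wirt j f) :=
  (contDiff_wirt j hf).differentiable (by simp)

theorem differentiable_wirtBar (j : Fin 2) (hf : ContDiff ℝ ∞ f) :
    Differentiable ℝ (wirtBar j f) :=
  (contDiff_wirtBar j hf).differentiable (by simp)

theorem differentiableAt_wirtBar (j : Fin 2) (hf : ContDiffAt ℝ 2 f p) :
    DifferentiableAt ℝ (wirtBar j f) p :=
  (contDiffAt_wirtBar j hf (m := 1) (by norm_num)).differentiableAt one_ne_zero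

theorem hasFDerivAt_fderiv_apply {E F : Type*} [NormedAddCommGroup E] [NormedSpace ℝ E]
    [NormedAddCommGroup F] [NormedSpace ℝ F] {f : E → F} {p : E} (hf : ContDiffAt ℝ 2 f p)
    (u : E) : HasFDerivAt (fun x => fderiv ℝ f x u) ((fderiv ℝ (fderiv ℝ f) p).flip u) p := by
  have h : DifferentiableAt ℝ (fderiv ℝ f) p :=
    (hf.fderiv_right (m := 1) (by norm_num)).differentiableAt one_ne_zero
  simpa using h.hasFDerivAt.clm_apply (hasFDerivAt_const u p)

theorem fderiv_wirt (hf : ContDiffAt ℝ 2 f p) (j : Fin 2) (v : C2) :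
    fderiv ℝ (wirt j f) p v = (1 / 2 : ℂ) *
      (fderiv ℝ (fderiv ℝ f) p v (EuclideanSpace.single j 1)
        - I * fderiv ℝ (fderiv ℝ f) p v (EuclideanSpace.single j I)) :=
  congrArg (· v) (((hasFDerivAt_fderiv_apply hf _).fun_sub
    ((hasFDerivAt_fderiv_apply hf _).const_mul I)).const_mul (1 / 2 : ℂ)).fderiv

theorem fderiv_wirtBar (hf : ContDiffAt ℝ 2 f p) (j : Fin 2) (v : C2) :
    fderiv ℝ (wirtBar j f) p v = (1 / 2 : ℂ) *
      (fderiv ℝ (fderiv ℝ f) p v (EuclideanSpace.single j 1)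
        + I * fderiv ℝ (fderiv ℝ f) p v (EuclideanSpace.single j I)) :=
  congrArg (· v) (((hasFDerivAt_fderiv_apply hf _).fun_add
    ((hasFDerivAt_fderiv_apply hf _).const_mul I)).const_mul (1 / 2 : ℂ)).fderiv

theorem wirt_wirtBar_comm (hf : ContDiffAt ℝ 2 f p) (j k : Fin 2) :
    wirt j (wirtBar k f) p = wirtBar k (wirt j f) p := by
  have symm : ∀ a b, fderiv ℝ (fderiv ℝ f) p (EuclideanSpace.single k a)
      (EuclideanSpace.single j b) = _ := fun _ _ => (hf.isSymmSndFDerivAt (by simp)).eq _ _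
  rw [wirt, wirtBar.eq_1 k (wirt j f) p]
  simp only [fderiv_wirt hf, fderiv_wirtBar hf, symm]
  ring

theorem conj_wirt_wirtBar_of_conj_eq (hf : ContDiffAt ℝ 2 f p) (hr : ∀ x, conj (f x) = f x)
    (j k : Fin 2) : conj (wirt j (wirtBar k f) p) = wirt k (wirtBar j f) p := by
  rw [← wirtBar_conj, wirt_wirtBar_comm hf]
  simp only [conj_wirtBar_of_conj_eq hr]

theorem wirt_wirt_comm (hf : ContDiffAt ℝ 2 f p) (j k : Fin 2) :
    wirt j (wirt k f) p = wirt k (wirt j f) p := by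
  have symm : ∀ a b, fderiv ℝ (fderiv ℝ f) p (EuclideanSpace.single k a)
      (EuclideanSpace.single j b) = _ := fun _ _ => (hf.isSymmSndFDerivAt (by simp)).eq _ _
  rw [wirt, wirt.eq_1 k (wirt j f) p]
  simp only [fderiv_wirt hf, symm]
  ring

theorem wirtBar_wirtBar_comm (hf : ContDiffAt ℝ 2 f p) (j k : Fin 2) :
    wirtBar j (wirtBar k f) p = wirtBar k (wirtBar j f) p := by
  have symm : ∀ a b, fderiv ℝ (fderiv ℝ f) p (EuclideanSpace.single k a)
      (EuclideanSpace.single j b) = _ := fun _ _ => (hf.isSymmSndFDerivAt (by simp)).eq _ _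
  rw [wirtBar, wirtBar.eq_1 k (wirtBar j f) p]
  simp only [fderiv_wirtBar hf, symm]
  ring

end WirtingerCalculus

section LeviForm

variable {χ : ℝ → ℝ} {φ ψ : C2 → ℝ} {p : C2}

/-- The polarised complex Hessian `∑ j k, ∂²φ/∂z_j∂z̄_k (p) s_j t̄_k`. -/
noncomputable def leviForm (φ : C2 → ℝ) (p s t : C2) : ℂ :=
  ∑ j : Fin 2, ∑ k : Fin 2, wirt j (wirtBar k (fun x => (φ x : ℂ))) p * s j * conj (t k)

/-- The `(1,0)`-derivative `∑ j, t_j ∂φ/∂z_j (p)`; its kernel consists of the complex tangent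
vectors. -/
noncomputable def holDeriv (φ : C2 → ℝ) (p t : C2) : ℂ :=
  ∑ j : Fin 2, t j * wirt j (fun x => (φ x : ℂ)) p

theorem complexHessian_eq_re_leviForm (φ : C2 → ℝ) (p t : C2) :
    complexHessian φ p t = (leviForm φ p t t).re := rfl

theorem contDiffAt_ofReal_comp {n : WithTop ℕ∞} (hφ : ContDiffAt ℝ n φ p) :
    ContDiffAt ℝ n (fun x => (φ x : ℂ)) p :=
  ofRealCLM.contDiff.contDiffAt.comp p hφ

theorem contDiff_ofReal_comp {n : WithTop ℕ∞} (hφ : ContDiff ℝ n φ) :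
    ContDiff ℝ n (fun x => (φ x : ℂ)) :=
  ofRealCLM.contDiff.comp hφ

theorem differentiableAt_ofReal_comp (hφ : DifferentiableAt ℝ φ p) :
    DifferentiableAt ℝ (fun x => (φ x : ℂ)) p :=
  ofRealCLM.differentiableAt.comp p hφ

theorem fderiv_ofReal_comp (hφ : DifferentiableAt ℝ φ p) (v : C2) :
    fderiv ℝ (fun x => (φ x : ℂ)) p v = (fderiv ℝ φ p v : ℂ) :=
  congrArg (· v) (ofRealCLM.hasFDerivAt.comp p hφ.hasFDerivAt).fderiv

theorem wirt_comp (hχ : DifferentiableAt ℝ χ (φ p)) (hφ : DifferentiableAt ℝ φ p) (j : Fin 2) :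
    wirt j (fun x => (χ (φ x) : ℂ)) p
      = ((deriv χ (φ p) : ℝ) : ℂ) * wirt j (fun x => (φ x : ℂ)) p := by
  have h : HasFDerivAt (fun x => χ (φ x)) (deriv χ (φ p) • fderiv ℝ φ p) p :=
    hχ.hasDerivAt.comp_hasFDerivAt p hφ.hasFDerivAt
  simp only [wirt, fderiv_ofReal_comp hφ, fderiv_ofReal_comp h.differentiableAt, h.fderiv,
    smul_apply, smul_eq_mul, ofReal_mul]
  ring

theorem wirtBar_comp (hχ : DifferentiableAt ℝ χ (φ p)) (hφ : DifferentiableAt ℝ φ p)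
    (j : Fin 2) : wirtBar j (fun x => (χ (φ x) : ℂ)) p
      = ((deriv χ (φ p) : ℝ) : ℂ) * wirtBar j (fun x => (φ x : ℂ)) p := by
  rw [← conj_wirt_ofReal, wirt_comp hχ hφ, map_mul, conj_ofReal, conj_wirt_ofReal]

theorem wirt_wirtBar_comp (hχ : ContDiffAt ℝ 2 χ (φ p)) (hφ : ContDiffAt ℝ 2 φ p)
    (j k : Fin 2) : wirt j (wirtBar k (fun x => (χ (φ x) : ℂ))) p
      = ((deriv χ (φ p) : ℝ) : ℂ) * wirt j (wirtBar k (fun x => (φ x : ℂ))) p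
        + ((deriv (deriv χ) (φ p) : ℝ) : ℂ) * wirt j (fun x => (φ x : ℂ)) p
          * wirtBar k (fun x => (φ x : ℂ)) p := by
  have hχ_near : ∀ᶠ x in 𝓝 p, ContDiffAt ℝ 2 χ (φ x) :=
    hφ.continuousAt.eventually (hχ.eventually (by simp))
  have hwirtBar : wirtBar k (fun x => (χ (φ x) : ℂ)) =ᶠ[𝓝 p]
      fun x => ((deriv χ (φ x) : ℝ) : ℂ) * wirtBar k (fun x => (φ x : ℂ)) x := by
    filter_upwards [hφ.eventually (by simp), hχ_near] with x hx hχx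
    exact wirtBar_comp (hχx.differentiableAt two_ne_zero) (hx.differentiableAt two_ne_zero) k
  have hdχ : DifferentiableAt ℝ (deriv χ) (φ p) :=
    (hasFDerivAt_fderiv_apply hχ 1).differentiableAt
  have hφ1 : DifferentiableAt ℝ φ p := hφ.differentiableAt two_ne_zero
  have hdχφ : DifferentiableAt ℝ (fun x => deriv χ (φ x)) p := hdχ.comp p hφ1
  rw [wirt_congr_nhds hwirtBar, wirt_mul j (differentiableAt_ofReal_comp hdχφ)
    (differentiableAt_wirtBar k (contDiffAt_ofReal_comp hφ)), wirt_comp hdχ hφ1]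

theorem leviForm_comp (hχ : ContDiffAt ℝ 2 χ (φ p)) (hφ : ContDiffAt ℝ 2 φ p) (s t : C2) :
    leviForm (fun x => χ (φ x)) p s t = ((deriv χ (φ p) : ℝ) : ℂ) * leviForm φ p s t
      + ((deriv (deriv χ) (φ p) : ℝ) : ℂ) * (holDeriv φ p s * conj (holDeriv φ p t)) := by
  simp only [leviForm, holDeriv, wirt_wirtBar_comp hχ hφ, Fin.sum_univ_two, map_add, map_mul,
    conj_wirt_ofReal]
  ring

theorem holDeriv_comp (hχ : DifferentiableAt ℝ χ (φ p)) (hφ : DifferentiableAt ℝ φ p) (t : C2) :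
    holDeriv (fun x => χ (φ x)) p t = ((deriv χ (φ p) : ℝ) : ℂ) * holDeriv φ p t := by
  simp only [holDeriv, wirt_comp hχ hφ, Fin.sum_univ_two]
  ring

theorem complexHessian_comp (hχ : ContDiffAt ℝ 2 χ (φ p)) (hφ : ContDiffAt ℝ 2 φ p) (t : C2) :
    complexHessian (fun x => χ (φ x)) p t = deriv χ (φ p) * complexHessian φ p t
      + deriv (deriv χ) (φ p) * ‖holDeriv φ p t‖ ^ 2 := by
  rw [complexHessian_eq_re_leviForm, leviForm_comp hχ hφ, mul_conj, normSq_eq_norm_sq, add_re,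
    re_ofReal_mul, re_ofReal_mul, ofReal_re, complexHessian_eq_re_leviForm]

theorem wirt_wirtBar_add (hφ : ContDiffAt ℝ 2 φ p) (hψ : ContDiffAt ℝ 2 ψ p) (j k : Fin 2) :
    wirt j (wirtBar k (fun x => ((φ x + ψ x : ℝ) : ℂ))) p
      = wirt j (wirtBar k (fun x => (φ x : ℂ))) p + wirt j (wirtBar k (fun x => (ψ x : ℂ))) p := by
  have hwirtBar : wirtBar k (fun x => ((φ x + ψ x : ℝ) : ℂ)) =ᶠ[𝓝 p]
      fun x => wirtBar k (fun x => (φ x : ℂ)) x + wirtBar k (fun x => (ψ x : ℂ)) x := by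
    filter_upwards [hφ.eventually (by simp), hψ.eventually (by simp)] with x hφx hψx
    simp only [ofReal_add]
    exact wirtBar_add k (differentiableAt_ofReal_comp (hφx.differentiableAt two_ne_zero))
      (differentiableAt_ofReal_comp (hψx.differentiableAt two_ne_zero))
  rw [wirt_congr_nhds hwirtBar, wirt_add j (differentiableAt_wirtBar k (contDiffAt_ofReal_comp hφ))
    (differentiableAt_wirtBar k (contDiffAt_ofReal_comp hψ))]

theorem leviForm_add (hφ : ContDiffAt ℝ 2 φ p) (hψ : ContDiffAt ℝ 2 ψ p) (s t : C2) :
    leviForm (fun x => φ x + ψ x) p s t = leviForm φ p s t + leviForm ψ p s t := by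
  simp only [leviForm, wirt_wirtBar_add hφ hψ, Fin.sum_univ_two]
  ring

theorem holDeriv_add (hφ : DifferentiableAt ℝ φ p) (hψ : DifferentiableAt ℝ ψ p) (t : C2) :
    holDeriv (fun x => φ x + ψ x) p t = holDeriv φ p t + holDeriv ψ p t := by
  simp only [holDeriv, ofReal_add, wirt_add _ (differentiableAt_ofReal_comp hφ)
    (differentiableAt_ofReal_comp hψ), Fin.sum_univ_two]
  ring

theorem ofReal_comp_eventuallyEq (h : φ =ᶠ[𝓝 p] ψ) :
    (fun x => (φ x : ℂ)) =ᶠ[𝓝 p] fun x => (ψ x : ℂ) :=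
  h.fun_comp ofReal

theorem leviForm_congr_nhds (h : φ =ᶠ[𝓝 p] ψ) (s t : C2) : leviForm φ p s t = leviForm ψ p s t := by
  simp only [leviForm, fun j k => wirt_congr_nhds (j := j)
    (wirtBar_eventuallyEq (j := k) (ofReal_comp_eventuallyEq h))]

theorem complexHessian_congr_nhds (h : φ =ᶠ[𝓝 p] ψ) (t : C2) :
    complexHessian φ p t = complexHessian ψ p t := by
  rw [complexHessian_eq_re_leviForm, leviForm_congr_nhds h, complexHessian_eq_re_leviForm]

theorem holDeriv_congr_nhds (h : φ =ᶠ[𝓝 p] ψ) (t : C2) : holDeriv φ p t = holDeriv ψ p t := by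
  simp only [holDeriv, fun j => wirt_congr_nhds (j := j) (ofReal_comp_eventuallyEq h)]

theorem conj_leviForm (hφ : ContDiffAt ℝ 2 φ p) (s t : C2) :
    conj (leviForm φ p s t) = leviForm φ p t s := by
  simp only [leviForm, Fin.sum_univ_two, map_add, map_mul, conj_conj,
    conj_wirt_wirtBar_of_conj_eq (contDiffAt_ofReal_comp hφ) (fun _ => conj_ofReal _)]
  ring

theorem complexHessian_smul_add_smul (h : ContDiffAt ℝ 2 φ p) (u v : C2) (a b : ℂ) :
    complexHessian φ p (a • u + b • v) = ‖a‖ ^ 2 * complexHessian φ p u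
      + ‖b‖ ^ 2 * complexHessian φ p v + 2 * (a * conj b * leviForm φ p u v).re := by
  have expand : leviForm φ p (a • u + b • v) (a • u + b • v) = (‖a‖ ^ 2 : ℝ) * leviForm φ p u u
      + (‖b‖ ^ 2 : ℝ) * leviForm φ p v v + (a * conj b * leviForm φ p u v
      + conj (a * conj b * leviForm φ p u v)) := by
    rw [map_mul, conj_leviForm h, ← normSq_eq_norm_sq, ← normSq_eq_norm_sq, ← mul_conj, ← mul_conj]
    simp only [leviForm, Fin.sum_univ_two, map_add, map_mul, conj_conj, PiLp.add_apply,
      PiLp.smul_apply, smul_eq_mul]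
    ring
  rw [complexHessian_eq_re_leviForm, expand, add_conj, add_re, add_re, re_ofReal_mul,
    re_ofReal_mul, ofReal_re]
  rfl

theorem holDeriv_smul_add_smul (φ : C2 → ℝ) (p u v : C2) (a b : ℂ) :
    holDeriv φ p (a • u + b • v) = a * holDeriv φ p u + b * holDeriv φ p v := by
  simp only [holDeriv, Fin.sum_univ_two, PiLp.add_apply, PiLp.smul_apply, smul_eq_mul]
  ring

end LeviForm

section NormalCoordinates

theorem exists_contDiffAt_leftInverse {F G : Type*} [NormedAddCommGroup F] [NormedSpace ℝ F]
    [NormedAddCommGroup G] [NormedSpace ℝ G] [CompleteSpace F] {f : F → G} {a : F}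
    (hf : ∀ᶠ x in 𝓝 a, ContDiffAt ℝ ∞ f x) {e : F ≃L[ℝ] G}
    (he : HasFDerivAt f (e : F →L[ℝ] G) a) :
    ∃ g : G → F, (∀ᶠ y in 𝓝 (f a), ContDiffAt ℝ ∞ g y) ∧ ∀ᶠ x in 𝓝 a, g (f x) = x := by
  have hfa := hf.self_of_nhds
  let H := hfa.toOpenPartialHomeomorph f he (by simp)
  have ha : a ∈ H.source := hfa.mem_toOpenPartialHomeomorph_source he (by simp)
  have hequiv : ∀ᶠ x in 𝓝 a, fderiv ℝ f x ∈ range ((↑) : (F ≃L[ℝ] G) → F →L[ℝ] G) :=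
    (hfa.fderiv_right (m := 0) (by simp)).continuousAt (he.fderiv ▸ e.nhds)
  have hsymm : Tendsto H.symm (𝓝 (f a)) (𝓝 a) := by
    have h := (H.continuousAt_symm (H.map_source ha)).tendsto
    rwa [H.left_inv ha] at h
  refine ⟨H.symm, ?_, H.eventually_left_inverse ha⟩
  filter_upwards [H.open_target.mem_nhds (H.map_source ha), hsymm.eventually hequiv,
    hsymm.eventually hf] with y hy ⟨e', he'⟩ hfy
  exact H.contDiffAt_symm hy (he' ▸ (hfy.differentiableAt (by simp)).hasFDerivAt) hfy

variable {E : Type*} [NormedAddCommGroup E] [InnerProductSpace ℝ E] [CompleteSpace E]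
  {r s : E → ℝ} {p q x : E}

theorem gradient_eq_zero_iff : ∇ r q = 0 ↔ fderiv ℝ r q = 0 :=
  (InnerProductSpace.toDual ℝ E).symm.map_eq_zero_iff

theorem contDiff_gradient (hr : ContDiff ℝ ∞ r) : ContDiff ℝ ∞ (∇ r) := by
  have h : IsBoundedLinearMap ℝ (InnerProductSpace.toDual ℝ E).symm :=
    IsLinearMap.with_bound ⟨map_add _, fun c v => by simp⟩ 1 fun v => by simp
  exact h.contDiff.comp (hr.fderiv_right le_rfl)

/-- The unit normal field of the level sets of `r`, with the junk value `0` at critical points. -/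
noncomputable def unitNormal (r : E → ℝ) (q : E) : E := ‖∇ r q‖⁻¹ • ∇ r q

theorem norm_unitNormal (h : ∇ r q ≠ 0) : ‖unitNormal r q‖ = 1 := by
  rw [unitNormal, norm_smul, norm_inv, norm_norm, inv_mul_cancel₀ (norm_ne_zero_iff.2 h)]

theorem norm_gradient_smul_unitNormal (h : ∇ r q ≠ 0) : ‖∇ r q‖ • unitNormal r q = ∇ r q := by
  rw [unitNormal, smul_inv_smul₀ (norm_ne_zero_iff.2 h)]

theorem contDiffAt_unitNormal (hr : ContDiff ℝ ∞ r) (h : ∇ r q ≠ 0) :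
    ContDiffAt ℝ ∞ (unitNormal r) q :=
  have hg := (contDiff_gradient hr).contDiffAt
  ((hg.norm ℝ h).inv (norm_ne_zero_iff.2 h)).smul hg

theorem fderiv_unitNormal (h : ∇ r q ≠ 0) : fderiv ℝ r q (unitNormal r q) = ‖∇ r q‖ := by
  rw [← inner_gradient_left, unitNormal, inner_smul_right, real_inner_self_eq_norm_sq]
  have := norm_ne_zero_iff.2 h
  field_simp

/-- Normal coordinates along the level sets of `r`: the map `(q, t) ↦ q + t n(q)`, paired with the
level `r q`, so that the tube around `{r = 0}` is the slice where the second component vanishes. -/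
noncomputable def normalCoord (r : E → ℝ) (y : E × ℝ) : E × ℝ :=
  (y.1 + y.2 • unitNormal r y.1, r y.1)

theorem contDiffAt_normalCoord (hr : ContDiff ℝ ∞ r) {y : E × ℝ} (h : ∇ r y.1 ≠ 0) :
    ContDiffAt ℝ ∞ (normalCoord r) y :=
  (contDiffAt_fst.add (contDiffAt_snd.smul
    ((contDiffAt_unitNormal hr h).comp y contDiffAt_fst))).prodMk
    (hr.contDiffAt.comp y contDiffAt_fst)

theorem hasFDerivAt_normalCoord (hr : ContDiff ℝ ∞ r) (h : ∇ r q ≠ 0) :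
    HasFDerivAt (normalCoord r) ((ContinuousLinearMap.fst ℝ E ℝ +
      (ContinuousLinearMap.snd ℝ E ℝ).smulRight (unitNormal r q)).prod
        (fderiv ℝ r q ∘L ContinuousLinearMap.fst ℝ E ℝ)) (q, 0) := by
  have hn : HasFDerivAt (fun y : E × ℝ => unitNormal r y.1) _ (q, 0) :=
    HasFDerivAt.comp (g := unitNormal r) (f := Prod.fst) (q, (0 : ℝ))
      ((contDiffAt_unitNormal hr h).differentiableAt (by simp)).hasFDerivAt hasFDerivAt_fst
  have hr' : HasFDerivAt (fun y : E × ℝ => r y.1) _ (q, 0) :=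
    HasFDerivAt.comp (g := r) (f := Prod.fst) (q, (0 : ℝ))
      (hr.differentiable (by simp) q).hasFDerivAt hasFDerivAt_fst
  refine ((hasFDerivAt_fst.add (hasFDerivAt_snd.smul hn)).prodMk hr').congr_fderiv ?_
  simp

theorem exists_equiv_hasFDerivAt_normalCoord (hr : ContDiff ℝ ∞ r) (h : ∇ r q ≠ 0) :
    ∃ e : (E × ℝ) ≃L[ℝ] (E × ℝ), HasFDerivAt (normalCoord r) (e : (E × ℝ) →L[ℝ] E × ℝ) (q, 0) := by
  have hnorm := norm_ne_zero_iff.2 h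
  let shift : E × ℝ →L[ℝ] ℝ := ‖∇ r q‖⁻¹ • (fderiv ℝ r q ∘L ContinuousLinearMap.fst ℝ E ℝ
    - ContinuousLinearMap.snd ℝ E ℝ)
  refine ⟨ContinuousLinearEquiv.equivOfInverse ((ContinuousLinearMap.fst ℝ E ℝ +
      (ContinuousLinearMap.snd ℝ E ℝ).smulRight (unitNormal r q)).prod
        (fderiv ℝ r q ∘L ContinuousLinearMap.fst ℝ E ℝ))
    ((ContinuousLinearMap.fst ℝ E ℝ - shift.smulRight (unitNormal r q)).prod shift) ?_ ?_,
    hasFDerivAt_normalCoord hr h⟩ <;> rintro ⟨v, t⟩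
  · have cancel : ‖∇ r q‖⁻¹ * (t * ‖∇ r q‖) = t := by field_simp
    simp [shift, fderiv_unitNormal h, cancel]
  · have cancel : ‖∇ r q‖⁻¹ * (fderiv ℝ r q v - t) * ‖∇ r q‖ = fderiv ℝ r q v - t := by field_simp
    simp [shift, fderiv_unitNormal h, cancel]

theorem exists_normalDistance (hr : ContDiff ℝ ∞ r) (hp : r p = 0) (h : ∇ r p ≠ 0) :
    ∃ s : E → ℝ, (∀ᶠ x in 𝓝 p, ContDiffAt ℝ ∞ s x) ∧
      ∀ᶠ y in 𝓝 (p, (0 : ℝ)), r y.1 = 0 → s (y.1 + y.2 • unitNormal r y.1) = y.2 := by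
  obtain ⟨e, he⟩ := exists_equiv_hasFDerivAt_normalCoord hr h
  have hne : ∀ᶠ y : E × ℝ in 𝓝 (p, 0), ∇ r y.1 ≠ 0 :=
    ((contDiff_gradient hr).continuous.comp continuous_fst).continuousAt.eventually_ne h
  obtain ⟨g, hg, hleft⟩ :=
    exists_contDiffAt_leftInverse (hne.mono fun y hy => contDiffAt_normalCoord hr hy) he
  have hslice : Tendsto (fun x : E => (x, (0 : ℝ))) (𝓝 p) (𝓝 (normalCoord r (p, 0))) :=
    (continuous_id.prodMk continuous_const).tendsto' _ _ (by simp [normalCoord, hp])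
  refine ⟨fun x => (g (x, 0)).2, ?_, ?_⟩
  · filter_upwards [hslice.eventually hg] with x hx
    exact contDiffAt_snd.comp x (hx.comp x (contDiffAt_id.prodMk contDiffAt_const))
  · filter_upwards [hleft] with y hy hy0
    rw [normalCoord, hy0] at hy
    rw [hy]

theorem tendsto_add_smul_unitNormal (h : ContinuousAt (unitNormal r) p) :
    Tendsto (fun y : E × ℝ => y.1 + y.2 • unitNormal r y.1) (𝓝 (p, 0)) (𝓝 p) := by
  have hc : ContinuousAt (fun y : E × ℝ => y.1 + y.2 • unitNormal r y.1) (p, 0) :=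
    continuousAt_fst.add (continuousAt_snd.smul (h.comp' continuousAt_fst))
  simpa using hc.tendsto

theorem eventually_fderiv_unitNormal_eq_one (h : ContinuousAt (unitNormal r) p)
    (hs : ∀ᶠ x in 𝓝 p, DifferentiableAt ℝ s x)
    (hsn : ∀ᶠ y in 𝓝 (p, (0 : ℝ)), r y.1 = 0 → s (y.1 + y.2 • unitNormal r y.1) = y.2) :
    ∀ᶠ y in 𝓝 (p, (0 : ℝ)), r y.1 = 0 →
      fderiv ℝ s (y.1 + y.2 • unitNormal r y.1) (unitNormal r y.1) = 1 := by
  filter_upwards [hsn.eventually_nhds, (tendsto_add_smul_unitNormal h).eventually hs]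
    with ⟨q, t⟩ hy hsy hq
  have hline : (fun τ : ℝ => s (q + τ • unitNormal r q)) =ᶠ[𝓝 t] id :=
    ((continuous_const.prodMk continuous_id).tendsto t |>.eventually hy).mono fun τ hτ => hτ hq
  have hderiv : HasDerivAt (fun τ : ℝ => q + τ • unitNormal r q) (unitNormal r q) t := by
    simpa using ((hasDerivAt_id t).smul_const (unitNormal r q)).const_add q
  exact (hsy.hasFDerivAt.comp_hasDerivAt t hderiv).unique
    ((hasDerivAt_id t).congr_of_eventuallyEq hline)

theorem eventually_pos_mul_add_smul_unitNormal (hr : ContDiff ℝ ∞ r) (h : ∇ r p ≠ 0) :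
    ∀ᶠ y in 𝓝 (p, (0 : ℝ)), r y.1 = 0 → y.2 ≠ 0 →
      0 < y.2 * r (y.1 + y.2 • unitNormal r y.1) := by
  have hm : 0 < ‖∇ r p‖ := norm_pos_iff.2 h
  have hn : ContinuousAt (unitNormal r) p := (contDiffAt_unitNormal hr h).continuousAt
  have hne : ∀ᶠ q in 𝓝 p, ∇ r q ≠ 0 :=
    (contDiff_gradient hr).continuous.continuousAt.eventually_ne h
  have hslope : ∀ᶠ q in 𝓝 p, ‖∇ r p‖ / 2 < fderiv ℝ r p (unitNormal r q) := by
    refine ((fderiv ℝ r p).continuous.continuousAt.comp hn).eventually_const_lt ?_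
    simp only [Function.comp_apply, fderiv_unitNormal h]
    linarith
  have hstrict := (hr.contDiffAt (x := p)).hasStrictFDerivAt (by simp) |>.isLittleO.def
    (show 0 < ‖∇ r p‖ / 2 by linarith)
  have hpair : Tendsto (fun y : E × ℝ => (y.1 + y.2 • unitNormal r y.1, y.1)) (𝓝 (p, 0))
      (𝓝 (p, p)) := (tendsto_add_smul_unitNormal hn).prodMk_nhds continuousAt_fst
  filter_upwards [hpair.eventually hstrict, continuousAt_fst.eventually hne,
    continuousAt_fst.eventually hslope] with ⟨q, t⟩ hlin hq hslope hq0 ht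
  simp only [add_sub_cancel_left, map_smul, smul_eq_mul, norm_smul, norm_unitNormal hq, mul_one,
    Real.norm_eq_abs, show r q = 0 from hq0, sub_zero] at hlin ⊢
  have hbound : |t * (r (q + t • unitNormal r q) - t * fderiv ℝ r p (unitNormal r q))|
      ≤ ‖∇ r p‖ / 2 * t ^ 2 := by
    rw [abs_mul, ← sq_abs t]
    nlinarith [abs_nonneg t]
  nlinarith [neg_le_of_abs_le hbound, sq_pos_of_ne_zero ht]

theorem exists_eq_add_smul_gradient (hr : ContDiff ℝ ∞ r) (h : ∇ r q ≠ 0)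
    (hmin : IsLocalMinOn (fun y => dist x y) {y | r y = r q} q) :
    ∃ a : ℝ, x = q + a • ∇ r q := by
  have hext : IsLocalExtrOn (fun y => ‖y - x‖ ^ 2) {y | r y = r q} q := by
    refine .inl (hmin.mono fun y hy => ?_)
    simp only [dist_eq_norm'] at hy
    exact pow_le_pow_left₀ (norm_nonneg _) hy 2
  have hsq : HasStrictFDerivAt (fun y : E => ‖y - x‖ ^ 2) _ q :=
    (contDiff_id.sub contDiff_const).norm_sq ℝ |>.contDiffAt.hasStrictFDerivAt'
      ((hasFDerivAt_id q).sub_const x).norm_sq (n := 1) (by norm_num)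
  obtain ⟨a, b, hab, hsum⟩ := hext.exists_multipliers_of_hasStrictFDerivAt_1d
    (hr.contDiffAt.hasStrictFDerivAt (by simp)) hsq
  have hvec : a • ∇ r q = (2 * b) • (x - q) := by
    refine ext_inner_right ℝ fun v => ?_
    have hv := congrArg (fun T : E →L[ℝ] ℝ => T v) hsum
    simp only [id_eq, map_sub, ContinuousLinearMap.comp_id, add_apply, smul_apply, smul_eq_mul,
      sub_apply, coe_innerSL_apply, nsmul_eq_mul, Nat.cast_ofNat, zero_apply] at hv
    rw [inner_smul_left, inner_smul_left, inner_gradient_left]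
    simp only [conj_trivial, inner_sub_left]
    linarith
  have hb : b ≠ 0 := by
    rintro rfl
    simp only [mul_zero, zero_smul, smul_eq_zero, h, or_false] at hvec
    exact hab (Prod.ext hvec rfl)
  refine ⟨a / (2 * b), ?_⟩
  rw [div_eq_inv_mul, mul_smul, hvec, inv_smul_smul₀ (by simpa using hb), add_sub_cancel]

theorem exists_eq_add_smul_unitNormal (hr : ContDiff ℝ ∞ r) (h : ∇ r q ≠ 0)
    (hmin : IsLocalMinOn (fun y => dist x y) {y | r y = r q} q) :
    ∃ c : ℝ, x = q + c • unitNormal r q ∧ |c| = dist x q := by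
  obtain ⟨a, rfl⟩ := exists_eq_add_smul_gradient hr h hmin
  refine ⟨a * ‖∇ r q‖, by rw [mul_smul, norm_gradient_smul_unitNormal h], ?_⟩
  rw [dist_self_add_left, norm_smul, Real.norm_eq_abs, abs_mul, abs_norm]

end NormalCoordinates

section SignedDistance

open Metric

variable {n : ℕ∞} {Ω : Set C2} {r : C2 → ℝ} {p x : C2}

theorem IsDefiningFunction.nonpos_of_mem_closure (hr : IsDefiningFunction n Ω r)
    (hp : p ∈ closure Ω) : r p ≤ 0 := by
  refine closure_minimal (fun x hx => ?_) (isClosed_le hr.1.continuous continuous_const) hp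
  rw [hr.2.1] at hx
  exact (show r x < 0 from hx).le

theorem IsDefiningFunction.isOpen (hr : IsDefiningFunction n Ω r) : IsOpen Ω :=
  hr.2.1 ▸ isOpen_lt hr.1.continuous continuous_const

theorem IsDefiningFunction.eq_zero (hr : IsDefiningFunction n Ω r) (hp : p ∈ frontier Ω) :
    r p = 0 := by
  have hpΩ : p ∉ Ω := fun h => hp.2 (by rwa [hr.isOpen.interior_eq])
  rw [hr.2.1] at hpΩ
  exact le_antisymm (hr.nonpos_of_mem_closure hp.1) (not_lt.1 hpΩ)

theorem mem_frontier_of_fderiv_ne_zero (hΩ : Ω = {p | r p < 0}) (hp : r p = 0)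
    (hd : fderiv ℝ r p ≠ 0) : p ∈ frontier Ω := by
  refine ⟨?_, fun h => ?_⟩
  · by_contra hcl
    refine hd (IsLocalMin.fderiv_eq_zero ?_)
    filter_upwards [isClosed_closure.isOpen_compl.mem_nhds hcl] with x hx
    have hxΩ : x ∉ Ω := fun h => hx (subset_closure h)
    rw [hΩ] at hxΩ
    exact hp ▸ not_lt.1 hxΩ
  · have hpΩ := interior_subset h
    rw [hΩ, mem_ofPred_eq, hp] at hpΩ
    exact lt_irrefl _ hpΩ

theorem abs_signedBdryDist (Ω : Set C2) (x : C2) :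
    |signedBdryDist Ω x| = infDist x (frontier Ω) := by
  unfold signedBdryDist
  split_ifs
  · rw [abs_neg, abs_of_nonneg infDist_nonneg]
  · rw [abs_of_nonneg infDist_nonneg]

theorem signedBdryDist_eq_zero (hx : x ∈ frontier Ω) : signedBdryDist Ω x = 0 := by
  rw [← abs_eq_zero, abs_signedBdryDist, infDist_zero_of_mem hx]

theorem signedBdryDist_neg_iff (hΩ : IsOpen Ω) (hne : (frontier Ω).Nonempty) :
    signedBdryDist Ω x < 0 ↔ x ∈ Ω := by
  have hpos : x ∉ frontier Ω → 0 < infDist x (frontier Ω) :=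
    (isClosed_frontier.notMem_iff_infDist_pos hne).1
  refine ⟨fun h => ?_, fun h => ?_⟩
  · by_contra hx
    refine h.not_ge ?_
    by_cases hcl : x ∈ closure Ω
    · exact (signedBdryDist_eq_zero ⟨hcl, by rwa [hΩ.interior_eq]⟩).ge
    · rw [signedBdryDist, if_neg hcl]
      exact infDist_nonneg
  · rw [signedBdryDist, if_pos (subset_closure h), neg_lt_zero]
    exact hpos fun hf => hf.2 (by rwa [hΩ.interior_eq])

theorem eventually_abs_signedBdryDist_sub_le (hΩ : IsOpen Ω) (x : C2) :
    ∀ᶠ y in 𝓝 x, |signedBdryDist Ω y - signedBdryDist Ω x| ≤ ‖y - x‖ := by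
  have hlip : ∀ y, |infDist y (frontier Ω) - infDist x (frontier Ω)| ≤ ‖y - x‖ := fun y => by
    simpa [Real.dist_eq, dist_eq_norm] using (lipschitz_infDist_pt (frontier Ω)).dist_le_mul y x
  by_cases hcl : x ∈ closure Ω
  · by_cases hxΩ : x ∈ Ω
    · filter_upwards [hΩ.mem_nhds hxΩ] with y hy
      rw [signedBdryDist, signedBdryDist, if_pos (subset_closure hy), if_pos hcl, neg_sub_neg,
        abs_sub_comm]
      exact hlip y
    · have hx : x ∈ frontier Ω := ⟨hcl, by rwa [hΩ.interior_eq]⟩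
      refine Eventually.of_forall fun y => ?_
      simpa [signedBdryDist_eq_zero hx, abs_signedBdryDist, infDist_zero_of_mem hx,
        abs_of_nonneg infDist_nonneg] using hlip y
  · filter_upwards [isClosed_closure.isOpen_compl.mem_nhds hcl] with y hy
    rw [signedBdryDist, signedBdryDist, if_neg hy, if_neg hcl]
    exact hlip y

theorem IsDefiningFunction.gradient_ne_zero (hr : IsDefiningFunction n Ω r)
    (hp : p ∈ frontier Ω) : ∇ r p ≠ 0 :=
  gradient_eq_zero_iff.not.2 (hr.2.2 p hp)

theorem IsDefiningFunction.exists_foot (hr : IsDefiningFunction ⊤ Ω r)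
    (hne : (frontier Ω).Nonempty) (x : C2) :
    ∃ q ∈ frontier Ω, dist x q = infDist x (frontier Ω) ∧
      ∃ c : ℝ, x = q + c • unitNormal r q ∧ |c| = dist x q := by
  obtain ⟨q, hq, hdist⟩ := isClosed_frontier.exists_infDist_eq_dist hne x
  refine ⟨q, hq, hdist.symm, exists_eq_add_smul_unitNormal hr.1 (hr.gradient_ne_zero hq) ?_⟩
  have hreg : ∀ᶠ y in 𝓝 q, fderiv ℝ r y ≠ 0 :=
    (hr.1.continuous_fderiv (by simp)).continuousAt.eventually_ne (hr.2.2 q hq)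
  filter_upwards [nhdsWithin_le_nhds hreg, self_mem_nhdsWithin] with y hy hyq
  rw [← hdist]
  exact infDist_le_dist_of_mem
    (mem_frontier_of_fderiv_ne_zero hr.2.1 (hyq.trans (hr.eq_zero hq)) hy)

theorem IsDefiningFunction.signedBdryDist_add_smul_unitNormal
    (hr : IsDefiningFunction ⊤ Ω r) {q : C2} {c : ℝ} (hq : q ∈ frontier Ω)
    (habs : |c| = infDist (q + c • unitNormal r q) (frontier Ω))
    (hsign : c ≠ 0 → 0 < c * r (q + c • unitNormal r q)) :
    signedBdryDist Ω (q + c • unitNormal r q) = c := by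
  rcases lt_trichotomy c 0 with hc | rfl | hc
  · have hx : q + c • unitNormal r q ∈ Ω := by
      rw [hr.2.1]
      exact not_le.1 fun h0 =>
        (mul_nonpos_of_nonpos_of_nonneg hc.le h0).not_gt (hsign hc.ne)
    rw [signedBdryDist, if_pos (subset_closure hx), ← habs, abs_of_neg hc, neg_neg]
  · rw [zero_smul, add_zero, signedBdryDist_eq_zero hq]
  · have hx : q + c • unitNormal r q ∉ closure Ω := fun hcl =>
      ((mul_pos_iff_of_pos_left hc).1 (hsign hc.ne')).not_ge (hr.nonpos_of_mem_closure hcl)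
    rw [signedBdryDist, if_neg hx, ← habs, abs_of_pos hc]

theorem IsDefiningFunction.eventually_exists_foot (hr : IsDefiningFunction ⊤ Ω r)
    (hp : p ∈ frontier Ω) {V : Set (C2 × ℝ)} (hV : V ∈ 𝓝 (p, (0 : ℝ))) :
    ∀ᶠ x in 𝓝 p, ∃ q ∈ frontier Ω, (q, signedBdryDist Ω x) ∈ V ∧
      x = q + signedBdryDist Ω x • unitNormal r q := by
  obtain ⟨ε, hε, hball⟩ := Metric.mem_nhds_iff.1 (inter_mem hV
    (eventually_pos_mul_add_smul_unitNormal hr.1 (hr.gradient_ne_zero hp)))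
  filter_upwards [ball_mem_nhds p (half_pos hε)] with x hx
  obtain ⟨q, hq, hdist, c, hxc, hc⟩ := hr.exists_foot ⟨p, hp⟩ x
  have hxq : dist x q < ε / 2 := by
    rw [hdist]
    exact (infDist_le_dist_of_mem hp).trans_lt hx
  have hqp : dist q p < ε := by
    rw [mem_ball] at hx
    linarith [dist_triangle q x p, dist_comm q x]
  have hmem : (q, c) ∈ ball (p, (0 : ℝ)) ε := by
    rw [← ball_prod_same]
    exact ⟨hqp, by rw [mem_ball, Real.dist_0_eq_abs, hc]; linarith⟩
  have hsign : c ≠ 0 → 0 < c * r (q + c • unitNormal r q) := (hball hmem).2 (hr.eq_zero hq)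
  have hcs : signedBdryDist Ω x = c := by
    rw [hxc]
    exact hr.signedBdryDist_add_smul_unitNormal hq (by rw [← hxc, hc, hdist]) hsign
  rw [hcs]
  exact ⟨q, hq, (hball hmem).1, hxc⟩

theorem norm_fderiv_signedBdryDist_le_one (hΩ : IsOpen Ω)
    (hx : DifferentiableAt ℝ (signedBdryDist Ω) x) : ‖fderiv ℝ (signedBdryDist Ω) x‖ ≤ 1 :=
  hx.hasFDerivAt.le_of_lip' zero_le_one <| by
    simpa only [one_mul, Real.norm_eq_abs] using eventually_abs_signedBdryDist_sub_le hΩ x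

theorem IsDefiningFunction.eventually_contDiffAt_signedBdryDist (hr : IsDefiningFunction ⊤ Ω r)
    (hp : p ∈ frontier Ω) :
    ∀ᶠ x in 𝓝 p, ContDiffAt ℝ ∞ (signedBdryDist Ω) x ∧ ‖fderiv ℝ (signedBdryDist Ω) x‖ = 1 := by
  have hg := hr.gradient_ne_zero hp
  have hn := contDiffAt_unitNormal hr.1 hg
  obtain ⟨s, hs, hsn⟩ := exists_normalDistance hr.1 (hr.eq_zero hp) hg
  have hne : ∀ᶠ y in 𝓝 (p, (0 : ℝ)), ∇ r y.1 ≠ 0 :=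
    ((contDiff_gradient hr.1).continuous.comp continuous_fst).continuousAt.eventually_ne hg
  have hsn' := eventually_fderiv_unitNormal_eq_one hn.continuousAt
    (hs.mono fun x hx => hx.differentiableAt (by simp)) hsn
  have heq : signedBdryDist Ω =ᶠ[𝓝 p] s := by
    filter_upwards [hr.eventually_exists_foot hp hsn] with x ⟨q, hq, hqs, hx⟩
    rw [← hqs (hr.eq_zero hq), ← hx]
  filter_upwards [hs, heq.eventuallyEq_nhds, hr.eventually_exists_foot hp (hne.and hsn')]
    with x hsx hx ⟨q, hq, ⟨hgq, hqs⟩, hxq⟩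
  have hsmooth : ContDiffAt ℝ ∞ (signedBdryDist Ω) x := hsx.congr_of_eventuallyEq hx
  refine ⟨hsmooth, (norm_fderiv_signedBdryDist_le_one hr.isOpen
    (hsmooth.differentiableAt (by simp))).antisymm ?_⟩
  have hone := hqs (hr.eq_zero hq)
  rw [← hxq, ← hx.fderiv_eq] at hone
  simpa [hone, norm_unitNormal hgq] using
    (fderiv ℝ (signedBdryDist Ω) x).le_opNorm (unitNormal r q)

theorem exists_contDiff_one_near {E : Type*} [NormedAddCommGroup E] [InnerProductSpace ℝ E]
    [FiniteDimensional ℝ E] {S U : Set E} (hS : IsClosed S) (hU : IsOpen U) (hSU : S ⊆ U) :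
    ∃ χ : E → ℝ, ContDiff ℝ ∞ χ ∧ (∀ p ∈ S, ∀ᶠ x in 𝓝 p, χ x = 1) ∧ tsupport χ ⊆ U ∧
      ∀ x, χ x ∈ Icc (0 : ℝ) 1 := by
  obtain ⟨V, hV, hSV, hVU⟩ := normal_exists_closure_subset hS hU hSU
  obtain ⟨χ, hχ1, hχ0, hχI⟩ := exists_contMDiffMap_one_nhds_of_subset_interior
    (n := (⊤ : ℕ∞)) (modelWithCornersSelf ℝ E) hS (t := V) (by rwa [hV.interior_eq])
  refine ⟨χ, χ.contMDiff.contDiff, fun p hp => hχ1.filter_mono (nhds_le_nhdsSet hp),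
    (closure_mono fun x hx => ?_).trans hVU, hχI⟩
  by_contra hxV
  exact hx (hχ0 x hxV)

theorem contDiff_mul_of_tsupport_subset {E : Type*} [NormedAddCommGroup E] [NormedSpace ℝ E]
    {χ f : E → ℝ} {U : Set E} {k : WithTop ℕ∞} (hχ : ContDiff ℝ k χ)
    (hf : ∀ x ∈ U, ContDiffAt ℝ k f x) (hs : tsupport χ ⊆ U) :
    ContDiff ℝ k (fun x => χ x * f x) := by
  refine contDiff_iff_contDiffAt.2 fun x => ?_
  by_cases hx : x ∈ tsupport χ
  · exact hχ.contDiffAt.mul (hf x (hs hx))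
  · refine (contDiffAt_const (c := (0 : ℝ))).congr_of_eventuallyEq ?_
    filter_upwards [notMem_tsupport_iff_eventuallyEq.1 hx] with y hy
    simp [hy]

theorem convexCombination_neg_iff {a b t : ℝ} (ht : t ∈ Icc (0 : ℝ) 1) (h : a < 0 ↔ b < 0) :
    t * a + (1 - t) * b < 0 ↔ b < 0 := by
  refine ⟨fun hlt => ?_, fun hb => ?_⟩
  · by_contra hb
    nlinarith [mul_nonneg (sub_nonneg.2 ht.2) (not_lt.1 hb),
      mul_nonneg ht.1 (not_lt.1 (h.not.2 hb))]
  · exact convex_Iio (𝕜 := ℝ) (0 : ℝ) (h.2 hb) hb ht.1 (sub_nonneg.2 ht.2) (by ring)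

theorem IsDefiningFunction.exists_extension {g : C2 → ℝ} (hr : IsDefiningFunction ⊤ Ω r)
    (hg : ∀ p ∈ frontier Ω, ∀ᶠ x in 𝓝 p, ContDiffAt ℝ ∞ g x ∧ (g x < 0 ↔ x ∈ Ω))
    (hd : ∀ p ∈ frontier Ω, fderiv ℝ g p ≠ 0) :
    ∃ d : C2 → ℝ, IsDefiningFunction ⊤ Ω d ∧ ∀ p ∈ frontier Ω, d =ᶠ[𝓝 p] g := by
  let U := {x | ∀ᶠ y in 𝓝 x, ContDiffAt ℝ ∞ g y ∧ (g y < 0 ↔ y ∈ Ω)}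
  have hgU : ∀ x ∈ U, ContDiffAt ℝ ∞ g x ∧ (g x < 0 ↔ x ∈ Ω) := fun _ hx => hx.self_of_nhds
  obtain ⟨χ, hχ, hχ1, hχU, hχI⟩ :=
    exists_contDiff_one_near isClosed_frontier isOpen_setOfPred_eventually_nhds hg
  have hmem : ∀ x, x ∈ Ω ↔ r x < 0 := fun x => by rw [hr.2.1]; rfl
  have heq : ∀ p ∈ frontier Ω, (fun x => χ x * g x + (1 - χ x) * r x) =ᶠ[𝓝 p] g := by
    intro p hp
    filter_upwards [hχ1 p hp] with x hx
    rw [hx, one_mul, sub_self, zero_mul, add_zero]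
  refine ⟨fun x => χ x * g x + (1 - χ x) * r x, ⟨?_, ?_, fun p hp => ?_⟩, heq⟩
  · exact (contDiff_mul_of_tsupport_subset hχ (fun x hx => (hgU x hx).1) hχU).add
      ((contDiff_const.sub hχ).mul hr.1)
  · ext x
    rw [hmem]
    by_cases hx : x ∈ U
    · exact (convexCombination_neg_iff (hχI x) ((hgU x hx).2.trans (hmem x))).symm
    · simp [image_eq_zero_of_notMem_tsupport fun h => hx (hχU h)]
  · rw [(heq p hp).fderiv_eq]
    exact hd p hp

/-- `d` is a smooth defining function of `Ω` on all of `ℂ²` which agrees with the signed distance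
near the boundary; it stands in for `signedBdryDist`, which is smooth only there. -/
structure IsBoundaryDistance (Ω : Set C2) (d : C2 → ℝ) : Prop where
  defining : IsDefiningFunction ⊤ Ω d
  eq_dist : ∀ p ∈ frontier Ω, d =ᶠ[𝓝 p] signedBdryDist Ω

theorem exists_isBoundaryDistance (hs : HasSmoothBoundary Ω) : ∃ d, IsBoundaryDistance Ω d := by
  obtain ⟨r, hr⟩ := hs
  obtain ⟨d, hd, heq⟩ := hr.exists_extension (g := signedBdryDist Ω)
    (fun p hp => (hr.eventually_contDiffAt_signedBdryDist hp).mono fun x hx =>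
      ⟨hx.1, signedBdryDist_neg_iff hr.isOpen ⟨p, hp⟩⟩)
    fun p hp h0 => by simpa [h0] using (hr.eventually_contDiffAt_signedBdryDist hp).self_of_nhds.2
  exact ⟨d, hd, heq⟩

theorem C2.real_inner_eq (u v : C2) :
    inner ℝ u v = (conj (u 0) * v 0 + conj (u 1) * v 1).re := by
  have h : inner ℝ u v = (inner ℂ u v).re := rfl
  rw [h, PiLp.inner_apply]
  simp [Fin.sum_univ_two, mul_comm]

theorem gradient_eq_wirtBar {φ : C2 → ℝ} (hφ : DifferentiableAt ℝ φ p) :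
    ∇ φ p = !₂[2 * wirtBar 0 (fun x => (φ x : ℂ)) p, 2 * wirtBar 1 (fun x => (φ x : ℂ)) p] := by
  refine ext_inner_right ℝ fun v => ?_
  have h := congrArg re (fderiv_eq_wirt (fun x => (φ x : ℂ)) p v)
  rw [fderiv_ofReal_comp hφ, ofReal_re, ← conj_wirt_ofReal, ← conj_wirt_ofReal] at h
  rw [inner_gradient_left, h, C2.real_inner_eq]
  simp [← conj_wirt_ofReal]
  ring

theorem norm_fderiv_sq_eq_wirt {φ : C2 → ℝ} (hφ : DifferentiableAt ℝ φ p) :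
    ((‖fderiv ℝ φ p‖ ^ 2 : ℝ) : ℂ) =
      4 * (wirt 0 (fun x => (φ x : ℂ)) p * wirtBar 0 (fun x => (φ x : ℂ)) p
        + wirt 1 (fun x => (φ x : ℂ)) p * wirtBar 1 (fun x => (φ x : ℂ)) p) := by
  have hnorm : ‖∇ φ p‖ = ‖fderiv ℝ φ p‖ := LinearIsometryEquiv.norm_map _ _
  rw [← hnorm, gradient_eq_wirtBar hφ, EuclideanSpace.norm_sq_eq]
  simp only [Fin.sum_univ_two, ← conj_wirt_ofReal, mul_conj, normSq_eq_norm_sq]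
  simp [mul_pow]
  ring

theorem IsBoundaryDistance.eikonal {d : C2 → ℝ} (hd : IsBoundaryDistance Ω d)
    (hp : p ∈ frontier Ω) : ∀ᶠ x in 𝓝 p,
      wirt 0 (fun x => (d x : ℂ)) x * wirtBar 0 (fun x => (d x : ℂ)) x
        + wirt 1 (fun x => (d x : ℂ)) x * wirtBar 1 (fun x => (d x : ℂ)) x = 1 / 4 := by
  filter_upwards [(hd.eq_dist p hp).eventuallyEq_nhds,
    hd.defining.eventually_contDiffAt_signedBdryDist hp] with x hx ⟨_, hnorm⟩
  have h := norm_fderiv_sq_eq_wirt (hd.defining.1.differentiable (by simp) x)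
  rw [hx.fderiv_eq, hnorm] at h
  simp only [one_pow, ofReal_one] at h
  linear_combination -(1 / 4 : ℂ) * h

end SignedDistance

section Rotation

variable {Ω : Set C2} {d : C2 → ℝ} {p x : C2}

/-- Rotation in the first coordinate. -/
noncomputable def rotFirst (θ : ℝ) : C2 ≃ₗᵢ[ℝ] C2 :=
  LinearIsometryEquiv.piLpCongrRight 2
    (fun i : Fin 2 => if i = 0 then rotation (Circle.exp θ) else LinearIsometryEquiv.refl ℝ ℂ)

theorem rotFirst_apply (θ : ℝ) (p : C2) :
    rotFirst θ p = !₂[Complex.exp (θ * I) * p 0, p 1] := by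
  ext i
  fin_cases i <;> simp [rotFirst, rotation_apply]

theorem rotFirst_image (h : IsHartogs Ω) (θ : ℝ) : rotFirst θ '' Ω = Ω := by
  refine Subset.antisymm ?_ fun p hp => ⟨rotFirst (-θ) p, ?_, ?_⟩
  · rintro _ ⟨p, hp, rfl⟩
    exact rotFirst_apply θ p ▸ h p hp θ
  · exact rotFirst_apply (-θ) p ▸ h p hp (-θ)
  · ext i
    fin_cases i <;> simp [rotFirst_apply, ← mul_assoc, ← Complex.exp_add]

theorem signedBdryDist_rotFirst (h : IsHartogs Ω) (θ : ℝ) (p : C2) :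
    signedBdryDist Ω (rotFirst θ p) = signedBdryDist Ω p := by
  have hfrontier : rotFirst θ '' frontier Ω = frontier Ω := by
    conv_rhs => rw [← rotFirst_image h θ]
    exact (rotFirst θ).toHomeomorph.image_frontier Ω
  have hclosure : rotFirst θ '' closure Ω = closure Ω := by
    conv_rhs => rw [← rotFirst_image h θ]
    exact (rotFirst θ).toHomeomorph.image_closure Ω
  have hdist : Metric.infDist (rotFirst θ p) (frontier Ω) = Metric.infDist p (frontier Ω) := by
    simpa only [hfrontier] using
      Metric.infDist_image (rotFirst θ).isometry (x := p) (t := frontier Ω)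
  have hmem : rotFirst θ p ∈ closure Ω ↔ p ∈ closure Ω := by
    simpa only [hclosure] using (rotFirst θ).injective.mem_set_image (s := closure Ω) (a := p)
  by_cases hp : p ∈ closure Ω
  · rw [signedBdryDist, signedBdryDist, if_pos (hmem.2 hp), if_pos hp, hdist]
  · rw [signedBdryDist, signedBdryDist, if_neg (hmem.not.2 hp), if_neg hp, hdist]

theorem hasDerivAt_rotFirst_zero (x : C2) :
    HasDerivAt (fun θ : ℝ => rotFirst θ x) (EuclideanSpace.single 0 (I * x 0)) 0 := by
  have hexp : HasDerivAt (fun θ : ℝ => Complex.exp (θ * I)) I 0 := by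
    simpa using ((hasDerivAt_id (0 : ℝ)).ofReal_comp.mul_const I).cexp
  have hsplit : (fun θ : ℝ => rotFirst θ x) = fun θ : ℝ =>
      x + (Complex.exp (θ * I) * x 0 - x 0) • (EuclideanSpace.single 0 1 : C2) := by
    ext θ i
    fin_cases i <;> simp [rotFirst_apply]
  have hsingle : (EuclideanSpace.single 0 (I * x 0) : C2)
      = (I * x 0) • EuclideanSpace.single 0 1 := by
    ext i
    fin_cases i <;> simp
  rw [hsplit, hsingle]
  exact (((hexp.mul_const (x 0)).sub_const (x 0)).smul_const _).const_add x

theorem IsBoundaryDistance.fderiv_rotation_eq_zero (hd : IsBoundaryDistance Ω d)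
    (h : IsHartogs Ω) (hp : p ∈ frontier Ω) :
    ∀ᶠ x in 𝓝 p, fderiv ℝ d x (EuclideanSpace.single 0 (I * x 0)) = 0 := by
  filter_upwards [(hd.eq_dist p hp).eventuallyEq_nhds] with x hx
  have hrot : rotFirst 0 x = x := by
    ext i
    fin_cases i <;> simp [rotFirst_apply]
  have hcurve := hasDerivAt_rotFirst_zero x
  have hdx : HasFDerivAt d (fderiv ℝ d x) (rotFirst 0 x) := by
    rw [hrot]
    exact (hd.defining.1.differentiable (by simp) x).hasFDerivAt
  have hconst : (fun θ : ℝ => d (rotFirst θ x)) =ᶠ[𝓝 0] fun _ => d x := by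
    have hlim := hcurve.continuousAt.tendsto
    rw [hrot] at hlim
    filter_upwards [hlim.eventually hx] with θ hθ
    rw [hθ, signedBdryDist_rotFirst h, hx.self_of_nhds]
  exact (hdx.comp_hasDerivAt (0 : ℝ) hcurve).unique
    ((hasDerivAt_const (0 : ℝ) (d x)).congr_of_eventuallyEq hconst)

theorem IsBoundaryDistance.rotation (hd : IsBoundaryDistance Ω d) (h : IsHartogs Ω)
    (hp : p ∈ frontier Ω) : ∀ᶠ x in 𝓝 p,
      x 0 * wirt 0 (fun x => (d x : ℂ)) x = conj (x 0) * wirtBar 0 (fun x => (d x : ℂ)) x := by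
  filter_upwards [hd.fderiv_rotation_eq_zero h hp] with x hx
  have hwirt := fderiv_ofReal_comp (hd.defining.1.differentiable (by simp) x)
    (EuclideanSpace.single 0 (I * x 0))
  rw [hx, fderiv_eq_wirt] at hwirt
  have hmul : I * (x 0 * wirt 0 (fun x => (d x : ℂ)) x
      - conj (x 0) * wirtBar 0 (fun x => (d x : ℂ)) x) = 0 := by
    simp at hwirt
    linear_combination hwirt
  exact sub_eq_zero.1 ((mul_eq_zero.1 hmul).resolve_left I_ne_zero)

end Rotation

section SignComparison

variable {E : Type*} [NormedAddCommGroup E] [NormedSpace ℝ E] {φ ψ : E → ℝ} {p t v : E}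

theorem hasDerivAt_parabola (p t v : E) (s : ℝ) :
    HasDerivAt (fun s : ℝ => p + s • t + s ^ 2 • v) (t + (2 * s) • v) s := by
  have hlinear := ((hasDerivAt_id s).smul_const t).const_add p
  have hsquare := ((hasDerivAt_id s).pow 2).smul_const v
  exact (hlinear.fun_add hsquare).congr_deriv (by simp)

theorem tendsto_parabola (p t v : E) :
    Tendsto (fun s : ℝ => p + s • t + s ^ 2 • v) (𝓝 0) (𝓝 p) := by
  simpa using (hasDerivAt_parabola p t v 0).continuousAt.tendsto

theorem eventually_hasDerivAt_comp_parabola (hφ : ContDiffAt ℝ 2 φ p) (t v : E) :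
    ∀ᶠ s : ℝ in 𝓝 0, HasDerivAt (fun s : ℝ => φ (p + s • t + s ^ 2 • v))
      (fderiv ℝ φ (p + s • t + s ^ 2 • v) (t + (2 * s) • v)) s := by
  filter_upwards [(tendsto_parabola p t v).eventually (hφ.eventually (by simp))] with s hs
  exact (hs.differentiableAt two_ne_zero).hasFDerivAt.comp_hasDerivAt s
    (hasDerivAt_parabola p t v s)

theorem deriv_comp_parabola (hφ : ContDiffAt ℝ 2 φ p) (t v : E) :
    deriv (fun s : ℝ => φ (p + s • t + s ^ 2 • v)) 0 = fderiv ℝ φ p t := by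
  simpa using (eventually_hasDerivAt_comp_parabola hφ t v).self_of_nhds.deriv

theorem deriv_deriv_comp_parabola (hφ : ContDiffAt ℝ 2 φ p) (t v : E) :
    deriv (deriv fun s : ℝ => φ (p + s • t + s ^ 2 • v)) 0
      = fderiv ℝ (fderiv ℝ φ) p t t + 2 * fderiv ℝ φ p v := by
  have hfirst : deriv (fun s : ℝ => φ (p + s • t + s ^ 2 • v)) =ᶠ[𝓝 0]
      fun s => fderiv ℝ φ (p + s • t + s ^ 2 • v) (t + (2 * s) • v) :=
    (eventually_hasDerivAt_comp_parabola hφ t v).mono fun s hs => hs.deriv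
  have hfderiv : HasFDerivAt (fderiv ℝ φ) (fderiv ℝ (fderiv ℝ φ) p)
      (p + (0 : ℝ) • t + (0 : ℝ) ^ 2 • v) := by
    simpa using ((hφ.fderiv_right (m := 1) (by norm_num)).differentiableAt one_ne_zero).hasFDerivAt
  have hvelocity : HasDerivAt (fun s : ℝ => t + (2 * s) • v) ((2 : ℝ) • v) 0 := by
    simpa using (((hasDerivAt_id (0 : ℝ)).const_mul 2).smul_const v).const_add t
  have hcurve := hfderiv.comp_hasDerivAt (0 : ℝ) (hasDerivAt_parabola p t v 0)
  rw [hfirst.deriv_eq]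
  refine (hcurve.clm_apply hvelocity).deriv.trans ?_
  simp

theorem fderiv_fderiv_add_nonpos_of_neg_iff (hφ : ContDiffAt ℝ 2 φ p) (hψ : ContDiffAt ℝ 2 ψ p)
    (hφ0 : φ p = 0) (hψ0 : ψ p = 0) (hs : ∀ᶠ x in 𝓝 p, φ x < 0 ↔ ψ x < 0)
    (htφ : fderiv ℝ φ p t = 0) (htψ : fderiv ℝ ψ p t = 0)
    (h : fderiv ℝ (fderiv ℝ φ) p t t + 2 * fderiv ℝ φ p v < 0) :
    fderiv ℝ (fderiv ℝ ψ) p t t + 2 * fderiv ℝ ψ p v ≤ 0 := by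
  by_contra! hpos
  rw [← deriv_deriv_comp_parabola hφ] at h
  rw [← deriv_deriv_comp_parabola hψ] at hpos
  have hmax := isLocalMax_of_deriv_deriv_neg h (by rw [deriv_comp_parabola hφ, htφ])
    (eventually_hasDerivAt_comp_parabola hφ t v).self_of_nhds.continuousAt
  have hmin := isLocalMin_of_deriv_deriv_pos hpos (by rw [deriv_comp_parabola hψ, htψ])
    (eventually_hasDerivAt_comp_parabola hψ t v).self_of_nhds.continuousAt
  have hp0 : p + (0 : ℝ) • t + (0 : ℝ) ^ 2 • v = p := by simp
  have hzero : (fun s : ℝ => φ (p + s • t + s ^ 2 • v)) =ᶠ[𝓝 0] fun _ => 0 := by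
    filter_upwards [hmax, hmin, (tendsto_parabola p t v).eventually hs] with s hφs hψs hiff
    rw [hp0, hφ0] at hφs
    rw [hp0, hψ0] at hψs
    exact hφs.antisymm (not_lt.1 fun hlt => (hiff.1 hlt).not_ge hψs)
  have hderiv := hzero.deriv.deriv_eq
  rw [deriv_const', deriv_const] at hderiv
  exact h.ne hderiv

theorem exists_pos_eq_smul_of_neg_imp_nonpos {ℓ m : E →L[ℝ] ℝ} (hℓ : ℓ ≠ 0) (hm : m ≠ 0)
    (h : ∀ v, ℓ v < 0 → m v ≤ 0) : ∃ c : ℝ, 0 < c ∧ m = c • ℓ := by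
  obtain ⟨u, hu⟩ : ∃ u, ℓ u = -1 := by
    obtain ⟨w, hw⟩ : ∃ w, ℓ w ≠ 0 := by
      by_contra! hzero
      exact hℓ (ContinuousLinearMap.ext hzero)
    exact ⟨-(ℓ w)⁻¹ • w, by simp [hw]⟩
  have hker : ∀ v, ℓ v = 0 → m v = 0 := by
    intro v hv
    by_contra hne
    have hle := h (u + ((1 - m u) / m v) • v) (by simp [hv, hu])
    rw [map_add, map_smul, smul_eq_mul, div_mul_cancel₀ _ hne] at hle
    linarith
  have heq : m = -m u • ℓ := by
    ext v
    have hzero := hker (v + ℓ v • u) (by simp [hu])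
    rw [map_add, map_smul, smul_eq_mul] at hzero
    rw [smul_apply, smul_eq_mul]
    linarith
  refine ⟨-m u, lt_of_le_of_ne (neg_nonneg.2 (h u (by simp [hu]))) fun h0 => hm ?_, heq⟩
  rw [heq, ← h0, zero_smul]

theorem exists_pos_fderiv_eq_smul_of_neg_iff (hφ : ContDiffAt ℝ 2 φ p) (hψ : ContDiffAt ℝ 2 ψ p)
    (hφ0 : φ p = 0) (hψ0 : ψ p = 0) (hs : ∀ᶠ x in 𝓝 p, φ x < 0 ↔ ψ x < 0)
    (hdφ : fderiv ℝ φ p ≠ 0) (hdψ : fderiv ℝ ψ p ≠ 0) :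
    ∃ c : ℝ, 0 < c ∧ fderiv ℝ ψ p = c • fderiv ℝ φ p := by
  refine exists_pos_eq_smul_of_neg_imp_nonpos hdφ hdψ fun v hv => ?_
  have h := fderiv_fderiv_add_nonpos_of_neg_iff (t := 0) (v := v) hφ hψ hφ0 hψ0 hs
    (map_zero _) (map_zero _) (by rw [map_zero]; linarith)
  rw [map_zero] at h
  linarith

theorem fderiv_fderiv_le_of_neg_iff {c : ℝ} (hφ : ContDiffAt ℝ 2 φ p) (hψ : ContDiffAt ℝ 2 ψ p)
    (hφ0 : φ p = 0) (hψ0 : ψ p = 0) (hs : ∀ᶠ x in 𝓝 p, φ x < 0 ↔ ψ x < 0)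
    (hdφ : fderiv ℝ φ p ≠ 0) (hc : 0 < c) (hψφ : fderiv ℝ ψ p = c • fderiv ℝ φ p)
    (ht : fderiv ℝ φ p t = 0) :
    fderiv ℝ (fderiv ℝ ψ) p t t ≤ c * fderiv ℝ (fderiv ℝ φ) p t t := by
  refine le_of_forall_pos_lt_add fun ε hε => ?_
  obtain ⟨v, hv⟩ : ∃ v, fderiv ℝ φ p v
      = -(fderiv ℝ (fderiv ℝ φ) p t t + ε / (2 * c)) / 2 := by
    obtain ⟨w, hw⟩ : ∃ w, fderiv ℝ φ p w ≠ 0 := by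
      by_contra! hzero
      exact hdφ (ContinuousLinearMap.ext hzero)
    exact ⟨_, by rw [map_smul, smul_eq_mul, div_mul_cancel₀ _ hw]⟩
  have hle := fderiv_fderiv_add_nonpos_of_neg_iff (v := v) hφ hψ hφ0 hψ0 hs ht (by simp [hψφ, ht])
    (by linarith [div_pos hε (mul_pos two_pos hc)])
  have hcancel : c * (ε / (2 * c)) = ε / 2 := by field_simp
  rw [hψφ, smul_apply, hv, smul_eq_mul] at hle
  linarith

theorem fderiv_fderiv_eq_of_neg_iff {c : ℝ} (hφ : ContDiffAt ℝ 2 φ p) (hψ : ContDiffAt ℝ 2 ψ p)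
    (hφ0 : φ p = 0) (hψ0 : ψ p = 0) (hs : ∀ᶠ x in 𝓝 p, φ x < 0 ↔ ψ x < 0)
    (hdφ : fderiv ℝ φ p ≠ 0) (hc : 0 < c) (hψφ : fderiv ℝ ψ p = c • fderiv ℝ φ p)
    (ht : fderiv ℝ φ p t = 0) :
    fderiv ℝ (fderiv ℝ ψ) p t t = c * fderiv ℝ (fderiv ℝ φ) p t t := by
  refine (fderiv_fderiv_le_of_neg_iff hφ hψ hφ0 hψ0 hs hdφ hc hψφ ht).antisymm ?_
  have hφψ : fderiv ℝ φ p = c⁻¹ • fderiv ℝ ψ p := by rw [hψφ, inv_smul_smul₀ hc.ne']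
  have hle := fderiv_fderiv_le_of_neg_iff (t := t) hψ hφ hψ0 hφ0 (hs.mono fun x hx => hx.symm)
    (by rw [hψφ]; exact smul_ne_zero hc.ne' hdφ) (inv_pos.2 hc) hφψ (by simp [hψφ, ht])
  rwa [← div_eq_inv_mul, le_div_iff₀' hc] at hle

end SignComparison

section LeviComparison

variable {φ ψ : C2 → ℝ} {p : C2}

theorem fderiv_eq_re_holDeriv (hφ : DifferentiableAt ℝ φ p) (t : C2) :
    fderiv ℝ φ p t = 2 * (holDeriv φ p t).re := by
  have h := congrArg re (fderiv_eq_wirt (fun x => (φ x : ℂ)) p t)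
  rw [fderiv_ofReal_comp hφ, ofReal_re] at h
  rw [h]
  simp only [← conj_wirt_ofReal, holDeriv, Fin.sum_univ_two, ← map_mul, add_re, conj_re]
  ring

theorem holDeriv_I_smul (φ : C2 → ℝ) (p t : C2) : holDeriv φ p (I • t) = I * holDeriv φ p t := by
  simpa using holDeriv_smul_add_smul φ p t 0 I 0

theorem holDeriv_eq_zero_iff (hφ : DifferentiableAt ℝ φ p) (t : C2) :
    holDeriv φ p t = 0 ↔ fderiv ℝ φ p t = 0 ∧ fderiv ℝ φ p (I • t) = 0 := by
  rw [fderiv_eq_re_holDeriv hφ, fderiv_eq_re_holDeriv hφ, holDeriv_I_smul, Complex.ext_iff]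
  simp

theorem fderiv_fderiv_eq_re_add_complexHessian (hφ : ContDiffAt ℝ 2 φ p) (t : C2) :
    fderiv ℝ (fderiv ℝ φ) p t t = 2 * (complexHessian φ p t +
      (∑ j : Fin 2, ∑ k : Fin 2, wirt k (wirt j (fun x => (φ x : ℂ))) p * t j * t k).re) := by
  have hfirst : (fun x => fderiv ℝ φ x t) =ᶠ[𝓝 p] fun x => 2 * (holDeriv φ x t).re :=
    (hφ.eventually (by simp)).mono fun x hx =>
      fderiv_eq_re_holDeriv (hx.differentiableAt two_ne_zero) t
  have hwirt : ∀ j, HasFDerivAt (wirt j (fun x => (φ x : ℂ)))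
      (fderiv ℝ (wirt j (fun x => (φ x : ℂ))) p) p := fun j =>
    ((contDiffAt_wirt (m := 1) j (contDiffAt_ofReal_comp hφ) (by norm_num)).differentiableAt
      one_ne_zero).hasFDerivAt
  have hhol : HasFDerivAt (fun x => 2 * (holDeriv φ x t).re) _ p :=
    (reCLM.hasFDerivAt.comp p (HasFDerivAt.fun_sum (u := Finset.univ) fun j _ =>
      (hwirt j).const_mul (t j))).const_mul 2
  have hsecond := congrArg (· t) ((hasFDerivAt_fderiv_apply hφ t).fderiv.symm.trans
    (hfirst.fderiv_eq.trans hhol.fderiv))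
  refine (show fderiv ℝ (fderiv ℝ φ) p t t = _ from hsecond).trans ?_
  simp only [smul_apply, add_apply, ContinuousLinearMap.comp_apply, reCLM_apply,
    smul_eq_mul, fderiv_eq_wirt, complexHessian_eq_re_leviForm, leviForm,
    wirt_wirtBar_comm (contDiffAt_ofReal_comp hφ), Fin.sum_univ_two, ← add_re]
  congr 2
  ring

theorem complexHessian_eq_fderiv (hφ : ContDiffAt ℝ 2 φ p) (t : C2) :
    complexHessian φ p t = (1 / 4 : ℝ) *
      (fderiv ℝ (fderiv ℝ φ) p t t + fderiv ℝ (fderiv ℝ φ) p (I • t) (I • t)) := by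
  rw [fderiv_fderiv_eq_re_add_complexHessian hφ, fderiv_fderiv_eq_re_add_complexHessian hφ]
  have hHessian : complexHessian φ p (I • t) = complexHessian φ p t := by
    simpa using complexHessian_smul_add_smul hφ t 0 I 0
  have hI : ∀ a b c : ℂ, a * (I * b) * (I * c) = -(a * b * c) := fun a b c => by
    linear_combination a * b * c * I_sq
  simp only [hHessian, PiLp.smul_apply, smul_eq_mul, hI, Finset.sum_neg_distrib, neg_re]
  ring

theorem exists_pos_complexHessian_eq_of_neg_iff (hφ : ContDiffAt ℝ 2 φ p)
    (hψ : ContDiffAt ℝ 2 ψ p) (hφ0 : φ p = 0) (hψ0 : ψ p = 0)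
    (hs : ∀ᶠ x in 𝓝 p, φ x < 0 ↔ ψ x < 0) (hdφ : fderiv ℝ φ p ≠ 0) (hdψ : fderiv ℝ ψ p ≠ 0) :
    ∃ c : ℝ, 0 < c ∧ ∀ t : C2, holDeriv φ p t = 0 →
      holDeriv ψ p t = 0 ∧ complexHessian ψ p t = c * complexHessian φ p t := by
  obtain ⟨c, hc, hψφ⟩ := exists_pos_fderiv_eq_smul_of_neg_iff hφ hψ hφ0 hψ0 hs hdφ hdψ
  have hsecond := fun t => fderiv_fderiv_eq_of_neg_iff (t := t) hφ hψ hφ0 hψ0 hs hdφ hc hψφ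
  refine ⟨c, hc, fun t ht => ?_⟩
  obtain ⟨hre, him⟩ := (holDeriv_eq_zero_iff (hφ.differentiableAt two_ne_zero) t).1 ht
  refine ⟨(holDeriv_eq_zero_iff (hψ.differentiableAt two_ne_zero) t).2 ?_, ?_⟩
  · simp [hψφ, hre, him]
  · rw [complexHessian_eq_fderiv hψ, complexHessian_eq_fderiv hφ, hsecond _ hre, hsecond _ him]
    ring

end LeviComparison

section Frame

variable {Ω : Set C2} {d φ : C2 → ℝ} {p x : C2}

/-- The complex tangential vector field `(∂d/∂w, -∂d/∂z)` of the level sets of `d`. -/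
noncomputable def tangentVec (d : C2 → ℝ) (x : C2) : C2 :=
  !₂[wirt 1 (fun x => (d x : ℂ)) x, -wirt 0 (fun x => (d x : ℂ)) x]

/-- The Levi form of `d` on the field `tangentVec d`; for a boundary distance `d` it vanishes
exactly at the weakly pseudoconvex boundary points. -/
noncomputable def leviFn (d : C2 → ℝ) (x : C2) : ℝ := complexHessian d x (tangentVec d x)

theorem holDeriv_tangentVec (d : C2 → ℝ) (x : C2) : holDeriv d x (tangentVec d x) = 0 := by
  simp only [holDeriv, tangentVec, Fin.sum_univ_two, PiLp.toLp_apply, Matrix.cons_val_zero,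
    Matrix.cons_val_one]
  ring

theorem holDeriv_gradient (hd : DifferentiableAt ℝ d x)
    (hE : wirt 0 (fun x => (d x : ℂ)) x * wirtBar 0 (fun x => (d x : ℂ)) x
      + wirt 1 (fun x => (d x : ℂ)) x * wirtBar 1 (fun x => (d x : ℂ)) x = 1 / 4) :
    holDeriv d x (∇ d x) = 1 / 2 := by
  simp only [holDeriv, gradient_eq_wirtBar hd, Fin.sum_univ_two, PiLp.toLp_apply,
    Matrix.cons_val_zero, Matrix.cons_val_one]
  linear_combination 2 * hE

theorem exists_eq_smul_tangentVec_add_smul_gradient (hd : DifferentiableAt ℝ d x)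
    (hE : wirt 0 (fun x => (d x : ℂ)) x * wirtBar 0 (fun x => (d x : ℂ)) x
      + wirt 1 (fun x => (d x : ℂ)) x * wirtBar 1 (fun x => (d x : ℂ)) x = 1 / 4) (t : C2) :
    ∃ a b : ℂ, t = a • tangentVec d x + b • ∇ d x := by
  refine ⟨4 * (t 0 * wirtBar 1 (fun x => (d x : ℂ)) x - t 1 * wirtBar 0 (fun x => (d x : ℂ)) x),
    2 * (t 0 * wirt 0 (fun x => (d x : ℂ)) x + t 1 * wirt 1 (fun x => (d x : ℂ)) x), ?_⟩
  rw [gradient_eq_wirtBar hd]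
  refine PiLp.ext (Fin.forall_fin_two.2 ⟨?_, ?_⟩) <;>
    simp only [tangentVec, PiLp.add_apply, PiLp.smul_apply, Matrix.cons_val_zero,
      Matrix.cons_val_one, smul_eq_mul]
  · linear_combination -4 * t 0 * hE
  · linear_combination -4 * t 1 * hE

theorem exists_eq_smul_tangentVec (hd : DifferentiableAt ℝ d x)
    (hE : wirt 0 (fun x => (d x : ℂ)) x * wirtBar 0 (fun x => (d x : ℂ)) x
      + wirt 1 (fun x => (d x : ℂ)) x * wirtBar 1 (fun x => (d x : ℂ)) x = 1 / 4) {t : C2}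
    (ht : holDeriv d x t = 0) : ∃ a : ℂ, t = a • tangentVec d x := by
  obtain ⟨a, b, rfl⟩ := exists_eq_smul_tangentVec_add_smul_gradient hd hE t
  rw [holDeriv_smul_add_smul, holDeriv_tangentVec, holDeriv_gradient hd hE] at ht
  have hb : b = 0 := by simpa using ht
  exact ⟨a, by rw [hb, zero_smul, add_zero]⟩

theorem tangentVec_ne_zero
    (hE : wirt 0 (fun x => (d x : ℂ)) x * wirtBar 0 (fun x => (d x : ℂ)) x
      + wirt 1 (fun x => (d x : ℂ)) x * wirtBar 1 (fun x => (d x : ℂ)) x = 1 / 4) :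
    tangentVec d x ≠ 0 := by
  intro h
  have h1 : wirt 1 (fun x => (d x : ℂ)) x = 0 := by
    simpa [tangentVec] using congrArg (fun v : C2 => v 0) h
  have h0 : wirt 0 (fun x => (d x : ℂ)) x = 0 := by
    simpa [tangentVec] using congrArg (fun v : C2 => v 1) h
  norm_num [h0, h1] at hE

theorem complexHessian_smul (hφ : ContDiffAt ℝ 2 φ p) (a : ℂ) (t : C2) :
    complexHessian φ p (a • t) = ‖a‖ ^ 2 * complexHessian φ p t := by
  simpa using complexHessian_smul_add_smul hφ t 0 a 0

theorem contDiff_tangentVec (hd : ContDiff ℝ ∞ d) : ContDiff ℝ ∞ (tangentVec d) := by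
  rw [contDiff_piLp 2]
  intro i
  fin_cases i
  · exact contDiff_wirt 1 (contDiff_ofReal_comp hd)
  · exact (contDiff_wirt 0 (contDiff_ofReal_comp hd)).neg

theorem contDiff_leviForm {u v : C2 → C2} (hφ : ContDiff ℝ ∞ φ) (hu : ContDiff ℝ ∞ u)
    (hv : ContDiff ℝ ∞ v) : ContDiff ℝ ∞ (fun x => leviForm φ x (u x) (v x)) := by
  have hu' := (contDiff_piLp 2).1 hu
  have hv' := (contDiff_piLp 2).1 hv
  unfold leviForm
  exact ContDiff.sum fun j _ => ContDiff.sum fun k _ =>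
    ((contDiff_wirt j (contDiff_wirtBar k (contDiff_ofReal_comp hφ))).mul (hu' j)).mul
      (conjCLE.contDiff.comp (hv' k))

theorem contDiff_complexHessian {u : C2 → C2} (hφ : ContDiff ℝ ∞ φ) (hu : ContDiff ℝ ∞ u) :
    ContDiff ℝ ∞ (fun x => complexHessian φ x (u x)) :=
  reCLM.contDiff.comp (contDiff_leviForm hφ hu hu)

theorem contDiff_holDeriv {u : C2 → C2} (hφ : ContDiff ℝ ∞ φ) (hu : ContDiff ℝ ∞ u) :
    ContDiff ℝ ∞ (fun x => holDeriv φ x (u x)) := by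
  have hu' := (contDiff_piLp 2).1 hu
  unfold holDeriv
  exact ContDiff.sum fun j _ => (hu' j).mul (contDiff_wirt j (contDiff_ofReal_comp hφ))

theorem contDiff_leviFn (hd : ContDiff ℝ ∞ d) : ContDiff ℝ ∞ (leviFn d) :=
  contDiff_complexHessian hd (contDiff_tangentVec hd)

theorem IsDefiningFunction.mono {m n : ℕ∞} (hmn : m ≤ n) (hd : IsDefiningFunction n Ω d) :
    IsDefiningFunction m Ω d :=
  ⟨hd.1.of_le (by exact_mod_cast hmn), hd.2⟩

theorem IsBoundaryDistance.leviFn_nonneg (hd : IsBoundaryDistance Ω d)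
    (hpsc : IsLeviPseudoconvex Ω) (hp : p ∈ frontier Ω) : 0 ≤ leviFn d p :=
  hpsc d (hd.defining.mono le_top) p hp _ (holDeriv_tangentVec d p)

theorem IsBoundaryDistance.leviFn_eq_zero_of_mem_weaklyPseudoconvexPoints
    (hd : IsBoundaryDistance Ω d) (hpsc : IsLeviPseudoconvex Ω)
    (hp : p ∈ weaklyPseudoconvexPoints Ω) : leviFn d p = 0 := by
  obtain ⟨hp, hweak⟩ := hp
  unfold IsStrictlyPseudoconvexAt at hweak
  push Not at hweak
  obtain ⟨r, hr, t, ht0, ht, hle⟩ := hweak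
  have hd2 : ContDiffAt ℝ 2 d p := hd.defining.1.contDiffAt.of_le ENat.LEInfty.out
  have hneg : ∀ x, r x < 0 ↔ d x < 0 := fun x =>
    Set.ext_iff.1 (hr.2.1.symm.trans hd.defining.2.1) x
  obtain ⟨c, hc, hcmp⟩ := exists_pos_complexHessian_eq_of_neg_iff hr.1.contDiffAt hd2
    (hr.eq_zero hp) (hd.defining.eq_zero hp) (Eventually.of_forall hneg) (hr.2.2 p hp)
    (hd.defining.2.2 p hp)
  obtain ⟨htan, hHess⟩ := hcmp t ht
  obtain ⟨a, rfl⟩ := exists_eq_smul_tangentVec (hd2.differentiableAt two_ne_zero)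
    (hd.eikonal hp).self_of_nhds htan
  have ha : 0 < ‖a‖ ^ 2 := by
    have : a ≠ 0 := fun h => ht0 (by rw [h, zero_smul])
    positivity
  rw [complexHessian_smul hd2] at hHess
  have hle0 : ‖a‖ ^ 2 * leviFn d p ≤ 0 :=
    hHess.trans_le (mul_nonpos_of_nonneg_of_nonpos hc.le hle)
  exact le_antisymm (nonpos_of_mul_nonpos_right hle0 ha) (hd.leviFn_nonneg hpsc hp)

theorem IsBoundaryDistance.mem_weaklyPseudoconvexPoints_iff (hd : IsBoundaryDistance Ω d)
    (hpsc : IsLeviPseudoconvex Ω) (hp : p ∈ frontier Ω) :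
    p ∈ weaklyPseudoconvexPoints Ω ↔ leviFn d p = 0 :=
  ⟨hd.leviFn_eq_zero_of_mem_weaklyPseudoconvexPoints hpsc, fun h => ⟨hp, fun hstrict =>
    h.not_gt (hstrict d (hd.defining.mono le_top) _
      (tangentVec_ne_zero (hd.eikonal hp).self_of_nhds) (holDeriv_tangentVec d p))⟩⟩

theorem IsBoundaryDistance.exists_fderiv_leviFn_eq (hd : IsBoundaryDistance Ω d)
    (hpsc : IsLeviPseudoconvex Ω) (hp : p ∈ frontier Ω) (h0 : leviFn d p = 0) :
    ∃ μ : ℝ, fderiv ℝ (leviFn d) p = -μ • fderiv ℝ d p := by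
  have hdc : ContDiff ℝ ∞ d := hd.defining.1
  have hmin : IsLocalExtrOn (leviFn d) {x | d x = d p} p := by
    left
    have hne : ∀ᶠ y in 𝓝 p, fderiv ℝ d y ≠ 0 :=
      (hdc.continuous_fderiv (by simp)).continuousAt.eventually_ne (hd.defining.2.2 p hp)
    filter_upwards [nhdsWithin_le_nhds hne, self_mem_nhdsWithin] with y hy hdy
    rw [h0]
    exact hd.leviFn_nonneg hpsc (mem_frontier_of_fderiv_ne_zero hd.defining.2.1
      (hdy.trans (hd.defining.eq_zero hp)) hy)
  obtain ⟨a, b, hab, hsum⟩ := hmin.exists_multipliers_of_hasStrictFDerivAt_1d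
    (hdc.contDiffAt.hasStrictFDerivAt (by simp))
    ((contDiff_leviFn hdc).contDiffAt.hasStrictFDerivAt (by simp))
  have hb : b ≠ 0 := by
    rintro rfl
    simp only [zero_smul, add_zero, smul_eq_zero, hd.defining.2.2 p hp, or_false] at hsum
    exact hab (by rw [hsum]; rfl)
  refine ⟨a / b, ?_⟩
  have hsmul : b • fderiv ℝ (leviFn d) p = -(a • fderiv ℝ d p) := eq_neg_of_add_eq_zero_right hsum
  rw [← inv_smul_smul₀ hb (fderiv ℝ (leviFn d) p), hsmul, smul_neg, smul_smul, neg_smul,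
    div_eq_inv_mul]

theorem IsBoundaryDistance.eventually_mul_le_of_hasStrictFDerivAt (hd : IsBoundaryDistance Ω d)
    (hp : p ∈ frontier Ω) {f : C2 → ℝ} {μ : ℝ}
    (hf : HasStrictFDerivAt f (-μ • fderiv ℝ d p) p) (hf0 : ∀ q ∈ frontier Ω, 0 ≤ f q) {ε : ℝ}
    (hε : 0 < ε) : ∀ᶠ x in 𝓝 p, x ∈ Ω → -d x * (μ - ε) ≤ f x := by
  have hdstrict : HasStrictFDerivAt d (fderiv ℝ d p) p :=
    hd.defining.1.contDiffAt.hasStrictFDerivAt (by simp)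
  have hg : HasStrictFDerivAt (fun x => f x + μ * d x) (0 : C2 →L[ℝ] ℝ) p :=
    (hf.fun_add (hdstrict.const_mul μ)).congr_fderiv (by module)
  obtain ⟨η, hη, hball⟩ := Metric.eventually_nhds_iff_ball.1 (hg.isLittleO.bound hε)
  filter_upwards [Metric.ball_mem_nhds p (half_pos hη), hd.eq_dist p hp] with x hx hdist hxΩ
  obtain ⟨q, hq, hxq, -⟩ := hd.defining.exists_foot ⟨p, hp⟩ x
  have hqp : dist q p < η := by
    have hle := Metric.infDist_le_dist_of_mem (x := x) hp
    rw [Metric.mem_ball] at hx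
    linarith [dist_triangle q x p, dist_comm q x]
  have hfoot := hball (x, q) (by
    rw [← ball_prod_same]
    exact ⟨Metric.ball_subset_ball (half_lt_self hη).le hx, hqp⟩)
  have hdneg : d x < 0 := by rwa [hd.defining.2.1] at hxΩ
  rw [zero_apply, sub_zero, ← dist_eq_norm x q, hxq, ← abs_signedBdryDist, ← hdist,
    abs_of_neg hdneg, Real.norm_eq_abs, hd.defining.eq_zero hq] at hfoot
  linarith [(abs_le.1 hfoot).1, hf0 q hq]

end Frame

section Criterion

variable {Ω : Set C2} {d ψ : C2 → ℝ} {p x : C2} {τ : ℝ}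

theorem holDeriv_log_add (hd : DifferentiableAt ℝ d x) (hψ : DifferentiableAt ℝ ψ x)
    (hx : d x ≠ 0) (t : C2) : holDeriv (fun y => Real.log (d y) + ψ y) x t
      = ((d x)⁻¹ : ℝ) * holDeriv d x t + holDeriv ψ x t := by
  rw [holDeriv_add (hd.log hx) hψ, holDeriv_comp (Real.differentiableAt_log hx) hd, Real.deriv_log]

theorem complexHessian_log_add (hd : ContDiffAt ℝ 2 d x) (hψ : ContDiffAt ℝ 2 ψ x)
    (hx : d x ≠ 0) (t : C2) : complexHessian (fun y => Real.log (d y) + ψ y) x t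
      = (d x)⁻¹ * complexHessian d x t - ((d x) ^ 2)⁻¹ * ‖holDeriv d x t‖ ^ 2
        + complexHessian ψ x t := by
  rw [complexHessian_eq_re_leviForm, leviForm_add (hd.log hx) hψ, add_re,
    ← complexHessian_eq_re_leviForm, ← complexHessian_eq_re_leviForm,
    complexHessian_comp (Real.contDiffAt_log.2 hx) hd, Real.deriv_log', deriv_inv]
  ring

theorem complexHessian_neg_exp_mul {u : C2 → ℝ} (hu : ContDiffAt ℝ 2 u x) (τ : ℝ) (t : C2) :
    complexHessian (fun y => -Real.exp (τ * u y)) x t = -(τ * Real.exp (τ * u x)) *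
      (complexHessian u x t + τ * ‖holDeriv u x t‖ ^ 2) := by
  have hderiv : deriv (fun s => -Real.exp (τ * s)) = fun s => -(Real.exp (τ * s) * τ) :=
    funext fun s => by simpa using (((hasDerivAt_id s).const_mul τ).exp).fun_neg.deriv
  have hderiv2 : deriv (fun s => -(Real.exp (τ * s) * τ)) (u x)
      = -(Real.exp (τ * u x) * τ * τ) := by
    simpa using ((((hasDerivAt_id (u x)).const_mul τ).exp).mul_const τ).fun_neg.deriv
  rw [complexHessian_comp (χ := fun s => -Real.exp (τ * s)) (by fun_prop) hu, hderiv, hderiv2]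
  ring

/-- `Real.log` is even, so that `Real.log (d y)` means `log (-d y)` here. -/
theorem neg_rpow_eventuallyEq_neg_exp (hd : ContinuousAt d x) (ψ : C2 → ℝ) (hx : d x < 0) (τ : ℝ) :
    (fun y => -((-(d y * Real.exp (ψ y))) ^ τ)) =ᶠ[𝓝 x]
      fun y => -Real.exp (τ * (Real.log (d y) + ψ y)) := by
  filter_upwards [hd.eventually (gt_mem_nhds hx)] with y hy
  have hpos : 0 < -(d y * Real.exp (ψ y)) := by
    rw [← neg_mul]
    exact mul_pos (neg_pos.2 hy) (Real.exp_pos _)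
  rw [Real.rpow_def_of_pos hpos, ← neg_mul, Real.log_mul (neg_pos.2 hy).ne' (Real.exp_pos _).ne',
    Real.log_exp, Real.log_neg_eq_log, mul_comm τ]

theorem complexHessian_neg_rpow (hd : ContDiffAt ℝ 2 d x) (hψ : ContDiffAt ℝ 2 ψ x)
    (hx : d x < 0) (τ : ℝ) (t : C2) :
    complexHessian (fun y => -((-(d y * Real.exp (ψ y))) ^ τ)) x t
      = τ * Real.exp (τ * (Real.log (d x) + ψ x)) / (-d x) *
        (complexHessian d x t + d x * (complexHessian ψ x t + τ * ‖holDeriv ψ x t‖ ^ 2)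
          + 2 * τ * (conj (holDeriv d x t) * holDeriv ψ x t).re
          - (1 - τ) / d x * ‖holDeriv d x t‖ ^ 2) := by
  have hx0 : d x ≠ 0 := hx.ne
  have hnorm : ‖((d x)⁻¹ : ℝ) * holDeriv d x t + holDeriv ψ x t‖ ^ 2
      = ((d x) ^ 2)⁻¹ * ‖holDeriv d x t‖ ^ 2 + ‖holDeriv ψ x t‖ ^ 2
        + 2 * (d x)⁻¹ * (conj (holDeriv d x t) * holDeriv ψ x t).re := by
    simp only [← normSq_eq_norm_sq, normSq_apply, add_re, add_im, mul_re, mul_im, ofReal_re,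
      ofReal_im, conj_re, conj_im]
    ring
  rw [complexHessian_congr_nhds (neg_rpow_eventuallyEq_neg_exp hd.continuousAt ψ hx τ),
    complexHessian_neg_exp_mul ((hd.log hx0).add hψ), complexHessian_log_add hd hψ hx0,
    holDeriv_log_add (hd.differentiableAt two_ne_zero) (hψ.differentiableAt two_ne_zero) hx0, hnorm]
  field_simp
  ring

/-- The Levi form of `exp (τ ψ)`, divided by `τ exp (τ ψ)`. -/
noncomputable def expLeviForm (τ : ℝ) (ψ : C2 → ℝ) (x s t : C2) : ℂ :=
  leviForm ψ x s t + τ * (holDeriv ψ x s * conj (holDeriv ψ x t))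

theorem expLeviForm_self_re (τ : ℝ) (ψ : C2 → ℝ) (x t : C2) :
    (expLeviForm τ ψ x t t).re = complexHessian ψ x t + τ * ‖holDeriv ψ x t‖ ^ 2 := by
  rw [expLeviForm, add_re, mul_conj, normSq_eq_norm_sq, re_ofReal_mul, ofReal_re,
    complexHessian_eq_re_leviForm]

theorem expLeviForm_smul_add_smul_re (hψ : ContDiffAt ℝ 2 ψ x) (τ : ℝ) (u v : C2) (a b : ℂ) :
    (expLeviForm τ ψ x (a • u + b • v) (a • u + b • v)).re
      = ‖a‖ ^ 2 * (expLeviForm τ ψ x u u).re + ‖b‖ ^ 2 * (expLeviForm τ ψ x v v).re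
        + 2 * (a * conj b * expLeviForm τ ψ x u v).re := by
  rw [expLeviForm_self_re, expLeviForm_self_re, expLeviForm_self_re,
    complexHessian_smul_add_smul hψ, holDeriv_smul_add_smul, expLeviForm]
  simp only [← normSq_eq_norm_sq, normSq_apply, add_re, add_im, mul_re, mul_im, ofReal_re,
    ofReal_im, conj_re, conj_im]
  ring

theorem continuous_expLeviForm {u v : C2 → C2} (hψ : ContDiff ℝ ∞ ψ) (hu : ContDiff ℝ ∞ u)
    (hv : ContDiff ℝ ∞ v) (τ : ℝ) : Continuous fun x => expLeviForm τ ψ x (u x) (v x) :=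
  (contDiff_leviForm hψ hu hv).continuous.add (continuous_const.mul
    ((contDiff_holDeriv hψ hu).continuous.mul
      (continuous_conj.comp (contDiff_holDeriv hψ hv).continuous)))

/-- The tangential-normal entry of the complex Hessian of `-(-d exp ψ) ^ τ` in the frame
`tangentVec d`, `∇ d`, up to the positive factor of `complexHessian_neg_rpow`. -/
noncomputable def crossCoeff (τ : ℝ) (d ψ : C2 → ℝ) (x : C2) : ℂ :=
  leviForm d x (tangentVec d x) (∇ d x) + d x * expLeviForm τ ψ x (tangentVec d x) (∇ d x)
    + (τ / 2 : ℝ) * holDeriv ψ x (tangentVec d x)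

/-- The part of the normal-normal entry of the complex Hessian of `-(-d exp ψ) ^ τ` which stays
bounded at the boundary, with the normalization of `crossCoeff`. -/
noncomputable def normalCoeff (τ : ℝ) (d ψ : C2 → ℝ) (x : C2) : ℝ :=
  complexHessian d x (∇ d x) + d x * (expLeviForm τ ψ x (∇ d x) (∇ d x)).re
    + τ * (holDeriv ψ x (∇ d x)).re

theorem continuous_crossCoeff (hd : ContDiff ℝ ∞ d) (hψ : ContDiff ℝ ∞ ψ) (τ : ℝ) :
    Continuous (crossCoeff τ d ψ) :=
  ((contDiff_leviForm hd (contDiff_tangentVec hd) (contDiff_gradient hd)).continuous.add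
    ((continuous_ofReal.comp hd.continuous).mul
      (continuous_expLeviForm hψ (contDiff_tangentVec hd) (contDiff_gradient hd) τ))).add
    (continuous_const.mul (contDiff_holDeriv hψ (contDiff_tangentVec hd)).continuous)

theorem continuous_normalCoeff (hd : ContDiff ℝ ∞ d) (hψ : ContDiff ℝ ∞ ψ) (τ : ℝ) :
    Continuous (normalCoeff τ d ψ) :=
  ((contDiff_complexHessian hd (contDiff_gradient hd)).continuous.add
    (hd.continuous.mul (continuous_re.comp
      (continuous_expLeviForm hψ (contDiff_gradient hd) (contDiff_gradient hd) τ)))).add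
    (continuous_const.mul
      (continuous_re.comp (contDiff_holDeriv hψ (contDiff_gradient hd)).continuous))

theorem complexHessian_neg_rpow_frame (hd : ContDiffAt ℝ 2 d x) (hψ : ContDiffAt ℝ 2 ψ x)
    (hx : d x < 0) (hE : wirt 0 (fun x => (d x : ℂ)) x * wirtBar 0 (fun x => (d x : ℂ)) x
      + wirt 1 (fun x => (d x : ℂ)) x * wirtBar 1 (fun x => (d x : ℂ)) x = 1 / 4)
    (τ : ℝ) (a b : ℂ) :
    complexHessian (fun y => -((-(d y * Real.exp (ψ y))) ^ τ)) x (a • tangentVec d x + b • ∇ d x)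
      = τ * Real.exp (τ * (Real.log (d x) + ψ x)) / (-d x) *
        (‖a‖ ^ 2 * (leviFn d x + d x * (expLeviForm τ ψ x (tangentVec d x) (tangentVec d x)).re)
          + 2 * (a * conj b * crossCoeff τ d ψ x).re
          + ‖b‖ ^ 2 * (normalCoeff τ d ψ x + (1 - τ) / 4 / (-d x))) := by
  have hhalf : (1 / 2 : ℂ) = ((1 / 2 : ℝ) : ℂ) := by push_cast; rfl
  have hdt : holDeriv d x (a • tangentVec d x + b • ∇ d x) = b * ((1 / 2 : ℝ) : ℂ) := by
    rw [holDeriv_smul_add_smul, holDeriv_tangentVec,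
      holDeriv_gradient (hd.differentiableAt two_ne_zero) hE, mul_zero, zero_add, hhalf]
  have hnorm : (1 - τ) / d x * ‖b * ((1 / 2 : ℝ) : ℂ)‖ ^ 2
      = -(‖b‖ ^ 2 * ((1 - τ) / 4 / (-d x))) := by
    rw [norm_mul, mul_pow, norm_real, Real.norm_eq_abs, sq_abs]
    have hx0 : d x ≠ 0 := hx.ne
    field_simp
    ring
  rw [complexHessian_neg_rpow hd hψ hx, ← expLeviForm_self_re, expLeviForm_smul_add_smul_re hψ,
    complexHessian_smul_add_smul hd, hdt, hnorm, holDeriv_smul_add_smul, crossCoeff, normalCoeff,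
    leviFn]
  simp only [← normSq_eq_norm_sq, normSq_apply, add_re, add_im, mul_re, mul_im, ofReal_re,
    ofReal_im, conj_re, conj_im]
  ring

theorem hermitianForm_nonneg {A E : ℝ} {β : ℂ} (hA : 0 ≤ A) (hE : 0 ≤ E) (h : ‖β‖ ^ 2 ≤ A * E)
    (a b : ℂ) : 0 ≤ ‖a‖ ^ 2 * A + 2 * (a * conj b * β).re + ‖b‖ ^ 2 * E := by
  have hβ : ‖β‖ ≤ √A * √E := by
    rw [← Real.sqrt_mul hA]
    exact Real.le_sqrt_of_sq_le h
  have hre : -(‖a‖ * ‖b‖ * (√A * √E)) ≤ (a * conj b * β).re := by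
    have habs := abs_re_le_norm (a * conj b * β)
    rw [norm_mul, norm_mul, norm_conj] at habs
    have := mul_le_mul_of_nonneg_left hβ (by positivity : 0 ≤ ‖a‖ * ‖b‖)
    linarith [(abs_le.1 habs).1]
  calc 0 ≤ (‖a‖ * √A - ‖b‖ * √E) ^ 2 := sq_nonneg _
    _ = ‖a‖ ^ 2 * A + 2 * -(‖a‖ * ‖b‖ * (√A * √E)) + ‖b‖ ^ 2 * E := by
      rw [sub_sq, mul_pow, mul_pow, Real.sq_sqrt hA, Real.sq_sqrt hE]
      ring
    _ ≤ _ := by gcongr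

theorem complexHessian_neg_rpow_nonneg (hd : ContDiffAt ℝ 2 d x) (hψ : ContDiffAt ℝ 2 ψ x)
    (hx : d x < 0) (hE : wirt 0 (fun x => (d x : ℂ)) x * wirtBar 0 (fun x => (d x : ℂ)) x
      + wirt 1 (fun x => (d x : ℂ)) x * wirtBar 1 (fun x => (d x : ℂ)) x = 1 / 4)
    (hτ : 0 ≤ τ) {A : ℝ} (hA : 0 ≤ A) (htan : -d x * A
      ≤ leviFn d x + d x * (expLeviForm τ ψ x (tangentVec d x) (tangentVec d x)).re)
    (hnormal : 0 ≤ (1 - τ) / 4 - d x * normalCoeff τ d ψ x)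
    (hcross : ‖crossCoeff τ d ψ x‖ ^ 2 ≤ A * ((1 - τ) / 4 - d x * normalCoeff τ d ψ x)) (t : C2) :
    0 ≤ complexHessian (fun y => -((-(d y * Real.exp (ψ y))) ^ τ)) x t := by
  obtain ⟨a, b, rfl⟩ := exists_eq_smul_tangentVec_add_smul_gradient
    (hd.differentiableAt two_ne_zero) hE t
  have hs : 0 < -d x := neg_pos.2 hx
  have hdiv : normalCoeff τ d ψ x + (1 - τ) / 4 / (-d x)
      = ((1 - τ) / 4 - d x * normalCoeff τ d ψ x) / (-d x) := by
    have hx0 : d x ≠ 0 := hx.ne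
    field_simp
    ring
  rw [complexHessian_neg_rpow_frame hd hψ hx hE, hdiv]
  have htan0 := (mul_nonneg hs.le hA).trans htan
  refine mul_nonneg (by positivity)
    (hermitianForm_nonneg htan0 (div_nonneg hnormal hs.le) (hcross.trans ?_) a b)
  rw [mul_div_assoc', le_div_iff₀ hs]
  calc _ = -d x * A * ((1 - τ) / 4 - d x * normalCoeff τ d ψ x) := by ring
    _ ≤ _ := mul_le_mul_of_nonneg_right htan hnormal

theorem IsBoundaryDistance.eventually_complexHessian_neg_rpow_nonneg (hd : IsBoundaryDistance Ω d)
    (hψ : ContDiff ℝ ∞ ψ) (hτ0 : 0 ≤ τ) (hτ1 : τ < 1) (hp : p ∈ frontier Ω) {A : ℝ} (hA : 0 ≤ A)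
    (htan : ∀ᶠ x in 𝓝 p, x ∈ Ω → -d x * A
      ≤ leviFn d x + d x * (expLeviForm τ ψ x (tangentVec d x) (tangentVec d x)).re)
    (hcross : ‖crossCoeff τ d ψ p‖ ^ 2 < A * ((1 - τ) / 4)) :
    ∀ᶠ x in 𝓝 p, x ∈ Ω → ∀ t,
      0 ≤ complexHessian (fun y => -((-(d y * Real.exp (ψ y))) ^ τ)) x t := by
  have hdc : ContDiff ℝ ∞ d := hd.defining.1
  have hd0 : d p = 0 := hd.defining.eq_zero hp
  have hcoeff : Continuous fun x => (1 - τ) / 4 - d x * normalCoeff τ d ψ x :=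
    continuous_const.sub (hdc.continuous.mul (continuous_normalCoeff hdc hψ τ))
  have hnormal : ∀ᶠ x in 𝓝 p, 0 < (1 - τ) / 4 - d x * normalCoeff τ d ψ x :=
    hcoeff.continuousAt.eventually_const_lt (by
      simpa only [hd0, zero_mul, sub_zero] using (by linarith : 0 < (1 - τ) / 4))
  have hcross' : ∀ᶠ x in 𝓝 p,
      ‖crossCoeff τ d ψ x‖ ^ 2 < A * ((1 - τ) / 4 - d x * normalCoeff τ d ψ x) :=
    ((continuous_crossCoeff hdc hψ τ).norm.pow 2).continuousAt.eventually_lt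
      (continuous_const.mul hcoeff).continuousAt (by simpa [hd0] using hcross)
  filter_upwards [htan, hnormal, hcross', hd.eikonal hp] with x htanx hnormalx hcrossx hE hxΩ
  rw [hd.defining.2.1] at hxΩ
  exact complexHessian_neg_rpow_nonneg (hdc.contDiffAt.of_le ENat.LEInfty.out)
    (hψ.contDiffAt.of_le ENat.LEInfty.out) hxΩ hE hτ0 hA (htanx (hd.defining.2.1 ▸ hxΩ))
    hnormalx.le hcrossx.le

theorem IsBoundaryDistance.eventually_complexHessian_neg_rpow_nonneg_of_weak
    (hd : IsBoundaryDistance Ω d) (hpsc : IsLeviPseudoconvex Ω) (hψ : ContDiff ℝ ∞ ψ)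
    (hτ0 : 0 ≤ τ) (hτ1 : τ < 1) (hp : p ∈ frontier Ω) {μ : ℝ}
    (hμ : fderiv ℝ (leviFn d) p = -μ • fderiv ℝ d p)
    (hcross : ‖crossCoeff τ d ψ p‖ ^ 2
      < (1 - τ) / 4 * (μ - (expLeviForm τ ψ p (tangentVec d p) (tangentVec d p)).re)) :
    ∀ᶠ x in 𝓝 p, x ∈ Ω → ∀ t,
      0 ≤ complexHessian (fun y => -((-(d y * Real.exp (ψ y))) ^ τ)) x t := by
  have hdc : ContDiff ℝ ∞ d := hd.defining.1
  have hτ : 0 < (1 - τ) / 4 := by linarith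
  obtain ⟨A, hlower, hupper⟩ := exists_between ((div_lt_iff₀' hτ).2 hcross)
  have hcont : Continuous fun x => (expLeviForm τ ψ x (tangentVec d x) (tangentVec d x)).re :=
    continuous_re.comp (continuous_expLeviForm hψ (contDiff_tangentVec hdc)
      (contDiff_tangentVec hdc) τ)
  set h : C2 → ℝ := fun x => (expLeviForm τ ψ x (tangentVec d x) (tangentVec d x)).re
  set ε := (μ - h p - A) / 2 with hε
  have hε0 : 0 < ε := half_pos (sub_pos.2 hupper)
  refine hd.eventually_complexHessian_neg_rpow_nonneg hψ hτ0 hτ1 hp (A := A)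
    ((div_nonneg (sq_nonneg _) hτ.le).trans hlower.le) ?_ ((div_lt_iff₀ hτ).1 hlower)
  have hstrict : HasStrictFDerivAt (leviFn d) (-μ • fderiv ℝ d p) p :=
    hμ ▸ (contDiff_leviFn hdc).contDiffAt.hasStrictFDerivAt (by simp)
  filter_upwards [hd.eventually_mul_le_of_hasStrictFDerivAt hp hstrict
      (fun q hq => hd.leviFn_nonneg hpsc hq) hε0,
    hcont.continuousAt.eventually_lt_const (lt_add_of_pos_right (h p) hε0)] with x hlevi hlt hxΩ
  have hdx : d x < 0 := by rwa [hd.defining.2.1] at hxΩ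
  have hle := mul_le_mul_of_nonneg_left hlt.le (neg_pos.2 hdx).le
  calc -d x * A = -d x * (μ - ε) - -d x * (h p + ε) := by rw [hε]; ring
    _ ≤ leviFn d x - -d x * h x := sub_le_sub (hlevi hxΩ) hle
    _ = leviFn d x + d x * h x := by ring

theorem IsBoundaryDistance.eventually_complexHessian_neg_rpow_nonneg_of_strict
    (hd : IsBoundaryDistance Ω d) (hψ : ContDiff ℝ ∞ ψ) (hτ0 : 0 ≤ τ) (hτ1 : τ < 1)
    (hp : p ∈ frontier Ω) (hpos : 0 < leviFn d p) :
    ∀ᶠ x in 𝓝 p, x ∈ Ω → ∀ t,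
      0 ≤ complexHessian (fun y => -((-(d y * Real.exp (ψ y))) ^ τ)) x t := by
  have hdc : ContDiff ℝ ∞ d := hd.defining.1
  have hτ : 0 < (1 - τ) / 4 := by linarith
  obtain ⟨A, hA⟩ := exists_gt (‖crossCoeff τ d ψ p‖ ^ 2 / ((1 - τ) / 4))
  refine hd.eventually_complexHessian_neg_rpow_nonneg hψ hτ0 hτ1 hp
    ((div_nonneg (sq_nonneg _) hτ.le).trans hA.le) ?_ ((div_lt_iff₀ hτ).1 hA)
  have hlt : ∀ᶠ x in 𝓝 p, -d x * A
      < leviFn d x + d x * (expLeviForm τ ψ x (tangentVec d x) (tangentVec d x)).re := by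
    refine (hdc.continuous.neg.mul continuous_const).continuousAt.eventually_lt
      ((contDiff_leviFn hdc).continuous.add (hdc.continuous.mul (continuous_re.comp
        (continuous_expLeviForm hψ (contDiff_tangentVec hdc) (contDiff_tangentVec hdc) τ)))
      ).continuousAt ?_
    simpa [hd.defining.eq_zero hp] using hpos
  exact hlt.mono fun x hx _ => hx.le

end Criterion

section JetIdentities

variable {D : C2 → ℂ} {p : C2}

theorem conj_wirt_wirt_of_conj_eq (hr : ∀ x, conj (D x) = D x) (j k : Fin 2) (x : C2) :
    conj (wirt j (wirt k D) x) = wirtBar j (wirtBar k D) x := by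
  rw [← wirtBar_conj]
  simp only [conj_wirt_of_conj_eq hr]

theorem wirtBar_wirt_eq (hD : ContDiff ℝ ∞ D) (j k : Fin 2) :
    wirtBar j (wirt k D) = wirt k (wirtBar j D) :=
  funext fun _ => (wirt_wirtBar_comm (hD.contDiffAt.of_le ENat.LEInfty.out) k j).symm

theorem wirt_wirt_eq (hD : ContDiff ℝ ∞ D) (j k : Fin 2) :
    wirt j (wirt k D) = wirt k (wirt j D) :=
  funext fun _ => wirt_wirt_comm (hD.contDiffAt.of_le ENat.LEInfty.out) j k

theorem wirtBar_wirtBar_eq (hD : ContDiff ℝ ∞ D) (j k : Fin 2) :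
    wirtBar j (wirtBar k D) = wirtBar k (wirtBar j D) :=
  funext fun _ => wirtBar_wirtBar_comm (hD.contDiffAt.of_le ENat.LEInfty.out) j k

theorem differentiable_coord (i : Fin 2) : Differentiable ℝ (fun x : C2 => x i) :=
  (contDiff_coord (n := 1) i).differentiable (by norm_num)

theorem differentiable_conj_coord (i : Fin 2) : Differentiable ℝ (fun x : C2 => conj (x i)) :=
  (conjCLE.contDiff.comp (contDiff_coord (n := 1) i)).differentiable (by norm_num)

theorem wirt_eikonal (hD : ContDiff ℝ ∞ D)
    (hE : ∀ᶠ x in 𝓝 p, wirt 0 D x * wirtBar 0 D x + wirt 1 D x * wirtBar 1 D x = 1 / 4)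
    (j : Fin 2) : wirt 0 D p * wirt j (wirtBar 0 D) p + wirt j (wirt 0 D) p * wirtBar 0 D p
      + (wirt 1 D p * wirt j (wirtBar 1 D) p + wirt j (wirt 1 D) p * wirtBar 1 D p) = 0 := by
  have h := wirt_congr_nhds (j := j) hE
  have hz := differentiable_wirt 0 hD
  have hw := differentiable_wirt 1 hD
  have hzbar := differentiable_wirtBar 0 hD
  have hwbar := differentiable_wirtBar 1 hD
  rw [wirt_add j ((hz p).fun_mul (hzbar p)) ((hw p).fun_mul (hwbar p)), wirt_mul j (hz p) (hzbar p),
    wirt_mul j (hw p) (hwbar p), wirt_const] at h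
  exact h

theorem wirtBar_eikonal (hD : ContDiff ℝ ∞ D)
    (hE : ∀ᶠ x in 𝓝 p, wirt 0 D x * wirtBar 0 D x + wirt 1 D x * wirtBar 1 D x = 1 / 4)
    (j : Fin 2) : wirt 0 D p * wirtBar j (wirtBar 0 D) p + wirtBar j (wirt 0 D) p * wirtBar 0 D p
      + (wirt 1 D p * wirtBar j (wirtBar 1 D) p + wirtBar j (wirt 1 D) p * wirtBar 1 D p) = 0 := by
  have h := wirtBar_congr_nhds (j := j) hE
  have hz := differentiable_wirt 0 hD
  have hw := differentiable_wirt 1 hD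
  have hzbar := differentiable_wirtBar 0 hD
  have hwbar := differentiable_wirtBar 1 hD
  rw [wirtBar_add j ((hz p).fun_mul (hzbar p)) ((hw p).fun_mul (hwbar p)),
    wirtBar_mul j (hz p) (hzbar p), wirtBar_mul j (hw p) (hwbar p), wirtBar_const] at h
  exact h

theorem wirt_wirtBar_eikonal (hD : ContDiff ℝ ∞ D)
    (hE : ∀ᶠ x in 𝓝 p, wirt 0 D x * wirtBar 0 D x + wirt 1 D x * wirtBar 1 D x = 1 / 4)
    (h0 : wirt 0 D p = 0) (h0' : wirtBar 0 D p = 0) (h00 : wirt 0 (wirtBar 0 D) p = 0) :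
    wirt 0 (wirt 0 D) p * wirtBar 0 (wirtBar 0 D) p
      + wirt 0 (wirt 1 D) p * wirtBar 0 (wirtBar 1 D) p
      + wirt 1 (wirtBar 0 D) p * wirt 0 (wirtBar 1 D) p
      + wirt 1 D p * wirtBar 1 (wirt 0 (wirtBar 0 D)) p
      + wirt 1 (wirt 0 (wirtBar 0 D)) p * wirtBar 1 D p = 0 := by
  have hev : (fun x => wirt 0 D x * wirtBar 0 (wirtBar 0 D) x
      + wirtBar 0 (wirt 0 D) x * wirtBar 0 D x
      + (wirt 1 D x * wirtBar 0 (wirtBar 1 D) x + wirtBar 0 (wirt 1 D) x * wirtBar 1 D x))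
      =ᶠ[𝓝 p] fun _ => 0 :=
    hE.eventually_nhds.mono fun x hx => wirtBar_eikonal hD hx 0
  have h := wirt_congr_nhds (j := 0) hev
  have hz := differentiable_wirt 0 hD p
  have hw := differentiable_wirt 1 hD p
  have hzbar := differentiable_wirtBar 0 hD p
  have hwbar := differentiable_wirtBar 1 hD p
  have hzbar_zbar := differentiable_wirtBar 0 (contDiff_wirtBar 0 hD) p
  have hzbar_wbar := differentiable_wirtBar 0 (contDiff_wirtBar 1 hD) p
  have hzbar_z := differentiable_wirtBar 0 (contDiff_wirt 0 hD) p
  have hzbar_w := differentiable_wirtBar 0 (contDiff_wirt 1 hD) p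
  rw [wirt_add 0 ((hz.fun_mul hzbar_zbar).fun_add (hzbar_z.fun_mul hzbar))
      ((hw.fun_mul hzbar_wbar).fun_add (hzbar_w.fun_mul hwbar)),
    wirt_add 0 (hz.fun_mul hzbar_zbar) (hzbar_z.fun_mul hzbar),
    wirt_add 0 (hw.fun_mul hzbar_wbar) (hzbar_w.fun_mul hwbar),
    wirt_mul 0 hz hzbar_zbar, wirt_mul 0 hzbar_z hzbar,
    wirt_mul 0 hw hzbar_wbar, wirt_mul 0 hzbar_w hwbar, wirt_const, h0, h0',
    wirtBar_wirt_eq hD 0 0, wirtBar_wirt_eq hD 0 1, h00] at h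
  have hthird : wirt 0 (wirtBar 0 (wirtBar 1 D)) p = wirtBar 1 (wirt 0 (wirtBar 0 D)) p := by
    rw [wirtBar_wirtBar_eq hD 0 1, ← wirtBar_wirt_eq (contDiff_wirtBar 0 hD)]
  have hthird' : wirt 0 (wirt 1 (wirtBar 0 D)) p = wirt 1 (wirt 0 (wirtBar 0 D)) p := by
    rw [wirt_wirt_eq (contDiff_wirtBar 0 hD) 1 0]
  rw [hthird, hthird'] at h
  linear_combination h

theorem rotation_wirt_one (hD : ContDiff ℝ ∞ D)
    (hR : ∀ᶠ x in 𝓝 p, x 0 * wirt 0 D x = conj (x 0) * wirtBar 0 D x) :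
    p 0 * wirt 0 (wirt 1 D) p = conj (p 0) * wirt 1 (wirtBar 0 D) p := by
  have h := wirt_congr_nhds (j := 1) hR
  rw [wirt_mul 1 (differentiable_coord 0 p) (differentiable_wirt 0 hD p),
    wirt_mul 1 (differentiable_conj_coord 0 p) (differentiable_wirtBar 0 hD p), wirt_coord,
    wirt_conj_coord, wirt_wirt_eq hD 1 0] at h
  simpa using h

theorem rotation_wirt_zero (hD : ContDiff ℝ ∞ D)
    (hR : ∀ᶠ x in 𝓝 p, x 0 * wirt 0 D x = conj (x 0) * wirtBar 0 D x) :
    wirt 0 D p + p 0 * wirt 0 (wirt 0 D) p = conj (p 0) * wirt 0 (wirtBar 0 D) p := by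
  have h := wirt_congr_nhds (j := 0) hR
  rw [wirt_mul 0 (differentiable_coord 0 p) (differentiable_wirt 0 hD p),
    wirt_mul 0 (differentiable_conj_coord 0 p) (differentiable_wirtBar 0 hD p), wirt_coord,
    wirt_conj_coord] at h
  simp only [if_true, one_mul, zero_mul, add_zero] at h
  linear_combination h

theorem wirtBar_zero_eq_zero_of_coord (hD : ContDiff ℝ ∞ D)
    (hR : ∀ᶠ x in 𝓝 p, x 0 * wirt 0 D x = conj (x 0) * wirtBar 0 D x) (hz : p 0 = 0) :
    wirtBar 0 D p = 0 := by
  have h := wirtBar_congr_nhds (j := 0) hR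
  rw [wirtBar_mul 0 (differentiable_coord 0 p) (differentiable_wirt 0 hD p),
    wirtBar_mul 0 (differentiable_conj_coord 0 p) (differentiable_wirtBar 0 hD p), wirtBar_coord,
    wirtBar_conj_coord, hz] at h
  simpa using h.symm

theorem rotation_mixed_eq_zero_of_coord (hD : ContDiff ℝ ∞ D)
    (hR : ∀ᶠ x in 𝓝 p, x 0 * wirt 0 D x = conj (x 0) * wirtBar 0 D x) (hz : p 0 = 0) :
    wirt 1 (wirtBar 0 D) p = 0 := by
  have hev : (fun x : C2 => x 0 * wirt 0 (wirt 1 D) x)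
      =ᶠ[𝓝 p] fun x => conj (x 0) * wirt 1 (wirtBar 0 D) x :=
    hR.eventually_nhds.mono fun x hx => rotation_wirt_one hD hx
  have h := wirtBar_congr_nhds (j := 0) hev
  rw [wirtBar_mul 0 (differentiable_coord 0 p) (differentiable_wirt 0 (contDiff_wirt 1 hD) p),
    wirtBar_mul 0 (differentiable_conj_coord 0 p) (differentiable_wirt 1 (contDiff_wirtBar 0 hD) p),
    wirtBar_coord, wirtBar_conj_coord, hz] at h
  simpa using h.symm

theorem rotation_wirt_one_zero (hD : ContDiff ℝ ∞ D)
    (hR : ∀ᶠ x in 𝓝 p, x 0 * wirt 0 D x = conj (x 0) * wirtBar 0 D x) :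
    wirt 0 (wirt 1 D) p + p 0 * wirt 0 (wirt 0 (wirt 1 D)) p
      = conj (p 0) * wirt 1 (wirt 0 (wirtBar 0 D)) p := by
  have hev : (fun x : C2 => x 0 * wirt 0 (wirt 1 D) x)
      =ᶠ[𝓝 p] fun x => conj (x 0) * wirt 1 (wirtBar 0 D) x :=
    hR.eventually_nhds.mono fun x hx => rotation_wirt_one hD hx
  have h := wirt_congr_nhds (j := 0) hev
  rw [wirt_mul 0 (differentiable_coord 0 p) (differentiable_wirt 0 (contDiff_wirt 1 hD) p),
    wirt_mul 0 (differentiable_conj_coord 0 p) (differentiable_wirt 1 (contDiff_wirtBar 0 hD) p),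
    wirt_coord, wirt_conj_coord, ← wirt_wirt_eq (contDiff_wirtBar 0 hD) 1 0] at h
  simp only [if_true, one_mul, zero_mul, add_zero] at h
  linear_combination h

/-- The Levi determinant `∑ j k, D_{jk̄} L_j L̄_k` with `L = (D_w, -D_z)`, as a complex function. -/
noncomputable def leviDet (D : C2 → ℂ) (x : C2) : ℂ :=
  (wirt 0 (wirtBar 0 D) x * (wirt 1 D x * wirtBar 1 D x)
    - wirt 0 (wirtBar 1 D) x * (wirt 1 D x * wirtBar 0 D x))
  - (wirt 1 (wirtBar 0 D) x * (wirt 0 D x * wirtBar 1 D x)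
    - wirt 1 (wirtBar 1 D) x * (wirt 0 D x * wirtBar 0 D x))

theorem wirt_leviDet (hD : ContDiff ℝ ∞ D) (j : Fin 2) (p : C2) :
    wirt j (leviDet D) p =
      (wirt j (wirt 0 (wirtBar 0 D)) p * (wirt 1 D p * wirtBar 1 D p)
        - wirt j (wirt 0 (wirtBar 1 D)) p * (wirt 1 D p * wirtBar 0 D p)
        - wirt j (wirt 1 (wirtBar 0 D)) p * (wirt 0 D p * wirtBar 1 D p)
        + wirt j (wirt 1 (wirtBar 1 D)) p * (wirt 0 D p * wirtBar 0 D p))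
      + wirt 0 (wirtBar 0 D) p *
        (wirt j (wirt 1 D) p * wirtBar 1 D p + wirt 1 D p * wirt j (wirtBar 1 D) p)
      - wirt 0 (wirtBar 1 D) p *
        (wirt j (wirt 1 D) p * wirtBar 0 D p + wirt 1 D p * wirt j (wirtBar 0 D) p)
      - wirt 1 (wirtBar 0 D) p *
        (wirt j (wirt 0 D) p * wirtBar 1 D p + wirt 0 D p * wirt j (wirtBar 1 D) p)
      + wirt 1 (wirtBar 1 D) p *
        (wirt j (wirt 0 D) p * wirtBar 0 D p + wirt 0 D p * wirt j (wirtBar 0 D) p) := by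
  have hz := differentiable_wirt 0 hD p
  have hw := differentiable_wirt 1 hD p
  have hzbar := differentiable_wirtBar 0 hD p
  have hwbar := differentiable_wirtBar 1 hD p
  have hzzbar := differentiable_wirt 0 (contDiff_wirtBar 0 hD) p
  have hzwbar := differentiable_wirt 0 (contDiff_wirtBar 1 hD) p
  have hwzbar := differentiable_wirt 1 (contDiff_wirtBar 0 hD) p
  have hwwbar := differentiable_wirt 1 (contDiff_wirtBar 1 hD) p
  unfold leviDet
  rw [wirt_sub j ((hzzbar.fun_mul (hw.fun_mul hwbar)).fun_sub (hzwbar.fun_mul (hw.fun_mul hzbar)))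
      ((hwzbar.fun_mul (hz.fun_mul hwbar)).fun_sub (hwwbar.fun_mul (hz.fun_mul hzbar))),
    wirt_sub j (hzzbar.fun_mul (hw.fun_mul hwbar)) (hzwbar.fun_mul (hw.fun_mul hzbar)),
    wirt_sub j (hwzbar.fun_mul (hz.fun_mul hwbar)) (hwwbar.fun_mul (hz.fun_mul hzbar)),
    wirt_mul j hzzbar (hw.fun_mul hwbar), wirt_mul j hzwbar (hw.fun_mul hzbar),
    wirt_mul j hwzbar (hz.fun_mul hwbar), wirt_mul j hwwbar (hz.fun_mul hzbar),
    wirt_mul j hw hwbar, wirt_mul j hw hzbar, wirt_mul j hz hwbar, wirt_mul j hz hzbar]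
  ring

end JetIdentities

section LeviFn

theorem leviForm_tangentVec_eq (d : C2 → ℝ) (x : C2) :
    leviForm d x (tangentVec d x) (tangentVec d x) = leviDet (fun x => (d x : ℂ)) x := by
  simp only [leviForm, tangentVec, leviDet, Fin.sum_univ_two, Matrix.cons_val_zero,
    Matrix.cons_val_one, conj_wirt_ofReal, map_neg, mul_neg, neg_mul, neg_neg]
  ring

theorem ofReal_leviFn {d : C2 → ℝ} (hd : ContDiff ℝ ∞ d) :
    (fun x => (leviFn d x : ℂ)) = leviDet (fun x => (d x : ℂ)) := by
  funext x
  rw [← leviForm_tangentVec_eq, leviFn, complexHessian_eq_re_leviForm]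
  exact conj_eq_iff_re.1 (conj_leviForm (hd.contDiffAt.of_le ENat.LEInfty.out) _ _)

theorem wirt_leviDet_of_fderiv {d : C2 → ℝ} (hd : ContDiff ℝ ∞ d) {p : C2} {μ : ℝ}
    (hμ : fderiv ℝ (leviFn d) p = -μ • fderiv ℝ d p) (j : Fin 2) :
    wirt j (leviDet (fun x => (d x : ℂ))) p = -μ * wirt j (fun x => (d x : ℂ)) p := by
  rw [← ofReal_leviFn hd]
  have hlevi : DifferentiableAt ℝ (leviFn d) p := (contDiff_leviFn hd).differentiable (by simp) p
  have hdiff : DifferentiableAt ℝ d p := hd.differentiable (by simp) p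
  simp only [wirt, fderiv_ofReal_comp hlevi, fderiv_ofReal_comp hdiff, hμ, smul_apply,
    smul_eq_mul]
  push_cast
  ring

end LeviFn

section FlatPoints

variable {D : C2 → ℂ} {p : C2} {μ : ℝ}

theorem wirt_one_mul_wirtBar_one_of_wirt_zero_eq_zero
    (hE : wirt 0 D p * wirtBar 0 D p + wirt 1 D p * wirtBar 1 D p = 1 / 4)
    (h0 : wirt 0 D p = 0) : wirt 1 D p * wirtBar 1 D p = 1 / 4 := by
  rwa [h0, zero_mul, zero_add] at hE

theorem norm_wirt_one_of_wirt_zero_eq_zero (hr : ∀ x, conj (D x) = D x)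
    (hE : wirt 0 D p * wirtBar 0 D p + wirt 1 D p * wirtBar 1 D p = 1 / 4)
    (h0 : wirt 0 D p = 0) : ‖wirt 1 D p‖ = 1 / 2 := by
  have h := wirt_one_mul_wirtBar_one_of_wirt_zero_eq_zero hE h0
  rw [← conj_wirt_of_conj_eq hr, mul_conj, normSq_eq_norm_sq] at h
  have hsq : ‖wirt 1 D p‖ ^ 2 = (1 / 2) ^ 2 := by
    apply ofReal_injective
    rw [h]
    norm_num
  exact (sq_eq_sq₀ (norm_nonneg _) (by norm_num)).1 hsq

theorem eikonal_wirt_zero_of_wirt_zero_eq_zero (hD : ContDiff ℝ ∞ D) (hr : ∀ x, conj (D x) = D x)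
    (hE : ∀ᶠ x in 𝓝 p, wirt 0 D x * wirtBar 0 D x + wirt 1 D x * wirtBar 1 D x = 1 / 4)
    (h0 : wirt 0 D p = 0) :
    wirt 1 D p * wirt 0 (wirtBar 1 D) p + wirt 0 (wirt 1 D) p * wirtBar 1 D p = 0 := by
  have h0' : wirtBar 0 D p = 0 := by rw [← conj_wirt_of_conj_eq hr, h0, map_zero]
  simpa only [h0, h0', zero_mul, mul_zero, zero_add] using wirt_eikonal hD hE 0

theorem norm_wirt_wirt_one_of_wirt_zero_eq_zero (hD : ContDiff ℝ ∞ D)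
    (hr : ∀ x, conj (D x) = D x)
    (hE : ∀ᶠ x in 𝓝 p, wirt 0 D x * wirtBar 0 D x + wirt 1 D x * wirtBar 1 D x = 1 / 4)
    (h0 : wirt 0 D p = 0) : ‖wirt 0 (wirt 1 D) p‖ = ‖wirt 0 (wirtBar 1 D) p‖ := by
  have h := congrArg norm (eq_neg_of_add_eq_zero_left
    (eikonal_wirt_zero_of_wirt_zero_eq_zero hD hr hE h0))
  rw [norm_neg, norm_mul, norm_mul, ← conj_wirt_of_conj_eq hr, norm_conj,
    norm_wirt_one_of_wirt_zero_eq_zero hr hE.self_of_nhds h0] at h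
  linarith

theorem wirt_one_wirt_wirtBar_zero_of_flat (hD : ContDiff ℝ ∞ D) (hr : ∀ x, conj (D x) = D x)
    (hE : ∀ᶠ x in 𝓝 p, wirt 0 D x * wirtBar 0 D x + wirt 1 D x * wirtBar 1 D x = 1 / 4)
    (h0 : wirt 0 D p = 0) (h00 : wirt 0 (wirtBar 0 D) p = 0)
    (hμ : wirt 1 (leviDet D) p = -μ * wirt 1 D p) :
    wirt 1 (wirt 0 (wirtBar 0 D)) p = -4 * μ * wirt 1 D p := by
  have heik := eikonal_wirt_zero_of_wirt_zero_eq_zero hD hr hE h0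
  have hw := wirt_one_mul_wirtBar_one_of_wirt_zero_eq_zero hE.self_of_nhds h0
  have h0' : wirtBar 0 D p = 0 := by rw [← conj_wirt_of_conj_eq hr, h0, map_zero]
  rw [wirt_leviDet hD, h0, h0', h00, wirt_wirt_eq hD 1 0] at hμ
  linear_combination 4 * hμ + 4 * wirt 1 (wirtBar 0 D) p * heik
    - 4 * wirt 1 (wirt 0 (wirtBar 0 D)) p * hw

theorem two_mul_eq_norm_sq_add_of_flat (hD : ContDiff ℝ ∞ D) (hr : ∀ x, conj (D x) = D x)
    (hE : ∀ᶠ x in 𝓝 p, wirt 0 D x * wirtBar 0 D x + wirt 1 D x * wirtBar 1 D x = 1 / 4)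
    (h0 : wirt 0 D p = 0) (h00 : wirt 0 (wirtBar 0 D) p = 0)
    (hμ : wirt 1 (leviDet D) p = -μ * wirt 1 D p) :
    2 * μ = ‖wirt 0 (wirt 0 D) p‖ ^ 2 + 2 * ‖wirt 0 (wirtBar 1 D) p‖ ^ 2 := by
  have h0' : wirtBar 0 D p = 0 := by rw [← conj_wirt_of_conj_eq hr, h0, map_zero]
  have heik := wirt_wirtBar_eikonal hD hE h0 h0' h00
  have hw := wirt_one_mul_wirtBar_one_of_wirt_zero_eq_zero hE.self_of_nhds h0
  have hderiv := wirt_one_wirt_wirtBar_zero_of_flat hD hr hE h0 h00 hμ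
  have hderiv' : wirtBar 1 (wirt 0 (wirtBar 0 D)) p = -4 * μ * wirtBar 1 D p := by
    rw [← conj_wirt_of_conj_eq (fun x => conj_wirt_wirtBar_of_conj_eq
      (hD.contDiffAt.of_le ENat.LEInfty.out) hr 0 0), hderiv]
    simp only [map_mul, map_neg, map_ofNat, conj_ofReal, conj_wirt_of_conj_eq hr]
  rw [hderiv, hderiv', ← conj_wirt_wirt_of_conj_eq hr 0 0, ← conj_wirt_wirt_of_conj_eq hr 0 1,
    ← conj_wirt_wirtBar_of_conj_eq (hD.contDiffAt.of_le ENat.LEInfty.out) hr 0 1, mul_conj,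
    mul_conj, mul_comm (conj _), mul_conj, normSq_eq_norm_sq, normSq_eq_norm_sq,
    normSq_eq_norm_sq, norm_wirt_wirt_one_of_wirt_zero_eq_zero hD hr hE h0] at heik
  apply ofReal_injective
  push_cast at heik ⊢
  linear_combination -heik - 8 * μ * hw

theorem re_mul_wirt_wirtBar_one_of_rotation (hD : ContDiff ℝ ∞ D) (hr : ∀ x, conj (D x) = D x)
    (hE : ∀ᶠ x in 𝓝 p, wirt 0 D x * wirtBar 0 D x + wirt 1 D x * wirtBar 1 D x = 1 / 4)
    (hR : ∀ᶠ x in 𝓝 p, x 0 * wirt 0 D x = conj (x 0) * wirtBar 0 D x)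
    (h0 : wirt 0 D p = 0) :
    (p 0 * (wirt 1 D p * wirt 0 (wirtBar 1 D) p)).re = 0 := by
  have heik := eikonal_wirt_zero_of_wirt_zero_eq_zero hD hr hE h0
  have hrot := rotation_wirt_one hD hR
  have hsum : p 0 * (wirt 1 D p * wirt 0 (wirtBar 1 D) p)
      + conj (p 0 * (wirt 1 D p * wirt 0 (wirtBar 1 D) p)) = 0 := by
    rw [map_mul, map_mul, conj_wirt_of_conj_eq hr,
      conj_wirt_wirtBar_of_conj_eq (hD.contDiffAt.of_le ENat.LEInfty.out) hr]
    linear_combination p 0 * heik - wirtBar 1 D p * hrot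
  rw [add_conj] at hsum
  linarith [ofReal_eq_zero.1 hsum]

theorem coord_eq_zero_or_wirt_wirt_zero_eq_zero (hD : ContDiff ℝ ∞ D)
    (hR : ∀ᶠ x in 𝓝 p, x 0 * wirt 0 D x = conj (x 0) * wirtBar 0 D x)
    (h0 : wirt 0 D p = 0) (h00 : wirt 0 (wirtBar 0 D) p = 0) :
    p 0 = 0 ∨ wirt 0 (wirt 0 D) p = 0 := by
  have h := rotation_wirt_zero hD hR
  rw [h0, h00, zero_add, mul_zero] at h
  exact mul_eq_zero.1 h

theorem wirtBar_zero_mul_wirt_one_of_flat (hD : ContDiff ℝ ∞ D) (hr : ∀ x, conj (D x) = D x)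
    (hE : ∀ᶠ x in 𝓝 p, wirt 0 D x * wirtBar 0 D x + wirt 1 D x * wirtBar 1 D x = 1 / 4)
    (hR : ∀ᶠ x in 𝓝 p, x 0 * wirt 0 D x = conj (x 0) * wirtBar 0 D x)
    (h0 : wirt 0 D p = 0) (h00 : wirt 0 (wirtBar 0 D) p = 0)
    (hμ : wirt 1 (leviDet D) p = -μ * wirt 1 D p) :
    wirtBar 0 (fun x : C2 => x 0 * (wirt 0 (wirt 1 D) x * wirtBar 1 D x)) p = 0 := by
  have hdzw := differentiable_wirt 0 (contDiff_wirt 1 hD) p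
  have hdw := differentiable_wirtBar 1 hD p
  rw [wirtBar_mul 0 (differentiable_coord 0 p) (hdzw.fun_mul hdw), wirtBar_mul 0 hdzw hdw,
    wirtBar_coord, zero_mul, add_zero]
  rcases coord_eq_zero_or_wirt_wirt_zero_eq_zero hD hR h0 h00 with hz | hzz
  · rw [hz, zero_mul]
  have hw := wirt_one_mul_wirtBar_one_of_wirt_zero_eq_zero hE.self_of_nhds h0
  have hnormal := two_mul_eq_norm_sq_add_of_flat hD hr hE h0 h00 hμ
  have hprod : wirt 0 (wirt 1 D) p * wirtBar 0 (wirtBar 1 D) p = μ := by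
    rw [← conj_wirt_wirt_of_conj_eq hr, mul_conj, normSq_eq_norm_sq,
      norm_wirt_wirt_one_of_wirt_zero_eq_zero hD hr hE h0]
    rw [hzz, norm_zero] at hnormal
    congr 1
    linarith
  have hcomm : wirtBar 0 (wirt 0 (wirt 1 D)) p = wirt 1 (wirt 0 (wirtBar 0 D)) p := by
    rw [wirtBar_wirt_eq (contDiff_wirt 1 hD), wirtBar_wirt_eq hD,
      wirt_wirt_eq (contDiff_wirtBar 0 hD) 0 1]
  rw [hprod, hcomm, wirt_one_wirt_wirtBar_zero_of_flat hD hr hE h0 h00 hμ]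
  linear_combination -4 * μ * p 0 * hw

theorem wirt_zero_mul_wirt_one_of_flat (hD : ContDiff ℝ ∞ D) (hr : ∀ x, conj (D x) = D x)
    (hE : ∀ᶠ x in 𝓝 p, wirt 0 D x * wirtBar 0 D x + wirt 1 D x * wirtBar 1 D x = 1 / 4)
    (hR : ∀ᶠ x in 𝓝 p, x 0 * wirt 0 D x = conj (x 0) * wirtBar 0 D x)
    (h0 : wirt 0 D p = 0) (h00 : wirt 0 (wirtBar 0 D) p = 0)
    (hμ : wirt 1 (leviDet D) p = -μ * wirt 1 D p) :
    wirt 0 (fun x : C2 => x 0 * (wirt 0 (wirt 1 D) x * wirtBar 1 D x)) p = 0 := by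
  have hdzw := differentiable_wirt 0 (contDiff_wirt 1 hD) p
  have hdw := differentiable_wirtBar 1 hD p
  have hconj := conj_wirt_wirtBar_of_conj_eq (p := p)
    (hD.contDiffAt.of_le ENat.LEInfty.out) hr
  rw [wirt_mul 0 (differentiable_coord 0 p) (hdzw.fun_mul hdw), wirt_mul 0 hdzw hdw,
    wirt_coord, if_pos rfl, one_mul]
  rcases coord_eq_zero_or_wirt_wirt_zero_eq_zero hD hR h0 h00 with hz | hzz
  · have hmixed : wirt 0 (wirtBar 1 D) p = 0 := by
      rw [← hconj 1 0, rotation_mixed_eq_zero_of_coord hD hR hz, map_zero]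
    have heik := eikonal_wirt_zero_of_wirt_zero_eq_zero hD hr hE h0
    rw [hmixed, mul_zero, zero_add] at heik
    rw [heik, hz, zero_mul, add_zero]
  have hnormal := two_mul_eq_norm_sq_add_of_flat hD hr hE h0 h00 hμ
  have hprod : wirt 1 (wirtBar 0 D) p * wirt 0 (wirtBar 1 D) p = μ := by
    rw [← hconj 0 1, mul_comm, mul_conj, normSq_eq_norm_sq]
    rw [hzz, norm_zero] at hnormal
    congr 1
    linarith
  linear_combination wirtBar 1 D p * rotation_wirt_one_zero hD hR
    + wirt 0 (wirtBar 1 D) p * rotation_wirt_one hD hR + conj (p 0) * hprod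
    + conj (p 0) * wirtBar 1 D p * wirt_one_wirt_wirtBar_zero_of_flat hD hr hE h0 h00 hμ
    - 4 * μ * conj (p 0) * wirt_one_mul_wirtBar_one_of_wirt_zero_eq_zero hE.self_of_nhds h0

theorem fderiv_mul_wirt_one_of_flat (hD : ContDiff ℝ ∞ D) (hr : ∀ x, conj (D x) = D x)
    (hE : ∀ᶠ x in 𝓝 p, wirt 0 D x * wirtBar 0 D x + wirt 1 D x * wirtBar 1 D x = 1 / 4)
    (hR : ∀ᶠ x in 𝓝 p, x 0 * wirt 0 D x = conj (x 0) * wirtBar 0 D x)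
    (h0 : wirt 0 D p = 0) (h00 : wirt 0 (wirtBar 0 D) p = 0)
    (hμ : wirt 1 (leviDet D) p = -μ * wirt 1 D p) (c : ℂ) :
    fderiv ℝ (fun x : C2 => x 0 * (wirt 0 (wirt 1 D) x * wirtBar 1 D x)) p
      (EuclideanSpace.single 0 c) = 0 := by
  rw [fderiv_eq_wirt, wirt_zero_mul_wirt_one_of_flat hD hr hE hR h0 h00 hμ,
    wirtBar_zero_mul_wirt_one_of_flat hD hr hE hR h0 h00 hμ]
  simp

end FlatPoints

section CriticalSet

variable {Ω : Set C2} {d : C2 → ℝ} {p : C2}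

theorem IsBoundaryDistance.eventuallyEq_signedBdryDistC (hd : IsBoundaryDistance Ω d)
    (hp : p ∈ frontier Ω) : (fun x => (d x : ℂ)) =ᶠ[𝓝 p] signedBdryDistC Ω :=
  ofReal_comp_eventuallyEq (hd.eq_dist p hp)

theorem IsBoundaryDistance.wirt_signedBdryDistC (hd : IsBoundaryDistance Ω d)
    (hp : p ∈ frontier Ω) (j : Fin 2) :
    wirt j (signedBdryDistC Ω) p = wirt j (fun x => (d x : ℂ)) p :=
  (wirt_congr_nhds (hd.eventuallyEq_signedBdryDistC hp)).symm

theorem IsBoundaryDistance.wirt_wirtBar_signedBdryDistC (hd : IsBoundaryDistance Ω d)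
    (hp : p ∈ frontier Ω) (j k : Fin 2) :
    wirt j (wirtBar k (signedBdryDistC Ω)) p = wirt j (wirtBar k (fun x => (d x : ℂ))) p :=
  (wirt_congr_nhds (wirtBar_eventuallyEq (hd.eventuallyEq_signedBdryDistC hp))).symm

theorem IsBoundaryDistance.mem_criticalSet_iff (hd : IsBoundaryDistance Ω d)
    (hp : p ∈ frontier Ω) : p ∈ criticalSet Ω ↔ wirt 0 (fun x => (d x : ℂ)) p = 0 ∧
      wirt 0 (wirtBar 0 (fun x => (d x : ℂ))) p = 0 := by
  rw [← hd.wirt_signedBdryDistC hp, ← hd.wirt_wirtBar_signedBdryDistC hp]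
  exact and_iff_right hp

theorem leviFn_of_wirt_zero_eq_zero (h0 : wirt 0 (fun x => (d x : ℂ)) p = 0)
    (hw : wirt 1 (fun x => (d x : ℂ)) p * wirtBar 1 (fun x => (d x : ℂ)) p = 1 / 4) :
    leviFn d p = (1 / 4) * (wirt 0 (wirtBar 0 (fun x => (d x : ℂ))) p).re := by
  have h0' : wirtBar 0 (fun x => (d x : ℂ)) p = 0 := by rw [← conj_wirt_ofReal, h0, map_zero]
  rw [leviFn, complexHessian_eq_re_leviForm, leviForm_tangentVec_eq, leviDet, h0, h0', hw,
    show (1 / 4 : ℂ) = ((1 / 4 : ℝ) : ℂ) by norm_num]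
  simp only [mul_zero, zero_mul, sub_zero, re_mul_ofReal]
  ring

theorem IsBoundaryDistance.leviFn_of_wirt_zero_eq_zero (hd : IsBoundaryDistance Ω d)
    (hp : p ∈ frontier Ω) (h0 : wirt 0 (fun x => (d x : ℂ)) p = 0) :
    leviFn d p = (1 / 4) * (wirt 0 (wirtBar 0 (fun x => (d x : ℂ))) p).re :=
  _root_.leviFn_of_wirt_zero_eq_zero h0
    (wirt_one_mul_wirtBar_one_of_wirt_zero_eq_zero (hd.eikonal hp).self_of_nhds h0)

theorem IsBoundaryDistance.leviFn_eq_zero_of_mem_criticalSet (hd : IsBoundaryDistance Ω d)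
    (hp : p ∈ criticalSet Ω) : leviFn d p = 0 := by
  obtain ⟨h0, h00⟩ := (hd.mem_criticalSet_iff hp.1).1 hp
  rw [hd.leviFn_of_wirt_zero_eq_zero hp.1 h0, h00, zero_re, mul_zero]

theorem IsBoundaryDistance.weakSet₁_eq_criticalSet (hd : IsBoundaryDistance Ω d)
    (hpsc : IsLeviPseudoconvex Ω) : weakSet₁ Ω = criticalSet Ω := by
  ext p
  refine ⟨fun ⟨hweak, h0⟩ => ?_, fun hp => ⟨(hd.mem_weaklyPseudoconvexPoints_iff hpsc hp.1).2
    (hd.leviFn_eq_zero_of_mem_criticalSet hp), hp.2.1⟩⟩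
  have hp := hweak.1
  rw [hd.wirt_signedBdryDistC hp] at h0
  rw [hd.mem_weaklyPseudoconvexPoints_iff hpsc hp, hd.leviFn_of_wirt_zero_eq_zero hp h0] at hweak
  have hre : (wirt 0 (wirtBar 0 (fun x => (d x : ℂ))) p).re = 0 := by linarith
  have hreal := conj_eq_iff_re.1 (conj_wirt_wirtBar_of_conj_eq
    ((contDiff_ofReal_comp hd.defining.1).contDiffAt.of_le ENat.LEInfty.out)
    (fun _ => conj_ofReal _) 0 0 (p := p))
  exact (hd.mem_criticalSet_iff hp).2 ⟨h0, by rw [← hreal, hre, ofReal_zero]⟩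

theorem IsBoundaryDistance.exists_fderiv_leviFn_eq_of_mem_criticalSet
    (hd : IsBoundaryDistance Ω d) (hpsc : IsLeviPseudoconvex Ω) (hp : p ∈ criticalSet Ω) :
    ∃ μ : ℝ, fderiv ℝ (leviFn d) p = -μ • fderiv ℝ d p :=
  hd.exists_fderiv_leviFn_eq hpsc hp.1 (hd.leviFn_eq_zero_of_mem_criticalSet hp)

theorem IsBoundaryDistance.exists_fderiv_leviFn_eq_and_norm_sq_le (hd : IsBoundaryDistance Ω d)
    (hpsc : IsLeviPseudoconvex Ω) (hp : p ∈ criticalSet Ω) :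
    ∃ μ : ℝ, fderiv ℝ (leviFn d) p = -μ • fderiv ℝ d p ∧
      ‖wirt 0 (wirtBar 1 (fun x => (d x : ℂ))) p‖ ^ 2 ≤ μ := by
  obtain ⟨h0, h00⟩ := (hd.mem_criticalSet_iff hp.1).1 hp
  obtain ⟨μ, hμ⟩ := hd.exists_fderiv_leviFn_eq_of_mem_criticalSet hpsc hp
  have hnormal := two_mul_eq_norm_sq_add_of_flat (contDiff_ofReal_comp hd.defining.1)
    (fun _ => conj_ofReal _) (hd.eikonal hp.1) h0 h00 (wirt_leviDet_of_fderiv hd.defining.1 hμ 1)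
  exact ⟨μ, hμ, by linarith [sq_nonneg ‖wirt 0 (wirt 0 (fun x => (d x : ℂ))) p‖]⟩

theorem IsBoundaryDistance.fderiv_mul_wirt_one_of_mem_criticalSet (hd : IsBoundaryDistance Ω d)
    (hpsc : IsLeviPseudoconvex Ω) (hH : IsHartogs Ω) (hp : p ∈ criticalSet Ω) (c : ℂ) :
    fderiv ℝ (fun x : C2 => x 0 * (wirt 0 (wirt 1 fun x => (d x : ℂ)) x
      * wirtBar 1 (fun x => (d x : ℂ)) x)) p (EuclideanSpace.single 0 c) = 0 := by
  obtain ⟨h0, h00⟩ := (hd.mem_criticalSet_iff hp.1).1 hp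
  obtain ⟨μ, hμ⟩ := hd.exists_fderiv_leviFn_eq_of_mem_criticalSet hpsc hp
  exact fderiv_mul_wirt_one_of_flat (contDiff_ofReal_comp hd.defining.1)
    (fun _ => conj_ofReal _) (hd.eikonal hp.1) (hd.rotation hH hp.1) h0 h00
    (wirt_leviDet_of_fderiv hd.defining.1 hμ 1) c

theorem hasDerivAt_ray (a b : ℂ) (s : ℝ) :
    HasDerivAt (fun s : ℝ => (!₂[(s : ℂ) * a, b] : C2)) (EuclideanSpace.single 0 a) s := by
  have hline : HasDerivAt (fun s : ℝ => s • (EuclideanSpace.single 0 a : C2)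
      + EuclideanSpace.single 1 b) (EuclideanSpace.single 0 a) s := by
    simpa using ((hasDerivAt_id s).smul_const (EuclideanSpace.single 0 a : C2)).add_const
      (EuclideanSpace.single 1 b : C2)
  refine hline.congr_of_eventuallyEq (.of_forall fun s => ?_)
  exact PiLp.ext (Fin.forall_fin_two.2 ⟨by simp, by simp⟩)

theorem IsBoundaryDistance.mul_wirt_one_eq_zero_of_ray (hd : IsBoundaryDistance Ω d)
    (hpsc : IsLeviPseudoconvex Ω) (hH : IsHartogs Ω)
    (hray : ∀ s : ℝ, 0 ≤ s → s ≤ 1 → (!₂[(s : ℂ) * p 0, p 1] : C2) ∈ criticalSet Ω) :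
    p 0 * (wirt 0 (wirt 1 fun x => (d x : ℂ)) p * wirtBar 1 (fun x => (d x : ℂ)) p) = 0 := by
  set F : C2 → ℂ := fun x => x 0 * (wirt 0 (wirt 1 fun x => (d x : ℂ)) x
    * wirtBar 1 (fun x => (d x : ℂ)) x) with hF
  have hD : ContDiff ℝ ∞ fun x => (d x : ℂ) := contDiff_ofReal_comp hd.defining.1
  have hFdiff : Differentiable ℝ F := (differentiable_coord 0).fun_mul
    ((differentiable_wirt 0 (contDiff_wirt 1 hD)).fun_mul (differentiable_wirtBar 1 hD))
  have hderiv : ∀ s ∈ Icc (0 : ℝ) 1,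
      HasDerivAt (fun s : ℝ => F !₂[(s : ℂ) * p 0, p 1]) 0 s := fun s hs =>
    ((hFdiff _).hasFDerivAt.comp_hasDerivAt s (hasDerivAt_ray (p 0) (p 1) s)).congr_deriv
      (hd.fderiv_mul_wirt_one_of_mem_criticalSet hpsc hH (hray s hs.1 hs.2) (p 0))
  have hconst := constant_of_has_deriv_right_zero
    (fun s hs => (hderiv s hs).continuousAt.continuousWithinAt)
    (fun s hs => (hderiv s ⟨hs.1, hs.2.le⟩).hasDerivWithinAt) 1 (right_mem_Icc.2 zero_le_one)
  have hend : (!₂[((1 : ℝ) : ℂ) * p 0, p 1] : C2) = p :=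
    PiLp.ext (Fin.forall_fin_two.2 ⟨by simp, by simp⟩)
  rw [hend] at hconst
  exact hconst.trans (by simp [hF])

-- `z D_{zw} D_{w̄}` is constant along the ray and vanishes at its centre.
theorem IsBoundaryDistance.wirt_wirtBar_one_eq_zero_of_ray (hd : IsBoundaryDistance Ω d)
    (hpsc : IsLeviPseudoconvex Ω) (hH : IsHartogs Ω) (hp : p ∈ criticalSet Ω)
    (hray : ∀ s : ℝ, 0 ≤ s → s ≤ 1 → (!₂[(s : ℂ) * p 0, p 1] : C2) ∈ criticalSet Ω) :
    wirt 0 (wirtBar 1 (fun x => (d x : ℂ))) p = 0 := by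
  have hD : ContDiff ℝ ∞ fun x => (d x : ℂ) := contDiff_ofReal_comp hd.defining.1
  have hr : ∀ x, conj (d x : ℂ) = d x := fun _ => conj_ofReal _
  have hE := hd.eikonal hp.1
  have h0 := ((hd.mem_criticalSet_iff hp.1).1 hp).1
  rcases mul_eq_zero.1 (hd.mul_wirt_one_eq_zero_of_ray hpsc hH hray) with hz | hprod
  · rw [← conj_wirt_wirtBar_of_conj_eq (hD.contDiffAt.of_le ENat.LEInfty.out) hr 1 0,
      rotation_mixed_eq_zero_of_coord hD (hd.rotation hH hp.1) hz, map_zero]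
  · have heik := eikonal_wirt_zero_of_wirt_zero_eq_zero hD hr hE h0
    rw [hprod, add_zero] at heik
    refine (mul_eq_zero.1 heik).resolve_left (norm_ne_zero_iff.1 ?_)
    rw [norm_wirt_one_of_wirt_zero_eq_zero hr hE.self_of_nhds h0]
    norm_num

end CriticalSet

section NormSq

variable {p : C2}

theorem ofReal_norm_coord_sq (i : Fin 2) :
    (fun x : C2 => ((‖x i‖ ^ 2 : ℝ) : ℂ)) = fun x => x i * conj (x i) :=
  funext fun x => by rw [mul_conj, normSq_eq_norm_sq]

theorem contDiff_norm_coord_sq (i : Fin 2) : ContDiff ℝ ∞ fun x : C2 => ‖x i‖ ^ 2 :=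
  (contDiff_coord i).norm_sq ℝ

theorem wirt_norm_coord_sq (i j : Fin 2) (p : C2) :
    wirt j (fun x : C2 => ((‖x i‖ ^ 2 : ℝ) : ℂ)) p = if i = j then conj (p i) else 0 := by
  rw [ofReal_norm_coord_sq, wirt_mul j (differentiable_coord i p) (differentiable_conj_coord i p),
    wirt_coord, wirt_conj_coord]
  split_ifs <;> simp

theorem wirtBar_norm_coord_sq (i j : Fin 2) (p : C2) :
    wirtBar j (fun x : C2 => ((‖x i‖ ^ 2 : ℝ) : ℂ)) p = if i = j then p i else 0 := by
  rw [← conj_wirt_ofReal, wirt_norm_coord_sq]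
  split_ifs <;> simp

theorem wirt_wirtBar_norm_coord_sq (i j k : Fin 2) (p : C2) :
    wirt j (wirtBar k fun x : C2 => ((‖x i‖ ^ 2 : ℝ) : ℂ)) p = if i = j ∧ i = k then 1 else 0 := by
  rw [funext (wirtBar_norm_coord_sq i k)]
  by_cases hik : i = k
  · simp [hik, wirt_coord]
  · simp [hik, wirt_const]

theorem holDeriv_norm_coord_sq (i : Fin 2) (p t : C2) :
    holDeriv (fun x : C2 => ‖x i‖ ^ 2) p t = t i * conj (p i) := by
  simp only [holDeriv, wirt_norm_coord_sq]
  simp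

theorem complexHessian_norm_coord_sq (i : Fin 2) (p t : C2) :
    complexHessian (fun x : C2 => ‖x i‖ ^ 2) p t = ‖t i‖ ^ 2 := by
  have hsum : ∑ j : Fin 2, ∑ k : Fin 2,
      wirt j (wirtBar k fun x : C2 => ((‖x i‖ ^ 2 : ℝ) : ℂ)) p * t j * conj (t k)
        = t i * conj (t i) := by
    simp only [wirt_wirtBar_norm_coord_sq]
    fin_cases i <;> simp
  rw [complexHessian, hsum, mul_conj, normSq_eq_norm_sq, ofReal_re]

theorem norm_sq_eq_add (x : C2) : ‖x‖ ^ 2 = ‖x 0‖ ^ 2 + ‖x 1‖ ^ 2 := by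
  rw [EuclideanSpace.norm_sq_eq, Fin.sum_univ_two]

theorem holDeriv_norm_sq (p t : C2) : holDeriv (fun x : C2 => ‖x‖ ^ 2) p t = inner ℂ p t := by
  have hdiff (i : Fin 2) : DifferentiableAt ℝ (fun x : C2 => ‖x i‖ ^ 2) p :=
    (contDiff_norm_coord_sq i).differentiable (by simp) p
  rw [funext norm_sq_eq_add, holDeriv_add (hdiff 0) (hdiff 1), holDeriv_norm_coord_sq,
    holDeriv_norm_coord_sq, PiLp.inner_apply, Fin.sum_univ_two]
  rfl

theorem complexHessian_norm_sq (p t : C2) :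
    complexHessian (fun x : C2 => ‖x‖ ^ 2) p t = ‖t‖ ^ 2 := by
  have hdiff (i : Fin 2) : ContDiffAt ℝ 2 (fun x : C2 => ‖x i‖ ^ 2) p :=
    (contDiff_norm_coord_sq i).contDiffAt.of_le ENat.LEInfty.out
  rw [funext norm_sq_eq_add, complexHessian_eq_re_leviForm, leviForm_add (hdiff 0) (hdiff 1),
    add_re, ← complexHessian_eq_re_leviForm, ← complexHessian_eq_re_leviForm,
    complexHessian_norm_coord_sq, complexHessian_norm_coord_sq, norm_sq_eq_add]

theorem holDeriv_sub_norm_sq {ψ : C2 → ℝ} (hψ : DifferentiableAt ℝ ψ p) (ε : ℝ) (t : C2) :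
    holDeriv (fun x => ψ x - ε * ‖x‖ ^ 2) p t = holDeriv ψ p t - ε * inner ℂ p t := by
  have hN : DifferentiableAt ℝ (fun x : C2 => ‖x‖ ^ 2) p := differentiableAt_id.norm_sq ℝ
  simp only [sub_eq_add_neg, ← neg_mul]
  rw [holDeriv_add hψ (hN.const_mul (-ε)), holDeriv_comp (χ := fun y => -ε * y) (by fun_prop) hN,
    deriv_const_mul_id', holDeriv_norm_sq, ofReal_neg]

theorem complexHessian_sub_norm_sq {ψ : C2 → ℝ} (hψ : ContDiffAt ℝ 2 ψ p) (ε : ℝ) (t : C2) :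
    complexHessian (fun x => ψ x - ε * ‖x‖ ^ 2) p t = complexHessian ψ p t - ε * ‖t‖ ^ 2 := by
  have hN : ContDiffAt ℝ 2 (fun x : C2 => ‖x‖ ^ 2) p := contDiffAt_id.norm_sq ℝ
  have hderiv : deriv (fun y : ℝ => -ε * y) = fun _ => -ε := deriv_const_mul_id' _
  simp only [sub_eq_add_neg, ← neg_mul]
  rw [complexHessian_eq_re_leviForm, leviForm_add hψ (contDiffAt_const.mul hN), add_re,
    ← complexHessian_eq_re_leviForm, ← complexHessian_eq_re_leviForm,
    complexHessian_comp (χ := fun y => -ε * y) (by fun_prop) hN, hderiv, complexHessian_norm_sq,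
    deriv_const]
  ring

end NormSq

section Weights

variable {Ω : Set C2} {d ψ φ : C2 → ℝ} {p : C2} {τ : ℝ}

/-- Admissibility of a weight `ψ` at a weakly pseudoconvex point `p`: the pointwise inequality
between the entries of the complex Hessian of `-(-d exp ψ) ^ τ`, in the limit at `p`, which makes
this function plurisubharmonic near `p`. The number `-μ` is the normal derivative of the Levi
function of `d`. -/
def IsAdmissibleWeight (d ψ : C2 → ℝ) (τ : ℝ) (p : C2) : Prop :=
  ∃ μ : ℝ, fderiv ℝ (leviFn d) p = -μ • fderiv ℝ d p ∧
    ‖leviForm d p (tangentVec d p) (∇ d p) + (τ / 2 : ℝ) * holDeriv ψ p (tangentVec d p)‖ ^ 2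
      < (1 - τ) / 4 *
        (μ - (complexHessian ψ p (tangentVec d p) + τ * ‖holDeriv ψ p (tangentVec d p)‖ ^ 2))

theorem IsAdmissibleWeight.congr_nhds (h : IsAdmissibleWeight d ψ τ p) (he : φ =ᶠ[𝓝 p] ψ) :
    IsAdmissibleWeight d φ τ p := by
  obtain ⟨μ, hμ, hlt⟩ := h
  exact ⟨μ, hμ, by rwa [holDeriv_congr_nhds he, complexHessian_congr_nhds he]⟩

theorem IsBoundaryDistance.eventually_complexHessian_neg_rpow_nonneg_of_isAdmissibleWeight
    (hd : IsBoundaryDistance Ω d) (hpsc : IsLeviPseudoconvex Ω) (hψ : ContDiff ℝ ∞ ψ)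
    (hτ0 : 0 ≤ τ) (hτ1 : τ < 1) (hp : p ∈ frontier Ω) (h : IsAdmissibleWeight d ψ τ p) :
    ∀ᶠ x in 𝓝 p, x ∈ Ω → ∀ t,
      0 ≤ complexHessian (fun y => -((-(d y * Real.exp (ψ y))) ^ τ)) x t := by
  obtain ⟨μ, hμ, hlt⟩ := h
  refine hd.eventually_complexHessian_neg_rpow_nonneg_of_weak hpsc hψ hτ0 hτ1 hp hμ ?_
  rwa [crossCoeff, hd.defining.eq_zero hp, ofReal_zero, zero_mul, add_zero, expLeviForm_self_re]

theorem leviForm_tangentVec_gradient_of_flat (hd : DifferentiableAt ℝ d p)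
    (h0 : wirt 0 (fun x => (d x : ℂ)) p = 0)
    (h00 : wirt 0 (wirtBar 0 (fun x => (d x : ℂ))) p = 0) :
    leviForm d p (tangentVec d p) (∇ d p) = wirt 1 (fun x => (d x : ℂ)) p *
      ((2 : ℝ) * (wirt 1 (fun x => (d x : ℂ)) p * wirt 0 (wirtBar 1 (fun x => (d x : ℂ))) p)) := by
  simp only [leviForm, tangentVec, gradient_eq_wirtBar hd, Fin.sum_univ_two]
  simp only [Matrix.cons_val_zero, Matrix.cons_val_one, h0, h00, neg_zero, zero_mul, mul_zero,
    add_zero, zero_add, map_mul, map_ofNat, conj_wirtBar_of_conj_eq fun x => conj_ofReal (d x)]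
  push_cast
  ring

theorem norm_sq_tangentVec
    (hE : wirt 0 (fun x => (d x : ℂ)) p * wirtBar 0 (fun x => (d x : ℂ)) p
      + wirt 1 (fun x => (d x : ℂ)) p * wirtBar 1 (fun x => (d x : ℂ)) p = 1 / 4) :
    ‖tangentVec d p‖ ^ 2 = 1 / 4 := by
  rw [← conj_wirt_ofReal, ← conj_wirt_ofReal, mul_conj, mul_conj, normSq_eq_norm_sq,
    normSq_eq_norm_sq] at hE
  simp only [norm_sq_eq_add, tangentVec, Matrix.cons_val_zero, Matrix.cons_val_one, norm_neg]
  apply ofReal_injective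
  push_cast at hE ⊢
  linear_combination hE

theorem norm_sub_smul_sq_lt {τ ε M : ℝ} {κ η : ℂ} (hε : 0 < ε) (hτ1 : τ < 1)
    (hη : 4 * (τ * ε * ‖η‖ ^ 2) < 1 - τ) (hM : ‖κ‖ ^ 2 ≤ M) :
    ‖-(κ / 2) + (τ / 2 : ℝ) * (κ - ε * η)‖ ^ 2
      < (1 - τ) / 4 * (M + ε / 4 - τ * ‖κ - ε * η‖ ^ 2) := by
  have hcomb : -(κ / 2) + (τ / 2 : ℝ) * (κ - ε * η)
      = -(((1 - τ) / 2 : ℝ) * κ + (τ * ε / 2 : ℝ) * η) := by push_cast; ring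
  have hcross : ‖((1 - τ) / 2 : ℝ) * κ + (τ * ε / 2 : ℝ) * η‖ ^ 2
      = (1 - τ) / 4 * (‖κ‖ ^ 2 - τ * ‖κ - ε * η‖ ^ 2) + τ * ε ^ 2 * ‖η‖ ^ 2 / 4 := by
    simp only [← normSq_eq_norm_sq, normSq_apply, add_re, add_im, sub_re, sub_im, mul_re, mul_im,
      ofReal_re, ofReal_im]
    ring
  rw [hcomb, norm_neg, hcross]
  nlinarith [mul_le_mul_of_nonneg_left hM (sub_nonneg.2 hτ1.le)]

-- Without the term `-ε ‖x‖²` both sides of the admissibility inequality could be equal.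
theorem IsBoundaryDistance.isAdmissibleWeight_sub_norm_sq (hd : IsBoundaryDistance Ω d)
    (hψ : ContDiffAt ℝ 2 ψ p) (hτ0 : 0 ≤ τ) (hτ1 : τ < 1) (hp : p ∈ frontier Ω) {ε μ : ℝ}
    (hε : 0 < ε) (hεp : τ * ε * ‖p‖ ^ 2 < 1 - τ) (hμ : fderiv ℝ (leviFn d) p = -μ • fderiv ℝ d p)
    (hcross : leviForm d p (tangentVec d p) (∇ d p) = -(holDeriv ψ p (tangentVec d p) / 2))
    (hle : complexHessian ψ p (tangentVec d p) + ‖holDeriv ψ p (tangentVec d p)‖ ^ 2 ≤ μ) :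
    IsAdmissibleWeight d (fun x => ψ x - ε * ‖x‖ ^ 2) τ p := by
  set L := tangentVec d p
  have hL : ‖L‖ ^ 2 = 1 / 4 := norm_sq_tangentVec (hd.eikonal hp).self_of_nhds
  have hη : 4 * (τ * ε * ‖(inner ℂ p L : ℂ)‖ ^ 2) < 1 - τ := by
    have hcs := pow_le_pow_left₀ (norm_nonneg _) (norm_inner_le_norm (𝕜 := ℂ) p L) 2
    rw [mul_pow, hL] at hcs
    nlinarith [mul_le_mul_of_nonneg_left hcs (mul_nonneg hτ0 hε.le)]
  refine ⟨μ, hμ, ?_⟩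
  rw [hcross, holDeriv_sub_norm_sq (hψ.differentiableAt (by norm_num)),
    complexHessian_sub_norm_sq hψ, hL]
  convert norm_sub_smul_sq_lt hε hτ1 hη (le_sub_iff_add_le'.2 hle) using 2
  ring

theorem IsBoundaryDistance.isAdmissibleWeight_neg_norm_sq (hd : IsBoundaryDistance Ω d)
    (hpsc : IsLeviPseudoconvex Ω) (hτ0 : 0 ≤ τ) (hτ1 : τ < 1) (hp : p ∈ criticalSet Ω)
    (hmixed : wirt 0 (wirtBar 1 (fun x => (d x : ℂ))) p = 0) {ε : ℝ} (hε : 0 < ε)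
    (hεp : τ * ε * ‖p‖ ^ 2 < 1 - τ) : IsAdmissibleWeight d (fun x => -(ε * ‖x‖ ^ 2)) τ p := by
  obtain ⟨h0, h00⟩ := (hd.mem_criticalSet_iff hp.1).1 hp
  obtain ⟨μ, hμ, hle⟩ := hd.exists_fderiv_leviFn_eq_and_norm_sq_le hpsc hp
  have hhol : holDeriv (fun _ => (0 : ℝ)) p (tangentVec d p) = 0 := by simp [holDeriv]
  have hhess : complexHessian (fun _ => (0 : ℝ)) p (tangentVec d p) = 0 := by
    simp [complexHessian, funext (wirtBar_const _ _)]
  have hadm := hd.isAdmissibleWeight_sub_norm_sq (ψ := fun _ => 0) contDiffAt_const hτ0 hτ1 hp.1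
    hε hεp hμ (by
      rw [leviForm_tangentVec_gradient_of_flat (hd.defining.1.differentiable (by simp) p) h0 h00,
        hmixed, hhol]
      simp)
    (by simpa [hhol, hhess] using (sq_nonneg _).trans hle)
  simpa only [zero_sub] using hadm

theorem IsBoundaryDistance.isAdmissibleWeight_radial (hd : IsBoundaryDistance Ω d)
    (hpsc : IsLeviPseudoconvex Ω) (hH : IsHartogs Ω) (hτ1 : τ < 1) (hp : p ∈ criticalSet Ω)
    {χ : ℝ → ℝ} (hχ : ContDiffAt ℝ 2 χ (‖p 0‖ ^ 2))
    (hlt : τ * (4 * ‖wirt 0 (wirtBar 1 (fun x => (d x : ℂ))) p‖ ^ 2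
        + deriv χ (‖p 0‖ ^ 2) ^ 2 * ‖p 0‖ ^ 2)
      < -(1 - τ) * (deriv χ (‖p 0‖ ^ 2) + deriv (deriv χ) (‖p 0‖ ^ 2) * ‖p 0‖ ^ 2)) :
    IsAdmissibleWeight d (fun x => χ (‖x 0‖ ^ 2)) τ p := by
  obtain ⟨h0, h00⟩ := (hd.mem_criticalSet_iff hp.1).1 hp
  have hD : ContDiff ℝ ∞ (fun x => (d x : ℂ)) := contDiff_ofReal_comp hd.defining.1
  have hr : ∀ x, conj (d x : ℂ) = d x := fun _ => conj_ofReal _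
  have hE := hd.eikonal hp.1
  have hN : ContDiffAt ℝ 2 (fun x : C2 => ‖x 0‖ ^ 2) p :=
    (contDiff_norm_coord_sq 0).contDiffAt.of_le ENat.LEInfty.out
  obtain ⟨μ, hμ, hle⟩ := hd.exists_fderiv_leviFn_eq_and_norm_sq_le hpsc hp
  have hrot := re_mul_wirt_wirtBar_one_of_rotation hD hr hE (hd.rotation hH hp.1) h0
  have ha := norm_wirt_one_of_wirt_zero_eq_zero hr hE.self_of_nhds h0
  have hL : tangentVec d p 0 = wirt 1 (fun x => (d x : ℂ)) p := by simp [tangentVec]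
  refine ⟨μ, hμ, ?_⟩
  rw [leviForm_tangentVec_gradient_of_flat (hd.defining.1.differentiable (by simp) p) h0 h00,
    holDeriv_comp (hχ.differentiableAt (by norm_num)) (hN.differentiableAt (by norm_num)),
    complexHessian_comp hχ hN, holDeriv_norm_coord_sq, complexHessian_norm_coord_sq, hL]
  generalize wirt 0 (wirtBar 1 (fun x => (d x : ℂ))) p = S at *
  generalize wirt 1 (fun x => (d x : ℂ)) p = a at *
  generalize deriv χ (‖p 0‖ ^ 2) = χ₁ at *
  generalize deriv (deriv χ) (‖p 0‖ ^ 2) = χ₂ at *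
  have hpyth : ‖a * ((2 : ℝ) * (a * S)) + (τ / 2 : ℝ) * (χ₁ * (a * conj (p 0)))‖ ^ 2
      = ‖a‖ ^ 2 * (4 * (‖a‖ ^ 2 * ‖S‖ ^ 2) + τ ^ 2 / 4 * (χ₁ ^ 2 * ‖p 0‖ ^ 2)
        + 2 * τ * χ₁ * (p 0 * (a * S)).re) := by
    simp only [← normSq_eq_norm_sq, normSq_apply, add_re, add_im, mul_re, mul_im, ofReal_re,
      ofReal_im, conj_re, conj_im]
    ring
  rw [hpyth, hrot, norm_mul, norm_mul, norm_mul, norm_real, norm_conj, mul_pow, mul_pow, mul_pow,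
    ha, Real.norm_eq_abs, sq_abs]
  nlinarith [mul_le_mul_of_nonneg_left hle (sub_nonneg.2 hτ1.le)]

/-- The radial weight `(1/k) log cos (2kC(log y - x₀))`, to be composed with `y = |z|²`. It solves
the extremal equation `deriv_add_deriv_deriv_radialWeight`. -/
noncomputable def radialWeight (k C x₀ y : ℝ) : ℝ :=
  (1 / k) * Real.log (Real.cos (2 * k * C * (Real.log y - x₀)))

theorem contDiffAt_radialWeight {k C x₀ y : ℝ} (hy : y ≠ 0)
    (hcos : 0 < Real.cos (2 * k * C * (Real.log y - x₀))) {n : WithTop ℕ∞} :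
    ContDiffAt ℝ n (radialWeight k C x₀) y := by
  have hangle : ContDiffAt ℝ n (fun y => 2 * k * C * (Real.log y - x₀)) y :=
    contDiffAt_const.mul ((contDiffAt_id.log hy).sub contDiffAt_const)
  exact contDiffAt_const.mul (hangle.cos.log hcos.ne')

theorem hasDerivAt_radialWeight {k C x₀ y : ℝ} (hk : k ≠ 0) (hy : y ≠ 0)
    (hcos : 0 < Real.cos (2 * k * C * (Real.log y - x₀))) :
    HasDerivAt (radialWeight k C x₀)
      (-(2 * C) * Real.tan (2 * k * C * (Real.log y - x₀)) / y) y := by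
  have hangle : HasDerivAt (fun y => 2 * k * C * (Real.log y - x₀)) (2 * k * C * y⁻¹) y :=
    ((Real.hasDerivAt_log hy).sub_const x₀).const_mul _
  refine ((hangle.cos.log hcos.ne').const_mul (1 / k)).congr_deriv ?_
  rw [Real.tan_eq_sin_div_cos]
  field_simp

theorem eventually_cos_log_pos {k C x₀ y : ℝ} (hy : y ≠ 0)
    (hcos : 0 < Real.cos (2 * k * C * (Real.log y - x₀))) :
    ∀ᶠ s in 𝓝 y, s ≠ 0 ∧ 0 < Real.cos (2 * k * C * (Real.log s - x₀)) := by
  have hcont : ContinuousAt (fun s => Real.cos (2 * k * C * (Real.log s - x₀))) y :=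
    Real.continuous_cos.continuousAt.comp (continuousAt_const.mul
      ((Real.continuousAt_log hy).sub continuousAt_const))
  exact (eventually_ne_nhds hy).and (hcont.eventually (lt_mem_nhds hcos))

-- With `u = log y` this is the Riccati equation `f'' = -k (4 C² + f' ²)`.
theorem deriv_add_deriv_deriv_radialWeight {k C x₀ y : ℝ} (hk : k ≠ 0) (hy : y ≠ 0)
    (hcos : 0 < Real.cos (2 * k * C * (Real.log y - x₀))) :
    deriv (radialWeight k C x₀) y + deriv (deriv (radialWeight k C x₀)) y * y
      = -(k * (4 * (C ^ 2 / y) + deriv (radialWeight k C x₀) y ^ 2 * y)) := by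
  have hderiv : deriv (radialWeight k C x₀) =ᶠ[𝓝 y]
      fun s => -(2 * C) * Real.tan (2 * k * C * (Real.log s - x₀)) / s :=
    (eventually_cos_log_pos hy hcos).mono fun s hs => (hasDerivAt_radialWeight hk hs.1 hs.2).deriv
  have hangle : HasDerivAt (fun s => 2 * k * C * (Real.log s - x₀)) (2 * k * C * y⁻¹) y :=
    ((Real.hasDerivAt_log hy).sub_const x₀).const_mul _
  have hderiv₂ := (((((Real.hasDerivAt_tan hcos.ne').comp y hangle).const_mul
    (-(2 * C))).fun_div (hasDerivAt_id y) hy).congr_of_eventuallyEq hderiv).deriv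
  have hsec : 1 / Real.cos (2 * k * C * (Real.log y - x₀)) ^ 2
      = 1 + Real.tan (2 * k * C * (Real.log y - x₀)) ^ 2 := by
    rw [← Real.inv_one_add_tan_sq hcos.ne', one_div, inv_inv]
  rw [hderiv₂, hderiv.self_of_nhds, hsec]
  simp only [Function.comp_apply, id]
  field_simp
  ring

theorem IsBoundaryDistance.isAdmissibleWeight_radialWeight (hd : IsBoundaryDistance Ω d)
    (hpsc : IsLeviPseudoconvex Ω) (hH : IsHartogs Ω) (hτ0 : 0 < τ) (hτ1 : τ < 1)
    (hp : p ∈ criticalSet Ω) {C x₀ : ℝ} (hz : p 0 ≠ 0)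
    (hC : ‖wirt 0 (wirtBar 1 (fun x => (d x : ℂ))) p‖ < C / ‖p 0‖)
    (hcos : 0 < Real.cos (2 * (τ / (1 - τ)) * C * (Real.log (‖p 0‖ ^ 2) - x₀))) :
    IsAdmissibleWeight d (fun x => radialWeight (τ / (1 - τ)) C x₀ (‖x 0‖ ^ 2)) τ p := by
  have hτ1' : 0 < 1 - τ := sub_pos.2 hτ1
  have hy : ‖p 0‖ ^ 2 ≠ 0 := pow_ne_zero 2 (norm_ne_zero_iff.2 hz)
  have hbound := pow_lt_pow_left₀ hC (norm_nonneg _) two_ne_zero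
  refine hd.isAdmissibleWeight_radial hpsc hH hτ1 hp (contDiffAt_radialWeight hy hcos) ?_
  rw [deriv_add_deriv_deriv_radialWeight (div_pos hτ0 hτ1').ne' hy hcos, neg_mul_neg, ← mul_assoc,
    mul_div_cancel₀ _ hτ1'.ne', ← div_pow]
  gcongr

end Weights

section Transversal

variable {Ω : Set C2} {d : C2 → ℝ} {p : C2}

theorem two_mul_leviForm_tangentVec_gradient_mul (hd : ContDiff ℝ ∞ d)
    (hE : wirt 0 (fun x => (d x : ℂ)) p * wirtBar 0 (fun x => (d x : ℂ)) p
      + wirt 1 (fun x => (d x : ℂ)) p * wirtBar 1 (fun x => (d x : ℂ)) p = 1 / 4)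
    (hl : leviFn d p = 0) :
    2 * leviForm d p (tangentVec d p) (∇ d p) * wirtBar 0 (fun x => (d x : ℂ)) p
      = wirt 1 (fun x => (d x : ℂ)) p * wirt 0 (wirtBar 0 (fun x => (d x : ℂ))) p
        - wirt 0 (fun x => (d x : ℂ)) p * wirt 1 (wirtBar 0 (fun x => (d x : ℂ))) p := by
  have hdet : leviDet (fun x => (d x : ℂ)) p = 0 := by
    simp only [← ofReal_leviFn hd, hl, ofReal_zero]
  rw [leviDet] at hdet
  simp only [leviForm, tangentVec, gradient_eq_wirtBar (hd.differentiable (by simp) p),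
    Fin.sum_univ_two, Matrix.cons_val_zero, Matrix.cons_val_one, map_mul, map_ofNat,
    conj_wirtBar_of_conj_eq fun x => conj_ofReal (d x)]
  linear_combination 4 * (wirt 1 (fun x => (d x : ℂ)) p * wirt 0 (wirtBar 0 (fun x => (d x : ℂ))) p
    - wirt 0 (fun x => (d x : ℂ)) p * wirt 1 (wirtBar 0 (fun x => (d x : ℂ))) p) * hE
    - 4 * wirt 1 (fun x => (d x : ℂ)) p * hdet

theorem norm_sq_leviForm_tangentVec_gradient (hd : ContDiff ℝ ∞ d)
    (hE : wirt 0 (fun x => (d x : ℂ)) p * wirtBar 0 (fun x => (d x : ℂ)) p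
      + wirt 1 (fun x => (d x : ℂ)) p * wirtBar 1 (fun x => (d x : ℂ)) p = 1 / 4)
    (hl : leviFn d p = 0) (h0 : wirt 0 (fun x => (d x : ℂ)) p ≠ 0) :
    ((‖2 * leviForm d p (tangentVec d p) (∇ d p)‖ ^ 2 : ℝ) : ℂ)
      = wirt 1 (wirtBar 0 (fun x => (d x : ℂ))) p * wirt 0 (wirtBar 1 (fun x => (d x : ℂ))) p
        - wirt 0 (wirtBar 0 (fun x => (d x : ℂ))) p
          * wirt 1 (wirtBar 1 (fun x => (d x : ℂ))) p := by
  have hr : ∀ x, conj (d x : ℂ) = d x := fun _ => conj_ofReal _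
  have hD : ContDiffAt ℝ 2 (fun x => (d x : ℂ)) p :=
    (contDiff_ofReal_comp hd).contDiffAt.of_le ENat.LEInfty.out
  have hb : wirtBar 0 (fun x => (d x : ℂ)) p ≠ 0 := by
    rw [← conj_wirt_ofReal]
    exact (map_ne_zero _).2 h0
  have hdet : leviDet (fun x => (d x : ℂ)) p = 0 := by
    simp only [← ofReal_leviFn hd, hl, ofReal_zero]
  rw [leviDet] at hdet
  have hκ := two_mul_leviForm_tangentVec_gradient_mul hd hE hl
  generalize 2 * leviForm d p (tangentVec d p) (∇ d p) = κ at *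
  have hκ' := congrArg conj hκ
  simp only [map_mul, map_sub, conj_wirt_of_conj_eq hr, conj_wirtBar_of_conj_eq hr,
    conj_wirt_wirtBar_of_conj_eq hD hr] at hκ'
  rw [← normSq_eq_norm_sq, ← mul_conj]
  apply mul_left_cancel₀ (mul_ne_zero h0 hb)
  linear_combination (conj κ * wirt 0 (fun x => (d x : ℂ)) p) * hκ
    + (wirt 1 (fun x => (d x : ℂ)) p * wirt 0 (wirtBar 0 (fun x => (d x : ℂ))) p
      - wirt 0 (fun x => (d x : ℂ)) p * wirt 1 (wirtBar 0 (fun x => (d x : ℂ))) p) * hκ'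
    + wirt 0 (wirtBar 0 (fun x => (d x : ℂ))) p * hdet

-- Eliminates `∂²D/∂z²` and `∂²D/∂z∂w`, which are not entries of the complex Hessian, from the
-- normal derivative of the Levi determinant.
theorem neg_mul_mul_wirt_zero_eq {D : C2 → ℂ} (hD : ContDiff ℝ ∞ D)
    (hR : ∀ᶠ x in 𝓝 p, x 0 * wirt 0 D x = conj (x 0) * wirtBar 0 D x)
    (hdet : leviDet D p = 0) {μ : ℂ} (hμ : wirt 0 (leviDet D) p = -μ * wirt 0 D p) :
    -μ * (p 0 * wirt 0 D p) =
      (p 0 * (wirt 0 (wirt 0 (wirtBar 0 D)) p * (wirt 1 D p * wirtBar 1 D p)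
        - wirt 0 (wirt 0 (wirtBar 1 D)) p * (wirt 1 D p * wirtBar 0 D p)
        - wirt 0 (wirt 1 (wirtBar 0 D)) p * (wirt 0 D p * wirtBar 1 D p)
        + wirt 0 (wirt 1 (wirtBar 1 D)) p * (wirt 0 D p * wirtBar 0 D p))
      + wirt 1 D p * (wirt 0 (wirtBar 0 D) p * wirtBar 1 D p
        - wirt 0 (wirtBar 1 D) p * wirtBar 0 D p))
      + 2 * (p 0 * wirt 0 D p) * (wirt 0 (wirtBar 0 D) p * wirt 1 (wirtBar 1 D) p
        - wirt 1 (wirtBar 0 D) p * wirt 0 (wirtBar 1 D) p) := by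
  have h1 := rotation_wirt_one hD hR
  have h0 := rotation_wirt_zero hD hR
  have h := hR.self_of_nhds
  rw [wirt_leviDet hD] at hμ
  rw [leviDet] at hdet
  linear_combination -(p 0) * hμ
    + (wirt 0 (wirtBar 0 D) p * wirtBar 1 D p - wirt 0 (wirtBar 1 D) p * wirtBar 0 D p) * h1
    + (wirt 1 (wirtBar 1 D) p * wirtBar 0 D p - wirt 1 (wirtBar 0 D) p * wirtBar 1 D p) * h0 - hdet
    + (wirt 0 (wirtBar 1 D) p * wirt 1 (wirtBar 0 D) p
      - wirt 1 (wirtBar 1 D) p * wirt 0 (wirtBar 0 D) p) * h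

/-- The real part of `z ∂d/∂z`, half the radial derivative of `d` in the first coordinate. For a
rotation invariant `d` the function `z ∂d/∂z` is itself real. -/
noncomputable def radialDeriv (d : C2 → ℝ) (x : C2) : ℝ := (x 0 * wirt 0 (fun y => (d y : ℂ)) x).re

theorem contDiff_radialDeriv (hd : ContDiff ℝ ∞ d) : ContDiff ℝ ∞ (radialDeriv d) :=
  reCLM.contDiff.comp ((contDiff_coord 0).mul (contDiff_wirt 0 (contDiff_ofReal_comp hd)))

theorem ofReal_radialDeriv
    (h : p 0 * wirt 0 (fun y => (d y : ℂ)) p = conj (p 0) * wirtBar 0 (fun y => (d y : ℂ)) p) :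
    (radialDeriv d p : ℂ) = p 0 * wirt 0 (fun y => (d y : ℂ)) p := by
  refine conj_eq_iff_re.1 ?_
  rw [map_mul, conj_wirt_ofReal, h]

theorem radialDeriv_ne_zero (hd : ContDiff ℝ ∞ d)
    (hR : ∀ᶠ x in 𝓝 p,
      x 0 * wirt 0 (fun y => (d y : ℂ)) x = conj (x 0) * wirtBar 0 (fun y => (d y : ℂ)) x)
    (h0 : wirt 0 (fun x => (d x : ℂ)) p ≠ 0) : radialDeriv d p ≠ 0 := by
  have hz : p 0 ≠ 0 := by
    intro hz
    have hb := wirtBar_zero_eq_zero_of_coord (contDiff_ofReal_comp hd) hR hz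
    rw [← conj_wirt_ofReal] at hb
    exact h0 ((map_eq_zero _).1 hb)
  rw [← ofReal_ne_zero, ofReal_radialDeriv hR.self_of_nhds]
  exact mul_ne_zero hz h0

theorem wirt_radialDeriv (hd : ContDiff ℝ ∞ d)
    (hR : ∀ᶠ x in 𝓝 p,
      x 0 * wirt 0 (fun y => (d y : ℂ)) x = conj (x 0) * wirtBar 0 (fun y => (d y : ℂ)) x)
    (j : Fin 2) :
    wirt j (fun x => (radialDeriv d x : ℂ)) p
      = conj (p 0) * wirt j (wirtBar 0 (fun y => (d y : ℂ))) p := by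
  rw [wirt_congr_nhds (hR.mono fun x hx => (ofReal_radialDeriv hx).trans hx),
    wirt_mul j (differentiable_conj_coord 0 p)
      (differentiable_wirtBar 0 (contDiff_ofReal_comp hd) p), wirt_conj_coord, zero_mul, add_zero]

theorem wirt_wirtBar_radialDeriv (hd : ContDiff ℝ ∞ d)
    (hR : ∀ᶠ x in 𝓝 p,
      x 0 * wirt 0 (fun y => (d y : ℂ)) x = conj (x 0) * wirtBar 0 (fun y => (d y : ℂ)) x)
    (j k : Fin 2) :
    wirt j (wirtBar k (fun x => (radialDeriv d x : ℂ))) p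
      = (if 0 = j then 1 else 0) * wirt 0 (wirtBar k (fun y => (d y : ℂ))) p
        + p 0 * wirt j (wirt 0 (wirtBar k (fun y => (d y : ℂ)))) p := by
  have hD := contDiff_ofReal_comp hd
  have hbar : wirtBar k (fun x : C2 => x 0 * wirt 0 (fun y => (d y : ℂ)) x)
      = fun x => x 0 * wirt 0 (wirtBar k (fun y => (d y : ℂ))) x := by
    funext x
    rw [wirtBar_mul k (differentiable_coord 0 x) (differentiable_wirt 0 hD x), wirtBar_coord,
      zero_mul, add_zero, wirtBar_wirt_eq hD]
  rw [wirt_congr_nhds (wirtBar_eventuallyEq (hR.mono fun x hx => ofReal_radialDeriv hx)), hbar,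
    wirt_mul j (differentiable_coord 0 p) (differentiable_wirt 0 (contDiff_wirtBar k hD) p),
    wirt_coord, add_comm]

theorem holDeriv_radialDeriv (hd : ContDiff ℝ ∞ d)
    (hE : wirt 0 (fun x => (d x : ℂ)) p * wirtBar 0 (fun x => (d x : ℂ)) p
      + wirt 1 (fun x => (d x : ℂ)) p * wirtBar 1 (fun x => (d x : ℂ)) p = 1 / 4)
    (hR : ∀ᶠ x in 𝓝 p,
      x 0 * wirt 0 (fun y => (d y : ℂ)) x = conj (x 0) * wirtBar 0 (fun y => (d y : ℂ)) x)
    (hl : leviFn d p = 0) :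
    holDeriv (radialDeriv d) p (tangentVec d p)
      = radialDeriv d p * (2 * leviForm d p (tangentVec d p) (∇ d p)) := by
  have hκ := two_mul_leviForm_tangentVec_gradient_mul hd hE hl
  have hφ := (ofReal_radialDeriv hR.self_of_nhds).trans hR.self_of_nhds
  simp only [holDeriv, tangentVec, Fin.sum_univ_two, Matrix.cons_val_zero, Matrix.cons_val_one,
    wirt_radialDeriv hd hR]
  rw [tangentVec] at hκ
  linear_combination -conj (p 0) * hκ - 2 * leviForm d p _ (∇ d p) * hφ

theorem complexHessian_radialDeriv (hd : ContDiff ℝ ∞ d)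
    (hE : wirt 0 (fun x => (d x : ℂ)) p * wirtBar 0 (fun x => (d x : ℂ)) p
      + wirt 1 (fun x => (d x : ℂ)) p * wirtBar 1 (fun x => (d x : ℂ)) p = 1 / 4)
    (hR : ∀ᶠ x in 𝓝 p,
      x 0 * wirt 0 (fun y => (d y : ℂ)) x = conj (x 0) * wirtBar 0 (fun y => (d y : ℂ)) x)
    (hl : leviFn d p = 0) (h0 : wirt 0 (fun x => (d x : ℂ)) p ≠ 0) {μ : ℝ}
    (hμ : fderiv ℝ (leviFn d) p = -μ • fderiv ℝ d p) :
    complexHessian (radialDeriv d) p (tangentVec d p)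
      = radialDeriv d p * (2 * ‖2 * leviForm d p (tangentVec d p) (∇ d p)‖ ^ 2 - μ) := by
  have hD := contDiff_ofReal_comp hd
  have hdet : leviDet (fun x => (d x : ℂ)) p = 0 := by
    simp only [← ofReal_leviFn hd, hl, ofReal_zero]
  have hnormal := neg_mul_mul_wirt_zero_eq hD hR hdet (wirt_leviDet_of_fderiv hd hμ 0)
  have hnorm := norm_sq_leviForm_tangentVec_gradient hd hE hl h0
  have hφ := ofReal_radialDeriv hR.self_of_nhds
  have hlevi : leviForm (radialDeriv d) p (tangentVec d p) (tangentVec d p)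
      = ((radialDeriv d p
        * (2 * ‖2 * leviForm d p (tangentVec d p) (∇ d p)‖ ^ 2 - μ) : ℝ) : ℂ) := by
    rw [ofReal_mul, ofReal_sub, ofReal_mul, hnorm, hφ, leviForm]
    simp only [tangentVec, Fin.sum_univ_two, Matrix.cons_val_zero, Matrix.cons_val_one,
      wirt_wirtBar_radialDeriv hd hR, map_neg, conj_wirt_ofReal, if_true, zero_ne_one, if_false,
      wirt_wirt_eq (contDiff_wirtBar _ hD) 1 0]
    push_cast
    linear_combination -hnormal
  rw [complexHessian_eq_re_leviForm, hlevi, ofReal_re]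

theorem holDeriv_neg_log {φ : C2 → ℝ} (hφ : DifferentiableAt ℝ φ p) (hφ0 : φ p ≠ 0) (t : C2) :
    holDeriv (fun x => -Real.log (φ x)) p t = -(holDeriv φ p t / φ p) := by
  rw [holDeriv_comp (χ := fun y => -Real.log y) (Real.differentiableAt_log hφ0).neg hφ,
    deriv.fun_neg, Real.deriv_log, ofReal_neg, ofReal_inv]
  ring

theorem complexHessian_neg_log {φ : C2 → ℝ} (hφ : ContDiffAt ℝ 2 φ p) (hφ0 : φ p ≠ 0) (t : C2) :
    complexHessian (fun x => -Real.log (φ x)) p t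
      = ‖holDeriv φ p t‖ ^ 2 / φ p ^ 2 - complexHessian φ p t / φ p := by
  have hderiv : deriv (fun y => -Real.log y) = fun y => -y⁻¹ := by
    funext y
    rw [deriv.fun_neg, Real.deriv_log]
  rw [complexHessian_comp (χ := fun y => -Real.log y) (contDiffAt_id.log hφ0).neg hφ, hderiv,
    deriv.fun_neg, deriv_inv]
  ring

-- For the weight `-log (z ∂d/∂z)` equality holds in both conditions of
-- `isAdmissibleWeight_sub_norm_sq`.
theorem IsBoundaryDistance.isAdmissibleWeight_neg_log_radialDeriv (hd : IsBoundaryDistance Ω d)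
    (hpsc : IsLeviPseudoconvex Ω) (hH : IsHartogs Ω) {τ : ℝ} (hτ0 : 0 ≤ τ) (hτ1 : τ < 1)
    (hp : p ∈ frontier Ω) (hl : leviFn d p = 0) (h0 : wirt 0 (fun x => (d x : ℂ)) p ≠ 0)
    {ε : ℝ} (hε : 0 < ε) (hεp : τ * ε * ‖p‖ ^ 2 < 1 - τ) :
    IsAdmissibleWeight d (fun x => -Real.log (radialDeriv d x) - ε * ‖x‖ ^ 2) τ p := by
  have hdiff := hd.defining.1
  have hE := (hd.eikonal hp).self_of_nhds
  have hR := hd.rotation hH hp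
  obtain ⟨μ, hμ⟩ := hd.exists_fderiv_leviFn_eq hpsc hp hl
  have hφ0 : radialDeriv d p ≠ 0 := radialDeriv_ne_zero hdiff hR h0
  have hφ : ContDiffAt ℝ 2 (radialDeriv d) p :=
    (contDiff_radialDeriv hdiff).contDiffAt.of_le ENat.LEInfty.out
  have hhol : holDeriv (fun x => -Real.log (radialDeriv d x)) p (tangentVec d p)
      = -(2 * leviForm d p (tangentVec d p) (∇ d p)) := by
    rw [holDeriv_neg_log (hφ.differentiableAt (by norm_num)) hφ0,
      holDeriv_radialDeriv hdiff hE hR hl, mul_div_cancel_left₀ _ (ofReal_ne_zero.2 hφ0)]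
  have hhess : complexHessian (fun x => -Real.log (radialDeriv d x)) p (tangentVec d p)
      = μ - ‖2 * leviForm d p (tangentVec d p) (∇ d p)‖ ^ 2 := by
    rw [complexHessian_neg_log hφ hφ0, complexHessian_radialDeriv hdiff hE hR hl h0 hμ,
      holDeriv_radialDeriv hdiff hE hR hl, norm_mul, norm_real, mul_pow, Real.norm_eq_abs, sq_abs,
      mul_div_cancel_left₀ _ (pow_ne_zero 2 hφ0), mul_div_cancel_left₀ _ hφ0]
    ring
  refine hd.isAdmissibleWeight_sub_norm_sq (hφ.log hφ0).neg hτ0 hτ1 hp hε hεp hμ ?_ ?_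
  · rw [hhol]
    ring
  · rw [hhess, hhol, norm_neg, sub_add_cancel]

end Transversal

section Gluing

theorem isClosed_connectedComponentIn {X : Type*} [TopologicalSpace X] {S : Set X}
    (hS : IsClosed S) (p : X) : IsClosed (connectedComponentIn S p) := by
  by_cases hp : p ∈ S
  · exact isClosed_of_closure_subset <|
      isPreconnected_connectedComponentIn.closure.subset_connectedComponentIn
        (subset_closure (mem_connectedComponentIn hp))
        (closure_minimal (connectedComponentIn_subset S p) hS)
  · rw [connectedComponentIn_eq_empty hp]
    exact isClosed_empty

theorem pairwiseDisjoint_componentsOf (S : Set C2) : (componentsOf S).PairwiseDisjoint id := by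
  rintro K ⟨p, -, rfl⟩ K' ⟨q, -, rfl⟩ hne
  refine Set.disjoint_left.2 fun x hx hx' => hne ?_
  rw [connectedComponentIn_eq hx, connectedComponentIn_eq hx']

theorem subset_of_mem_componentsOf {S K : Set C2} (hK : K ∈ componentsOf S) : K ⊆ S := by
  obtain ⟨p, -, rfl⟩ := hK
  exact connectedComponentIn_subset S p

variable {E : Type*} [NormedAddCommGroup E] [InnerProductSpace ℝ E] [FiniteDimensional ℝ E]

theorem exists_contDiff_eventuallyEq_and_eventuallyEq_zero {S T : Set E} (hS : IsClosed S)
    (hT : IsClosed T) (hST : Disjoint S T) {ψ : E → ℝ}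
    (hψ : ∀ p ∈ S, ∀ᶠ x in 𝓝 p, ContDiffAt ℝ ∞ ψ x) :
    ∃ f : E → ℝ, ContDiff ℝ ∞ f ∧ (∀ p ∈ S, f =ᶠ[𝓝 p] ψ) ∧ ∀ p ∈ T, f =ᶠ[𝓝 p] 0 := by
  have hU : IsOpen ({x | ∀ᶠ y in 𝓝 x, ContDiffAt ℝ ∞ ψ y} ∩ Tᶜ) :=
    isOpen_setOfPred_eventually_nhds.inter hT.isOpen_compl
  obtain ⟨χ, hχ, hχ1, hχU, -⟩ := exists_contDiff_one_near hS hU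
    fun p hp => ⟨hψ p hp, Set.disjoint_left.1 hST hp⟩
  refine ⟨fun x => χ x * ψ x, contDiff_mul_of_tsupport_subset hχ
    (fun x hx => Eventually.self_of_nhds hx.1) hχU, fun p hp => ?_, fun p hp => ?_⟩
  · filter_upwards [hχ1 p hp] with x hx
    rw [hx, one_mul]
  · filter_upwards [notMem_tsupport_iff_eventuallyEq.1 fun h => (hχU h).2 hp] with x hx
    rw [hx, Pi.zero_apply, zero_mul]

theorem exists_contDiff_eventuallyEq {𝒮 : Set (Set E)} (hfin : 𝒮.Finite)
    (hclosed : ∀ S ∈ 𝒮, IsClosed S) (hdisj : 𝒮.PairwiseDisjoint id) {ψ : Set E → E → ℝ}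
    (hψ : ∀ S ∈ 𝒮, ∀ p ∈ S, ∀ᶠ x in 𝓝 p, ContDiffAt ℝ ∞ (ψ S) x) :
    ∃ Ψ : E → ℝ, ContDiff ℝ ∞ Ψ ∧ ∀ S ∈ 𝒮, ∀ p ∈ S, Ψ =ᶠ[𝓝 p] ψ S := by
  have hpiece : ∀ S ∈ 𝒮, ∃ f : E → ℝ, ContDiff ℝ ∞ f ∧ (∀ p ∈ S, f =ᶠ[𝓝 p] ψ S) ∧
      ∀ p ∈ ⋃ T ∈ 𝒮 \ {S}, T, f =ᶠ[𝓝 p] 0 := fun S hS =>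
    exists_contDiff_eventuallyEq_and_eventuallyEq_zero (hclosed S hS)
      (hfin.sdiff.isClosed_biUnion fun T hT => hclosed T hT.1)
      (Set.disjoint_iUnion₂_right.2 fun T hT => hdisj hS hT.1 (Ne.symm hT.2)) (hψ S hS)
  choose! f hf hfS hf0 using hpiece
  refine ⟨fun x => ∑ S ∈ hfin.toFinset, f S x,
    ContDiff.sum fun S hS => hf S (hfin.mem_toFinset.1 hS), fun S hS p hp => ?_⟩
  have hothers : ∀ᶠ x in 𝓝 p, ∀ T ∈ 𝒮 \ {S}, f T x = 0 :=
    hfin.sdiff.eventually_all.2 fun T hT =>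
      hf0 T hT.1 p (mem_biUnion (show S ∈ 𝒮 \ {T} from ⟨hS, Ne.symm hT.2⟩) hp)
  filter_upwards [hothers, hfS S hS p hp] with x hx0 hxS
  rw [Finset.sum_eq_single S (fun T hT hTS => hx0 T ⟨hfin.mem_toFinset.1 hT, hTS⟩)
    (fun h => (h (hfin.mem_toFinset.2 hS)).elim), hxS]

end Gluing

section LocalWeights

variable {Ω : Set C2} {d : C2 → ℝ} {τ : ℝ}

theorem IsBoundaryDistance.isClosed_criticalSet (hd : IsBoundaryDistance Ω d) :
    IsClosed (criticalSet Ω) := by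
  have hD := contDiff_ofReal_comp hd.defining.1
  have hset : criticalSet Ω = frontier Ω ∩ ({p | wirt 0 (fun x => (d x : ℂ)) p = 0} ∩
      {p | wirt 0 (wirtBar 0 (fun x => (d x : ℂ))) p = 0}) := by
    ext p
    exact ⟨fun hp => ⟨hp.1, (hd.mem_criticalSet_iff hp.1).1 hp⟩,
      fun hp => (hd.mem_criticalSet_iff hp.1).2 hp.2⟩
  rw [hset]
  exact isClosed_frontier.inter <|
    (isClosed_eq (contDiff_wirt 0 hD).continuous continuous_const).inter
    (isClosed_eq (contDiff_wirt 0 (contDiff_wirtBar 0 hD)).continuous continuous_const)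

theorem IsBoundaryDistance.isClosed_weaklyPseudoconvexPoints (hd : IsBoundaryDistance Ω d)
    (hpsc : IsLeviPseudoconvex Ω) : IsClosed (weaklyPseudoconvexPoints Ω) := by
  have hset : weaklyPseudoconvexPoints Ω = frontier Ω ∩ {p | leviFn d p = 0} := by
    ext p
    exact ⟨fun hp => ⟨hp.1, (hd.mem_weaklyPseudoconvexPoints_iff hpsc hp.1).1 hp⟩,
      fun hp => (hd.mem_weaklyPseudoconvexPoints_iff hpsc hp.1).2 hp.2⟩
  rw [hset]
  exact isClosed_frontier.inter
    (isClosed_eq (contDiff_leviFn hd.defining.1).continuous continuous_const)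

theorem IsBoundaryDistance.isClosed_weakSet₂ (hd : IsBoundaryDistance Ω d)
    (hpsc : IsLeviPseudoconvex Ω) (hsep : weakSet₁ Ω ∩ closure (weakSet₂ Ω) = ∅) :
    IsClosed (weakSet₂ Ω) := by
  refine isClosed_of_closure_subset fun p hp => ?_
  have hpW : p ∈ weaklyPseudoconvexPoints Ω :=
    closure_minimal (fun _ hx => hx.1) (hd.isClosed_weaklyPseudoconvexPoints hpsc) hp
  exact ⟨hpW, fun h0 => hsep.subset ⟨⟨hpW, h0⟩, hp⟩⟩

theorem cos_mul_log_sub_pos {A B c y : ℝ} (hA : 0 < A) (hAy : A ≤ y) (hyB : y ≤ B) (hc : 0 ≤ c)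
    (hlt : c * Real.log (B / A) < Real.pi) :
    0 < Real.cos (c * (Real.log y - (Real.log A + Real.log B) / 2)) := by
  have hy : 0 < y := hA.trans_le hAy
  rw [Real.log_div (hy.trans_le hyB).ne' hA.ne'] at hlt
  have hlogA := mul_le_mul_of_nonneg_left (Real.log_le_log hA hAy) hc
  have hlogB := mul_le_mul_of_nonneg_left (Real.log_le_log hy hyB) hc
  exact Real.cos_pos_of_mem_Ioo ⟨by linarith, by linarith⟩

theorem exists_gt_two_mul_div_mul_lt_pi {C ℓ : ℝ} (hC : 0 ≤ C) (hℓ : 0 ≤ ℓ) (hτ1 : τ < 1)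
    (hτ : τ < Real.pi / (2 * C * ℓ + Real.pi)) :
    ∃ C' > C, 2 * (τ / (1 - τ)) * C' * ℓ < Real.pi := by
  have hlt : 2 * (τ / (1 - τ)) * C * ℓ < Real.pi := by
    rw [lt_div_iff₀ (by positivity)] at hτ
    rw [show 2 * (τ / (1 - τ)) * C * ℓ = 2 * C * ℓ * τ / (1 - τ) by ring,
      div_lt_iff₀ (sub_pos.2 hτ1)]
    linarith
  have hcont : ContinuousAt (fun c => 2 * (τ / (1 - τ)) * c * ℓ) C := by fun_prop
  have hnear : ∀ᶠ c in 𝓝[>] C, 2 * (τ / (1 - τ)) * c * ℓ < Real.pi :=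
    (hcont.eventually_lt continuousAt_const hlt).filter_mono nhdsWithin_le_nhds
  obtain ⟨C', hC', hCC'⟩ := (hnear.and self_mem_nhdsWithin).exists
  exact ⟨C', hCC', hC'⟩

theorem IsBoundaryDistance.norm_wirt_wirtBar_signedBdryDistC (hd : IsBoundaryDistance Ω d) {p : C2}
    (hp : p ∈ frontier Ω) :
    ‖wirt 1 (wirtBar 0 (signedBdryDistC Ω)) p‖
      = ‖wirt 0 (wirtBar 1 (fun x => (d x : ℂ))) p‖ := by
  rw [hd.wirt_wirtBar_signedBdryDistC hp, ← norm_conj, conj_wirt_wirtBar_of_conj_eq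
    ((contDiff_ofReal_comp hd.defining.1).contDiffAt.of_le ENat.LEInfty.out)
    fun x => conj_ofReal (d x)]

theorem IsBoundaryDistance.exists_isAdmissibleWeight_of_annulus (hd : IsBoundaryDistance Ω d)
    (hpsc : IsLeviPseudoconvex Ω) (hH : IsHartogs Ω) (hτ0 : 0 < τ) (hτ1 : τ < 1)
    {K : Set C2} (hK : K ⊆ criticalSet Ω) {A B C : ℝ} (hA : 0 < A) (hAB : A ≤ B) (hC : 0 ≤ C)
    (hABC : ∀ p ∈ K, A ≤ ‖p 0‖ ^ 2 ∧ ‖p 0‖ ^ 2 ≤ B ∧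
        ‖wirt 1 (wirtBar 0 (signedBdryDistC Ω)) p‖ ≤ C / ‖p 0‖)
    (hτ : τ < Real.pi / (2 * C * Real.log (B / A) + Real.pi)) :
    ∃ ψ : C2 → ℝ, (∀ p ∈ K, ∀ᶠ x in 𝓝 p, ContDiffAt ℝ ∞ ψ x) ∧
      ∀ p ∈ K, IsAdmissibleWeight d ψ τ p := by
  obtain ⟨C', hCC', hC'⟩ := exists_gt_two_mul_div_mul_lt_pi hC
    (Real.log_nonneg ((one_le_div hA).2 hAB)) hτ1 hτ
  have hk : 0 < τ / (1 - τ) := div_pos hτ0 (sub_pos.2 hτ1)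
  have hz : ∀ p ∈ K, p 0 ≠ 0 := fun p hp hp0 => by
    have hAp := (hABC p hp).1
    rw [hp0, norm_zero, zero_pow two_ne_zero] at hAp
    exact hA.not_ge hAp
  have hcos : ∀ p ∈ K, 0 < Real.cos (2 * (τ / (1 - τ)) * C'
      * (Real.log (‖p 0‖ ^ 2) - (Real.log A + Real.log B) / 2)) := fun p hp =>
    cos_mul_log_sub_pos hA (hABC p hp).1 (hABC p hp).2.1
      (mul_nonneg (mul_nonneg zero_le_two hk.le) (hC.trans hCC'.le)) hC'
  refine ⟨fun x => radialWeight (τ / (1 - τ)) C' ((Real.log A + Real.log B) / 2) (‖x 0‖ ^ 2),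
    fun p hp => ?_, fun p hp => ?_⟩
  · have hcont := (contDiff_norm_coord_sq 0).continuous.continuousAt (x := p)
    filter_upwards [hcont.eventually (eventually_cos_log_pos
      (pow_ne_zero 2 (norm_ne_zero_iff.2 (hz p hp))) (hcos p hp))] with x hx
    exact ContDiffAt.comp (g := radialWeight _ C' _) x (contDiffAt_radialWeight hx.1 hx.2)
      (contDiff_norm_coord_sq 0).contDiffAt
  · refine hd.isAdmissibleWeight_radialWeight hpsc hH hτ0 hτ1 (hK hp) (hz p hp) ?_ (hcos p hp)
    rw [← hd.norm_wirt_wirtBar_signedBdryDistC (hK hp).1]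
    exact (hABC p hp).2.2.trans_lt
      (div_lt_div_of_pos_right hCC' (norm_pos_iff.2 (hz p hp)))

theorem IsBoundaryDistance.exists_isAdmissibleWeight_of_diskLike (hd : IsBoundaryDistance Ω d)
    (hpsc : IsLeviPseudoconvex Ω) (hH : IsHartogs Ω) (hτ0 : 0 ≤ τ) (hτ1 : τ < 1)
    {K : Set C2} (hK : K ⊆ criticalSet Ω) (hdisk : IsDiskLike K) {ε : ℝ} (hε : 0 < ε)
    (hεΩ : ∀ p ∈ frontier Ω, τ * ε * ‖p‖ ^ 2 < 1 - τ) :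
    ∃ ψ : C2 → ℝ, (∀ p ∈ K, ∀ᶠ x in 𝓝 p, ContDiffAt ℝ ∞ ψ x) ∧
      ∀ p ∈ K, IsAdmissibleWeight d ψ τ p :=
  ⟨fun x => -(ε * ‖x‖ ^ 2),
    fun _ _ => Eventually.of_forall fun _ => (contDiffAt_const.mul (contDiffAt_id.norm_sq ℝ)).neg,
    fun p hp => hd.isAdmissibleWeight_neg_norm_sq hpsc hτ0 hτ1 (hK hp)
      (hd.wirt_wirtBar_one_eq_zero_of_ray hpsc hH (hK hp) fun s hs0 hs1 =>
        hK (hdisk p hp s hs0 hs1))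
      hε (hεΩ p (hK hp).1)⟩

theorem IsBoundaryDistance.exists_isAdmissibleWeight_weakSet₂ (hd : IsBoundaryDistance Ω d)
    (hpsc : IsLeviPseudoconvex Ω) (hH : IsHartogs Ω) (hτ0 : 0 ≤ τ) (hτ1 : τ < 1) {ε : ℝ}
    (hε : 0 < ε) (hεΩ : ∀ p ∈ frontier Ω, τ * ε * ‖p‖ ^ 2 < 1 - τ) :
    ∃ ψ : C2 → ℝ, (∀ p ∈ weakSet₂ Ω, ∀ᶠ x in 𝓝 p, ContDiffAt ℝ ∞ ψ x) ∧
      ∀ p ∈ weakSet₂ Ω, IsAdmissibleWeight d ψ τ p := by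
  have hφ := contDiff_radialDeriv hd.defining.1
  have h0 : ∀ p ∈ weakSet₂ Ω, wirt 0 (fun x => (d x : ℂ)) p ≠ 0 := fun p hp => by
    rw [← hd.wirt_signedBdryDistC hp.1.1]
    exact hp.2
  refine ⟨fun x => -Real.log (radialDeriv d x) - ε * ‖x‖ ^ 2, fun p hp => ?_, fun p hp =>
    hd.isAdmissibleWeight_neg_log_radialDeriv hpsc hH hτ0 hτ1 hp.1.1
      ((hd.mem_weaklyPseudoconvexPoints_iff hpsc hp.1.1).1 hp.1) (h0 p hp) hε (hεΩ p hp.1.1)⟩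
  filter_upwards [hφ.continuous.continuousAt.eventually_ne
    (radialDeriv_ne_zero hd.defining.1 (hd.rotation hH hp.1.1) (h0 p hp))] with x hx
  exact (hφ.contDiffAt.log hx).neg.sub (contDiffAt_const.mul (contDiffAt_id.norm_sq ℝ))

theorem exists_pos_mul_norm_sq_lt {E : Type*} [SeminormedAddCommGroup E] {S : Set E}
    (hS : Bornology.IsBounded S) {a b : ℝ} (hb : 0 < b) :
    ∃ ε > 0, ∀ p ∈ S, a * ε * ‖p‖ ^ 2 < b := by
  obtain ⟨M, hM⟩ := hS.exists_norm_le
  have hcont : ContinuousAt (fun ε : ℝ => |a| * ε * M ^ 2) 0 := by fun_prop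
  have hnear : ∀ᶠ ε in 𝓝[>] (0 : ℝ), |a| * ε * M ^ 2 < b :=
    (hcont.eventually_lt continuousAt_const (by simpa using hb)).filter_mono nhdsWithin_le_nhds
  obtain ⟨ε, hεb, hε⟩ := (hnear.and self_mem_nhdsWithin).exists
  refine ⟨ε, hε, fun p hp => lt_of_le_of_lt ?_ hεb⟩
  have : 0 ≤ ε := le_of_lt hε
  gcongr
  · exact le_abs_self a
  · exact hM p hp

theorem IsBoundaryDistance.exists_mem_of_leviFn_eq_zero (hd : IsBoundaryDistance Ω d)
    (hpsc : IsLeviPseudoconvex Ω) {p : C2} (hp : p ∈ frontier Ω) (hl : leviFn d p = 0) :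
    ∃ S ∈ insert (weakSet₂ Ω) (componentsOf (criticalSet Ω)), p ∈ S := by
  have hw := (hd.mem_weaklyPseudoconvexPoints_iff hpsc hp).2 hl
  by_cases h0 : wirt 0 (signedBdryDistC Ω) p = 0
  · have hcrit : p ∈ criticalSet Ω := hd.weakSet₁_eq_criticalSet hpsc ▸ ⟨hw, h0⟩
    exact ⟨_, Or.inr ⟨p, hcrit, rfl⟩, mem_connectedComponentIn hcrit⟩
  · exact ⟨_, Or.inl rfl, hw, h0⟩

theorem IsBoundaryDistance.exists_contDiff_isAdmissibleWeight (hd : IsBoundaryDistance Ω d)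
    (hbdd : Bornology.IsBounded Ω) (hpsc : IsLeviPseudoconvex Ω) (hH : IsHartogs Ω)
    (hreg : HasRegularWeaklyPseudoconvexPoints Ω) {A B C : Set C2 → ℝ}
    (hABC : ∀ K ∈ annulusLikeComponents Ω, 0 < A K ∧ A K ≤ B K ∧ 0 < C K ∧
      ∀ p ∈ K, A K ≤ ‖p 0‖ ^ 2 ∧ ‖p 0‖ ^ 2 ≤ B K ∧
        ‖wirt 1 (wirtBar 0 (signedBdryDistC Ω)) p‖ ≤ C K / ‖p 0‖)
    (hτ0 : 0 < τ) (hτ1 : τ < 1)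
    (hτ : ∀ K ∈ annulusLikeComponents Ω,
      τ < Real.pi / (2 * C K * Real.log (B K / A K) + Real.pi)) :
    ∃ Ψ : C2 → ℝ, ContDiff ℝ ∞ Ψ ∧
      ∀ p ∈ frontier Ω, leviFn d p = 0 → IsAdmissibleWeight d Ψ τ p := by
  obtain ⟨hsep, hfin, hcomp⟩ := hreg
  have hclosed₂ := hd.isClosed_weakSet₂ hpsc hsep
  rw [hd.weakSet₁_eq_criticalSet hpsc] at hfin hcomp
  obtain ⟨ε, hε, hεΩ⟩ := exists_pos_mul_norm_sq_lt (a := τ)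
    (hbdd.closure.subset frontier_subset_closure) (sub_pos.2 hτ1)
  have hclosed : ∀ S ∈ insert (weakSet₂ Ω) (componentsOf (criticalSet Ω)), IsClosed S := by
    rintro S (rfl | ⟨p, -, rfl⟩)
    · exact hclosed₂
    · exact isClosed_connectedComponentIn hd.isClosed_criticalSet p
  have hdisj : (insert (weakSet₂ Ω) (componentsOf (criticalSet Ω))).PairwiseDisjoint id :=
    (pairwiseDisjoint_componentsOf _).insert fun K hK _ =>
      Set.disjoint_left.2 fun x hx hxK => hx.2 (subset_of_mem_componentsOf hK hxK).2.1
  have hlocal : ∀ S ∈ insert (weakSet₂ Ω) (componentsOf (criticalSet Ω)), ∃ ψ : C2 → ℝ,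
      (∀ p ∈ S, ∀ᶠ x in 𝓝 p, ContDiffAt ℝ ∞ ψ x) ∧ ∀ p ∈ S, IsAdmissibleWeight d ψ τ p := by
    rintro S (rfl | hS)
    · exact hd.exists_isAdmissibleWeight_weakSet₂ hpsc hH hτ0.le hτ1 hε hεΩ
    have hScrit := subset_of_mem_componentsOf hS
    rcases hcomp S hS with hdisk | hann
    · exact hd.exists_isAdmissibleWeight_of_diskLike hpsc hH hτ0.le hτ1 hScrit hdisk hε hεΩ
    · obtain ⟨hA, hAB, hC, hK⟩ := hABC S ⟨hS, hann⟩
      exact hd.exists_isAdmissibleWeight_of_annulus hpsc hH hτ0 hτ1 hScrit hA hAB hC.le hK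
        (hτ S ⟨hS, hann⟩)
  choose! ψ hψ hadm using hlocal
  obtain ⟨Ψ, hΨ, hΨψ⟩ := exists_contDiff_eventuallyEq (hfin.insert _) hclosed hdisj hψ
  refine ⟨Ψ, hΨ, fun p hp hl => ?_⟩
  obtain ⟨S, hS, hpS⟩ := hd.exists_mem_of_leviFn_eq_zero hpsc hp hl
  exact (hadm S hS p hpS).congr_nhds (hΨψ S hS p hpS)

end LocalWeights

section GlobalExtension

/-- A smooth convex nondecreasing function which is constant on `(-∞, -b]` and the identity on
`[-b / 2, ∞)`: the primitive of a smooth step. -/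
noncomputable def convexCutoff (b t : ℝ) : ℝ :=
  -(b / 2) + ∫ s in -(b / 2)..t, Real.smoothTransition (2 * (s + b) / b)

theorem contDiff_smoothTransition_affine (b : ℝ) :
    ContDiff ℝ ∞ fun s : ℝ => Real.smoothTransition (2 * (s + b) / b) :=
  Real.smoothTransition.contDiff.comp (by fun_prop)

theorem hasDerivAt_convexCutoff (b t : ℝ) :
    HasDerivAt (convexCutoff b) (Real.smoothTransition (2 * (t + b) / b)) t :=
  have hcont := (contDiff_smoothTransition_affine b).continuous
  (intervalIntegral.integral_hasDerivAt_right (hcont.intervalIntegrable _ _)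
    (hcont.stronglyMeasurableAtFilter _ _) hcont.continuousAt).const_add _

theorem deriv_convexCutoff (b : ℝ) :
    deriv (convexCutoff b) = fun t => Real.smoothTransition (2 * (t + b) / b) :=
  funext fun t => (hasDerivAt_convexCutoff b t).deriv

theorem contDiff_convexCutoff (b : ℝ) : ContDiff ℝ ∞ (convexCutoff b) := by
  rw [contDiff_infty_iff_deriv, deriv_convexCutoff]
  exact ⟨fun t => (hasDerivAt_convexCutoff b t).differentiableAt,
    contDiff_smoothTransition_affine b⟩

theorem deriv_convexCutoff_nonneg (b t : ℝ) : 0 ≤ deriv (convexCutoff b) t := by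
  rw [deriv_convexCutoff]
  exact Real.smoothTransition.nonneg _

variable {b : ℝ}

theorem monotone_deriv_convexCutoff (hb : 0 < b) : Monotone (deriv (convexCutoff b)) := by
  rw [deriv_convexCutoff]
  exact fun s t hst => Real.smoothTransition.monotone (by gcongr)

theorem convexCutoff_of_neg_half_le (hb : 0 < b) {t : ℝ} (ht : -(b / 2) ≤ t) :
    convexCutoff b t = t := by
  have hstep : ∀ s ∈ uIcc (-(b / 2)) t, Real.smoothTransition (2 * (s + b) / b) = 1 := by
    intro s hs
    rw [uIcc_of_le ht] at hs
    refine Real.smoothTransition.one_of_one_le ?_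
    rw [le_div_iff₀ hb]
    linarith [hs.1]
  rw [convexCutoff, intervalIntegral.integral_congr hstep, intervalIntegral.integral_const,
    smul_eq_mul]
  ring

theorem convexCutoff_eventuallyEq_id (hb : 0 < b) : convexCutoff b =ᶠ[𝓝 0] id := by
  filter_upwards [lt_mem_nhds (show -(b / 2) < 0 by linarith)] with t ht
  exact convexCutoff_of_neg_half_le hb ht.le

theorem convexCutoff_neg (hb : 0 < b) {t : ℝ} (ht : t < 0) : convexCutoff b t < 0 := by
  have hmono : Monotone (convexCutoff b) := monotone_of_deriv_nonneg
    ((contDiff_convexCutoff b).differentiable (by simp)) (deriv_convexCutoff_nonneg b)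
  calc convexCutoff b t ≤ convexCutoff b (max (-(b / 2)) t) := hmono (le_max_right _ _)
    _ = max (-(b / 2)) t := convexCutoff_of_neg_half_le hb (le_max_left _ _)
    _ < 0 := max_lt (by linarith) ht

theorem deriv_convexCutoff_of_le_neg (hb : 0 < b) {t : ℝ} (ht : t ≤ -b) :
    deriv (convexCutoff b) t = 0 := by
  rw [deriv_convexCutoff]
  exact Real.smoothTransition.zero_of_nonpos
    (div_nonpos_of_nonpos_of_nonneg (by linarith) hb.le)

theorem deriv_deriv_convexCutoff_of_le_neg (hb : 0 < b) {t : ℝ} (ht : t ≤ -b) :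
    deriv (deriv (convexCutoff b)) t = 0 := by
  have hmin : IsLocalMin (deriv (convexCutoff b)) t := Eventually.of_forall fun s => by
    rw [deriv_convexCutoff_of_le_neg hb ht]
    exact deriv_convexCutoff_nonneg b s
  exact hmin.deriv_eq_zero

theorem complexHessian_convexCutoff_comp_nonneg (hb : 0 < b) {φ : C2 → ℝ} {x : C2}
    (hφ : ContDiffAt ℝ 2 φ x) {t : C2} (h : φ x ≤ -b ∨ 0 ≤ complexHessian φ x t) :
    0 ≤ complexHessian (fun y => convexCutoff b (φ y)) x t := by
  rw [complexHessian_comp ((contDiff_convexCutoff b).contDiffAt.of_le ENat.LEInfty.out) hφ]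
  rcases h with hx | hx
  · simp [deriv_convexCutoff_of_le_neg hb hx, deriv_deriv_convexCutoff_of_le_neg hb hx]
  · exact add_nonneg (mul_nonneg (deriv_convexCutoff_nonneg b _) hx)
      (mul_nonneg (monotone_deriv_convexCutoff hb).deriv_nonneg (sq_nonneg _))

/-- The conjugate of `χ` by the bijection `y ↦ -(-y) ^ τ` of `(-∞, 0)`, extended by the identity to
`[0, ∞)`. It turns a change of `-(-ρ) ^ τ` into a change of the defining function `ρ`. -/
noncomputable def negRpowConj (τ : ℝ) (χ : ℝ → ℝ) (y : ℝ) : ℝ :=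
  if y < 0 then -((-χ (-((-y) ^ τ))) ^ τ⁻¹) else y

variable {τ : ℝ} {χ : ℝ → ℝ}

theorem comp_neg_rpow_neg (hneg : ∀ t < 0, χ t < 0) {y : ℝ} (hy : y < 0) :
    χ (-((-y) ^ τ)) < 0 :=
  hneg _ (neg_neg_of_pos (Real.rpow_pos_of_pos (neg_pos.2 hy) τ))

theorem neg_rpow_negRpowConj (hτ0 : τ ≠ 0) (hneg : ∀ t < 0, χ t < 0) {y : ℝ} (hy : y < 0) :
    -((-negRpowConj τ χ y) ^ τ) = χ (-((-y) ^ τ)) := by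
  have hpos := neg_pos.2 (comp_neg_rpow_neg (τ := τ) hneg hy)
  rw [negRpowConj, if_pos hy, neg_neg, Real.rpow_inv_rpow hpos.le hτ0, neg_neg]

theorem negRpowConj_neg_iff (hneg : ∀ t < 0, χ t < 0) {y : ℝ} :
    negRpowConj τ χ y < 0 ↔ y < 0 := by
  by_cases hy : y < 0
  · rw [negRpowConj, if_pos hy, neg_lt_zero]
    exact iff_of_true (Real.rpow_pos_of_pos (neg_pos.2 (comp_neg_rpow_neg hneg hy)) _) hy
  · rw [negRpowConj, if_neg hy]

theorem negRpowConj_eventuallyEq_id (hτ0 : 0 < τ) (hid : χ =ᶠ[𝓝 0] id) :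
    negRpowConj τ χ =ᶠ[𝓝 0] id := by
  have hcont : Continuous fun y : ℝ => -((-y) ^ τ) :=
    ((Real.continuous_rpow_const hτ0.le).comp continuous_neg).neg
  have hlim : Tendsto (fun y : ℝ => -((-y) ^ τ)) (𝓝 0) (𝓝 0) := by
    simpa [Real.zero_rpow hτ0.ne'] using hcont.tendsto 0
  filter_upwards [hlim.eventually hid] with y hy
  by_cases hy0 : y < 0
  · rw [negRpowConj, if_pos hy0, hy, id, neg_neg, Real.rpow_rpow_inv (neg_pos.2 hy0).le hτ0.ne',
      neg_neg, id]
  · exact if_neg hy0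

theorem contDiff_negRpowConj (hτ0 : 0 < τ) (hχ : ContDiff ℝ ∞ χ) (hid : χ =ᶠ[𝓝 0] id)
    (hneg : ∀ t < 0, χ t < 0) : ContDiff ℝ ∞ (negRpowConj τ χ) := by
  refine contDiff_iff_contDiffAt.2 fun y => ?_
  rcases lt_trichotomy y 0 with hy | rfl | hy
  · have hinner : ContDiffAt ℝ ∞ (fun y : ℝ => -((-y) ^ τ)) y :=
      (contDiffAt_id.neg.rpow_const_of_ne (neg_ne_zero.2 hy.ne)).neg
    have hcomp : ContDiffAt ℝ ∞ (fun y : ℝ => -χ (-((-y) ^ τ))) y :=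
      (hχ.contDiffAt.comp y hinner).neg
    refine (hcomp.rpow_const_of_ne (p := τ⁻¹)
      (neg_ne_zero.2 (comp_neg_rpow_neg hneg hy).ne)).neg.congr_of_eventuallyEq ?_
    filter_upwards [gt_mem_nhds hy] with s hs
    exact if_pos hs
  · exact contDiffAt_id.congr_of_eventuallyEq (negRpowConj_eventuallyEq_id hτ0 hid)
  · refine contDiffAt_id.congr_of_eventuallyEq ?_
    filter_upwards [lt_mem_nhds hy] with s hs
    exact if_neg hs.not_gt

theorem exists_pos_forall_le_neg_or {X : Type*} [PseudoMetricSpace X] [ProperSpace X] {U : Set X}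
    (hbdd : Bornology.IsBounded U) (hU : IsOpen U) {φ : X → ℝ} (hφ : ContinuousOn φ U)
    (hneg : ∀ x ∈ U, φ x < 0) {P : X → Prop}
    (hP : ∀ p ∈ frontier U, ∀ᶠ x in 𝓝 p, x ∈ U → P x) :
    ∃ b > 0, ∀ x ∈ U, φ x ≤ -b ∨ P x := by
  set K := closure U \ {p | ∀ᶠ x in 𝓝 p, x ∈ U → P x}
  have hKcompact : IsCompact K := hbdd.isCompact_closure.diff isOpen_setOfPred_eventually_nhds
  have hKU : K ⊆ U := by
    rintro x ⟨hx, hxP⟩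
    by_contra hxU
    exact hxP (hP x ⟨hx, by rwa [hU.interior_eq]⟩)
  obtain ⟨b, hb, hbK⟩ := hKcompact.exists_forall_le' (hφ.mono hKU).neg fun x hx =>
    neg_pos.2 (hneg x (hKU hx))
  refine ⟨b, hb, fun x hx => or_iff_not_imp_right.2 fun hxP => le_neg_of_le_neg ?_⟩
  exact hbK x ⟨subset_closure hx, fun h => hxP (h.self_of_nhds hx)⟩

variable {Ω : Set C2} {ρ : C2 → ℝ}

theorem IsDefiningFunction.comp_of_eventuallyEq_id {n : ℕ∞} (hρ : IsDefiningFunction n Ω ρ)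
    {G : ℝ → ℝ} (hG : ContDiff ℝ n G) (hneg : ∀ y, G y < 0 ↔ y < 0) (hid : G =ᶠ[𝓝 0] id) :
    IsDefiningFunction n Ω (fun x => G (ρ x)) := by
  refine ⟨hG.comp hρ.1, ?_, fun p hp => ?_⟩
  · simp only [hneg, ← hρ.2.1]
  · have hlim : Tendsto ρ (𝓝 p) (𝓝 0) := hρ.eq_zero hp ▸ hρ.1.continuous.tendsto p
    have heq : (fun x => G (ρ x)) =ᶠ[𝓝 p] ρ := hlim.eventually hid
    rw [heq.fderiv_eq]
    exact hρ.2.2 p hp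

theorem IsDefiningFunction.mul_exp {n : ℕ∞} (hn : n ≠ 0) (hρ : IsDefiningFunction n Ω ρ)
    {Ψ : C2 → ℝ} (hΨ : ContDiff ℝ n Ψ) :
    IsDefiningFunction n Ω (fun x => ρ x * Real.exp (Ψ x)) := by
  have hn' : (n : WithTop ℕ∞) ≠ 0 := by exact_mod_cast hn
  refine ⟨hρ.1.mul hΨ.exp, ?_, fun p hp => ?_⟩
  · simp only [mul_comm (ρ _), ← smul_eq_mul, smul_neg_iff_of_pos_left (Real.exp_pos _)]
    exact hρ.2.1
  · rw [fderiv_fun_mul (hρ.1.differentiable hn' p) (hΨ.exp.differentiable hn' p), hρ.eq_zero hp,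
      zero_smul, zero_add]
    exact smul_ne_zero (Real.exp_pos _).ne' (hρ.2.2 p hp)

theorem IsDefiningFunction.isDFExponent_of_eventually (hρ : IsDefiningFunction ⊤ Ω ρ)
    (hbdd : Bornology.IsBounded Ω) (hτ0 : 0 < τ) (hτ1 : τ < 1)
    (hpsh : ∀ p ∈ frontier Ω, ∀ᶠ x in 𝓝 p, x ∈ Ω → ∀ t,
      0 ≤ complexHessian (fun y => -((-ρ y) ^ τ)) x t) : IsDFExponent Ω τ := by
  have hρneg : ∀ x ∈ Ω, ρ x < 0 := fun x hx => by rwa [hρ.2.1] at hx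
  have hφ : ∀ x ∈ Ω, ContDiffAt ℝ ∞ (fun y => -((-ρ y) ^ τ)) x := fun x hx =>
    (hρ.1.contDiffAt.neg.rpow_const_of_ne (neg_ne_zero.2 (hρneg x hx).ne)).neg
  obtain ⟨b, hb, hcases⟩ := exists_pos_forall_le_neg_or hbdd hρ.isOpen
    (fun x hx => (hφ x hx).continuousAt.continuousWithinAt)
    (fun x hx => neg_neg_of_pos (Real.rpow_pos_of_pos (neg_pos.2 (hρneg x hx)) τ)) hpsh
  have hχneg : ∀ t < 0, convexCutoff b t < 0 := fun t ht => convexCutoff_neg hb ht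
  have hχid := convexCutoff_eventuallyEq_id hb
  have hcongr : ∀ x ∈ Ω, (fun y => -((-negRpowConj τ (convexCutoff b) (ρ y)) ^ τ)) =ᶠ[𝓝 x]
      fun y => convexCutoff b (-((-ρ y) ^ τ)) := fun x hx => by
    filter_upwards [hρ.isOpen.mem_nhds hx] with y hy
    exact neg_rpow_negRpowConj hτ0.ne' hχneg (hρneg y hy)
  refine ⟨hτ0, hτ1, fun x => negRpowConj τ (convexCutoff b) (ρ x),
    hρ.comp_of_eventuallyEq_id (contDiff_negRpowConj hτ0 (contDiff_convexCutoff b) hχid hχneg)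
      (fun y => negRpowConj_neg_iff hχneg) (negRpowConj_eventuallyEq_id hτ0 hχid),
    fun x hx => ?_, fun x hx t => ?_⟩
  · refine (ContDiffAt.congr_of_eventuallyEq ?_ (hcongr x hx)).contDiffWithinAt
    exact ((contDiff_convexCutoff b).contDiffAt.comp x (hφ x hx)).of_le ENat.LEInfty.out
  · rw [complexHessian_congr_nhds (hcongr x hx)]
    exact complexHessian_convexCutoff_comp_nonneg hb ((hφ x hx).of_le ENat.LEInfty.out)
      ((hcases x hx).imp_right fun h => h t)

theorem IsBoundaryDistance.isDFExponent_of_isAdmissibleWeight {d : C2 → ℝ}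
    (hd : IsBoundaryDistance Ω d) (hbdd : Bornology.IsBounded Ω) (hpsc : IsLeviPseudoconvex Ω)
    (hτ0 : 0 < τ) (hτ1 : τ < 1) {Ψ : C2 → ℝ} (hΨ : ContDiff ℝ ∞ Ψ)
    (hadm : ∀ p ∈ frontier Ω, leviFn d p = 0 → IsAdmissibleWeight d Ψ τ p) :
    IsDFExponent Ω τ := by
  refine (hd.defining.mul_exp (by simp) hΨ).isDFExponent_of_eventually hbdd hτ0 hτ1
    fun p hp => ?_
  rcases (hd.leviFn_nonneg hpsc hp).eq_or_lt with hweak | hstrict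
  · exact hd.eventually_complexHessian_neg_rpow_nonneg_of_isAdmissibleWeight hpsc hΨ hτ0.le hτ1 hp
      (hadm p hp hweak.symm)
  · exact hd.eventually_complexHessian_neg_rpow_nonneg_of_strict hΨ hτ0.le hτ1 hp hstrict

end GlobalExtension

theorem IsDFExponent.le_dfIndex {Ω : Set C2} {τ : ℝ} (h : IsDFExponent Ω τ) : τ ≤ dfIndex Ω :=
  le_csSup ⟨1, fun _ h => h.2.1.le⟩ h

theorem dfIndex_nonneg (Ω : Set C2) : 0 ≤ dfIndex Ω :=
  Real.sSup_nonneg fun _ h => h.1.le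

theorem bddBelow_insert_one_pi_div {ι : Type*} {S : Set ι} {A B C : ι → ℝ}
    (hABC : ∀ K ∈ S, 0 < A K ∧ A K ≤ B K ∧ 0 < C K) :
    BddBelow (insert 1 {q : ℝ | ∃ K ∈ S,
      q = Real.pi / (2 * C K * Real.log (B K / A K) + Real.pi)}) := by
  refine BddBelow.insert 1 ⟨0, ?_⟩
  rintro q ⟨K, hK, rfl⟩
  obtain ⟨hA, hAB, hC⟩ := hABC K hK
  have := Real.log_nonneg ((one_le_div hA).2 hAB)
  positivity

theorem mainTheorem2_general (Ω : Set C2) (hbdd : Bornology.IsBounded Ω)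
    (hsmooth : HasSmoothBoundary Ω) (hpsc : IsLeviPseudoconvex Ω)
    (hHartogs : IsHartogs Ω) (hreg : HasRegularWeaklyPseudoconvexPoints Ω)
    (A B C : Set C2 → ℝ)
    (hABC : ∀ K ∈ annulusLikeComponents Ω,
      0 < A K ∧ A K ≤ B K ∧ 0 < C K ∧
      ∀ p ∈ K, A K ≤ ‖p 0‖ ^ 2 ∧ ‖p 0‖ ^ 2 ≤ B K ∧
        ‖wirt 1 (wirtBar 0 (signedBdryDistC Ω)) p‖ ≤ C K / ‖p 0‖) :
    sInf (insert 1 {q : ℝ | ∃ K ∈ annulusLikeComponents Ω,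
      q = Real.pi / (2 * C K * Real.log (B K / A K) + Real.pi)}) ≤ dfIndex Ω := by
  obtain ⟨d, hd⟩ := exists_isBoundaryDistance hsmooth
  have hbelow := bddBelow_insert_one_pi_div fun K hK =>
    ⟨(hABC K hK).1, (hABC K hK).2.1, (hABC K hK).2.2.1⟩
  refine le_of_forall_lt_imp_le_of_dense fun τ hτ => ?_
  rcases le_or_gt τ 0 with hτ0 | hτ0
  · exact hτ0.trans (dfIndex_nonneg Ω)
  have hτ1 : τ < 1 := hτ.trans_le (csInf_le hbelow (mem_insert _ _))
  have hτK : ∀ K ∈ annulusLikeComponents Ω,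
      τ < Real.pi / (2 * C K * Real.log (B K / A K) + Real.pi) := fun K hK =>
    hτ.trans_le (csInf_le hbelow (mem_insert_of_mem _ ⟨K, hK, rfl⟩))
  obtain ⟨Ψ, hΨ, hadm⟩ :=
    hd.exists_contDiff_isAdmissibleWeight hbdd hpsc hHartogs hreg hABC hτ0 hτ1 hτK
  exact (hd.isDFExponent_of_isAdmissibleWeight hbdd hpsc hτ0 hτ1 hΨ hadm).le_dfIndex

theorem mainTheorem2 (Ω : Set C2)
    (hopen : IsOpen Ω) (hconn : IsConnected Ω) (hbdd : Bornology.IsBounded Ω)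
    (hsmooth : HasSmoothBoundary Ω) (hpsc : IsLeviPseudoconvex Ω)
    (hHartogs : IsHartogs Ω) (hreg : HasRegularWeaklyPseudoconvexPoints Ω)
    (A B C : Set C2 → ℝ)
    (hABC : ∀ K ∈ annulusLikeComponents Ω,
      0 < A K ∧ A K ≤ B K ∧ 0 < C K ∧
      ∀ p ∈ K, A K ≤ ‖p 0‖ ^ 2 ∧ ‖p 0‖ ^ 2 ≤ B K ∧
        ‖wirt 1 (wirtBar 0 (signedBdryDistC Ω)) p‖ ≤ C K / ‖p 0‖) :
    sInf (insert 1 {q : ℝ | ∃ K ∈ annulusLikeComponents Ω,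
      q = Real.pi / (2 * C K * Real.log (B K / A K) + Real.pi)}) ≤ dfIndex Ω :=
  mainTheorem2_general Ω hbdd hsmooth hpsc hHartogs hreg A B C hABC
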